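/- Let $p$ be an odd prime, let $k$ be an algebraically closed field of characteristic $p$, and let $d \geq 3$ be an odd integer with $p \nmid d$. For $t \in k \setminus \{0,1\}$ let $X_t$ denote the smooth projective connected curve over $k$ with affine equation $y^d = x(x-1)(x-t)^{d-1}$, that is, the normalization of $\mathbb{P}^1_k$ in the function field $k(x,y)$ of this plane curve. 1. For every $t \in k \setminus \{0,1\}$ the curve $X_t$ is hyperelliptic (it has genus at least $2$ and admits a morphism of degree $2$ to $\mathbb{P}^1_k$). In fact $X_t$ is birationally equivalent over $k$ to the affine plane curve $$Y^2 = W^{2d} + (2-4t)W^d + 1,$$ in such a way that the hyperelliptic involution $\iota$ of $X_t$ (the non-trivial deck transformation of a morphism of degree $2$ to $\mathbb{P}^1_k$) corresponds to $(Y,W) \mapsto (-Y,W)$. 2. For $t_1, t_2 \in k \setminus \{0,1\}$, the curves $X_{t_1}$ and $X_{t_2}$ are isomorphic over $k$ if and only if $t_2 = t_1$ or $t_2 = 1 - t_1$. 3. Let $\zeta_d \in k$ be a primitive $d$-th root of unity, let $\tau$ be the automorphism $(x,y) \mapsto (x, \zeta_d y)$ of $X_t$, and let $\mathrm{Aut}(X_t,\tau)$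 be the normalizer of $\langle \tau \rangle$ in the group $\mathrm{Aut}(X_t)$ of $k$-automorphisms of $X_t$. If $t \in k \setminus \{0,1\}$ and $t \neq 1/2$, then $\mathrm{Aut}(X_t,\tau) \cong C_2 \times D_d$, where $C_2$ is the cyclic group of order $2$ and $D_d$ is the dihedral group of order $2d$. -/

import Mathlib

open CategoryTheory AlgebraicGeometry Polynomial

noncomputable section

namespace CyclicCover

attribute [local instance] MvPolynomial.gradedAlgebra

universe u

/-! ### The projective line over a field -/

section ProjectiveLine

variable (k : Type u) [Field k]

/-- The projective line `ℙ¹ = Proj k[T₀, T₁]`, as a scheme over `Spec k`. -/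
def P1 : Over (Spec (CommRingCat.of k)) :=
  Over.mk (Proj.toSpecZero (MvPolynomial.homogeneousSubmodule (Fin 2) k) ≫
    Spec.map (CommRingCat.ofHom
      (algebraMap k (MvPolynomial.homogeneousSubmodule (Fin 2) k 0))))

variable {k} {R : Type u} [CommRing R] [Algebra k R]

/-- The ring homomorphism `k[T₀, T₁] → Γ(Spec R)` with `T₀ ↦ r`, `T₁ ↦ 1`. -/
def evalSections (r : R) :
    MvPolynomial (Fin 2) k →+* Γ(Spec (CommRingCat.of R), ⊤) :=
  (Scheme.ΓSpecIso (CommRingCat.of R)).inv.hom.comp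
    (MvPolynomial.aeval (R := k) ![r, 1]).toRingHom

theorem map_irrelevant_evalSections (r : R) :
    (HomogeneousIdeal.irrelevant
      (MvPolynomial.homogeneousSubmodule (Fin 2) k)).toIdeal.map (evalSections r) = ⊤ := by
  rw [Ideal.eq_top_iff_one]
  have h1 : evalSections (k := k) r (MvPolynomial.X 1) = 1 := by
    simp [evalSections]
  rw [← h1]
  apply Ideal.mem_map_of_mem
  rw [HomogeneousIdeal.mem_iff, HomogeneousIdeal.mem_irrelevant_iff,
    GradedRing.proj_apply,
    DirectSum.decompose_of_mem_ne (i := 1) _ (MvPolynomial.isHomogeneous_X k 1) one_ne_zero]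

/-- The morphism `[r : 1] : Spec R ⟶ ℙ¹` over `k` given by an element `r` of a `k`-algebra `R`. -/
def toP1 (r : R) : Spec (CommRingCat.of R) ⟶ (P1 k).left :=
  Proj.fromOfGlobalSections (MvPolynomial.homogeneousSubmodule (Fin 2) k)
    (evalSections r) (map_irrelevant_evalSections r)

end ProjectiveLine

/-! ### Genus and hyperelliptic curves -/

section Hyperelliptic

variable {k : Type u} [Field k]

/-- The function field of an irreducible scheme over `k`, as a `k`-algebra. -/
instance functionFieldAlgebra (X : Over (Spec (CommRingCat.of k))) [IrreducibleSpace X.left] :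
    Algebra k X.left.functionField :=
  ((Scheme.ΓSpecIso (CommRingCat.of k)).inv ≫ X.hom.appTop ≫
    X.left.presheaf.germ ⊤ (genericPoint X.left) trivial).hom.toAlgebra

/-- The regular differentials `H⁰(X, Ω¹)` of a smooth curve `X` over `k`: the differentials `ω` of
the function field of `X` over `k` which, at every point `x`, are of the form `∑ aᵢ dbᵢ` with
`aᵢ, bᵢ` in the local ring `𝒪_{X,x}`. -/
def regularDifferentials (X : Over (Spec (CommRingCat.of k))) [IrreducibleSpace X.left] :
    Submodule k (Ω[X.left.functionField⁄k]) :=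
  ⨅ x : X.left, Submodule.span k
    {ω | ∃ a b : X.left.presheaf.stalk x,
      ω = algebraMap _ X.left.functionField a •
        KaehlerDifferential.D k X.left.functionField (algebraMap _ X.left.functionField b)}

/-- The genus of a smooth projective curve, the dimension of `H⁰(X, Ω¹)`. -/
def genus (X : Over (Spec (CommRingCat.of k))) [IrreducibleSpace X.left] : Cardinal :=
  Module.rank k (regularDifferentials X)

/-- `π : X ⟶ ℙ¹` is a morphism of degree two: finite, flat, and of rank `2`
(a finite morphism from a smooth connected curve onto `ℙ¹` is automatically flat). -/
def IsDoubleCover {X : Over (Spec (CommRingCat.of k))} (π : X ⟶ P1 k) : Prop :=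
  IsFinite π.left ∧ Flat π.left ∧ ∀ s, π.left.finrank s = 2

/-- A smooth projective curve `X` over `k` is hyperelliptic if it is connected, of genus at least
two, and admits a morphism of degree two to the projective line. -/
def IsHyperelliptic (X : Over (Spec (CommRingCat.of k))) : Prop :=
  ∃ _ : IsIntegral X.left, 2 ≤ genus X ∧ ∃ π : X ⟶ P1 k, IsDoubleCover π

/-- A hyperelliptic involution of `X`: the nontrivial deck transformation of a morphism of degree
two to the projective line. -/
def IsHyperellipticInvolution {X : Over (Spec (CommRingCat.of k))} (ι : Aut X) : Prop :=
  ι ≠ 1 ∧ ι * ι = 1 ∧ ∃ π : X ⟶ P1 k, IsDoubleCover π ∧ ι.hom ≫ π = π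

end Hyperelliptic

/-! ### The curves `X_t : y ^ d = x (x - 1) (x - t) ^ (d - 1)` -/

section Family

variable {k : Type u} [Field k] (d : ℕ) (t : k)

/-- The polynomial `y ^ d - x (x - 1) (x - t) ^ (d - 1)` in `k[x][y]`. -/
def cyclicPoly : k[X][X] :=
  X ^ d - C (X * (X - 1) * (X - C t) ^ (d - 1))

/-- The coordinate ring `k[x, y] / (y ^ d - x (x - 1) (x - t) ^ (d - 1))`. -/
abbrev CyclicRing : Type u := AdjoinRoot (cyclicPoly d t)

/-- The function field of the plane curve `y ^ d = x (x - 1) (x - t) ^ (d - 1)`. -/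
abbrev CyclicField : Type u := FractionRing (CyclicRing d t)

/-- The function `x`. -/
def xCoord : CyclicField d t :=
  algebraMap (CyclicRing d t) _ (AdjoinRoot.of (cyclicPoly d t) X)

/-- The function `y`. -/
def yCoord : CyclicField d t :=
  algebraMap (CyclicRing d t) _ (AdjoinRoot.root (cyclicPoly d t))

/-- The smooth projective curve `X_t` over `k` with affine equation
`y ^ d = x (x - 1) (x - t) ^ (d - 1)`: the normalization of `ℙ¹` in the function field
of that plane curve, along the function `x`. -/
def curve : Over (Spec (CommRingCat.of k)) :=
  Over.mk ((toP1 (k := k) (xCoord d t)).fromNormalization ≫ (P1 k).hom)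

/-- The generic point `Spec k(x, y) ⟶ X_t`. -/
def curveGenericPoint : Spec (CommRingCat.of (CyclicField d t)) ⟶ (curve d t).left :=
  (toP1 (k := k) (xCoord d t)).toNormalization

/-- `τ` is the automorphism `(x, y) ↦ (x, ζ y)` of `X_t`. -/
def IsCyclicAut (ζ : k) (τ : Aut (curve d t)) : Prop :=
  ∃ σ : CyclicField d t →ₐ[k] CyclicField d t,
    σ (xCoord d t) = xCoord d t ∧ σ (yCoord d t) = ζ • yCoord d t ∧
      Spec.map (CommRingCat.ofHom σ.toRingHom) ≫ curveGenericPoint d t =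
        curveGenericPoint d t ≫ τ.hom.left

/-- `Aut(X_t, τ)`: the normalizer of `⟨τ⟩` in the group of `k`-automorphisms of `X_t`. -/
abbrev AutNormalizer (τ : Aut (curve d t)) : Subgroup (Aut (curve d t)) :=
  Subgroup.normalizer (Subgroup.zpowers τ : Set (Aut (curve d t)))

/-! ### The plane curve `Y ^ 2 = W ^ (2 d) + (2 - 4 t) W ^ d + 1` -/

/-- The polynomial `Y ^ 2 - (W ^ (2 d) + (2 - 4 t) W ^ d + 1)` in `k[W][Y]`. -/
def hypPoly : k[X][X] :=
  X ^ 2 - C (X ^ (2 * d) + C (2 - 4 * t) * X ^ d + 1)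

/-- The coordinate ring `k[W, Y] / (Y ^ 2 - (W ^ (2 d) + (2 - 4 t) W ^ d + 1))`. -/
abbrev HypRing : Type u := AdjoinRoot (hypPoly d t)

/-- The affine plane curve `Y ^ 2 = W ^ (2 d) + (2 - 4 t) W ^ d + 1` over `k`. -/
def hypCurve : Over (Spec (CommRingCat.of k)) :=
  Over.mk (Spec.map (CommRingCat.ofHom (algebraMap k (HypRing d t))))

/-- The ring homomorphism fixing `k[W]` and mapping `Y` to `-Y`. -/
def negY : HypRing d t →+* HypRing d t :=
  AdjoinRoot.lift (AdjoinRoot.of (hypPoly d t)) (-AdjoinRoot.root (hypPoly d t)) (by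
    have h := AdjoinRoot.eval₂_root (hypPoly d t)
    have hp : ∀ y : HypRing d t, eval₂ (AdjoinRoot.of (hypPoly d t)) y (hypPoly d t) =
        y ^ 2 - AdjoinRoot.of (hypPoly d t) (X ^ (2 * d) + C (2 - 4 * t) * X ^ d + 1) := by
      intro y
      conv_lhs => arg 3; rw [hypPoly]
      rw [eval₂_sub, eval₂_pow, eval₂_X, eval₂_C]
    rw [hp] at h ⊢
    rw [neg_sq]
    exact h)

/-- The involution `(Y, W) ↦ (-Y, W)` of the affine plane curve. -/
def hypCurveInvolution : (hypCurve d t).left ⟶ (hypCurve d t).left :=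
  Spec.map (CommRingCat.ofHom (negY d t))

end Family

end CyclicCover

end

/-!
The function field `K = k(x, y)` of `X_t` is also `k(w, Y)`, where `w = y / (x - t)` and
`Y = 2 x - 1 - w ^ d`. Indeed `w ^ d = x (x - 1) / (x - t)` is quadratic in `x`, with discriminant
`f(w)`, where `f = W ^ (2 d) + (2 - 4 t) W ^ d + 1`, so that `Y ^ 2 = f(w)`
(`isHyperellipticPair_cyclicField`). As `16 t (1 - t) ≠ 0`, the polynomial `f` is separable. All
three claims are read off from such a pair `(w, Y)`, an `IsHyperellipticPair`.

The curve `X_t` is integral and proper over `k` and its local rings are valuation rings, hence by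
the valuative criterion a morphism from its generic point to a proper scheme extends
(`IsCompleteModel.exists_extension`). So `k`-isomorphisms of these curves are the same as
`k`-isomorphisms of their function fields (`IsCompleteModel.exists_iso_of_algEquiv`,
`IsCompleteModel.exists_algEquiv_of_iso`, `IsCompleteModel.exists_mulEquiv_aut`). In particular the
normalization of `ℙ¹` along `w` is the same curve as the normalization along `x`. As `f` is
squarefree, `k[w, Y]` is integrally closed (`IsHyperellipticPair.mem_range_coordHom_iff`), and the
curve is covered by two copies of the affine curve `Y ^ 2 = f(w)`, with coordinates `w, Y` and
`1 / w, Y / w ^ d` (`IsHyperellipticPair.exists_charts`). The function `w` is then the double cover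
of `ℙ¹`, with deck transformation `Y ↦ -Y`, and `dw / Y` and `w dw / Y` are two independent regular
differentials.

The other two claims need the uniqueness of the hyperelliptic pencil. If `(z, U)` is another
hyperelliptic pair of `K`, then `w` and `z` satisfy a polynomial relation of degree at most `2` in
each variable. If `z` were not in `k(w)`, its discriminant, of degree at most `4`, would be a square
times a branch polynomial of degree `2 d ≥ 6`. Hence `k(w) = k(z)`, and `z` is a Möbius function of
`w` (`IsHyperellipticPair.exists_mobius`) which maps the zeros of one branch polynomial to those of
the other. If moreover `w` and `z` are eigenvectors of the same automorphism, which does not fix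
`z`, then the Möbius function is `z = α w` or `z = α / w`, and comparing coefficients gives
`α ^ (2 d) = 1` and `(2 - 4 t') α ^ d = 2 - 4 t` (`IsHyperellipticPair.eq_or_mul_eq`).

For the normalizer of `τ`, this applies to `z = ρ w` with `ρ` in the normalizer, since `ρ w` is an
eigenvector of `ρ τ ρ⁻¹`, a power of `τ`. Here `t' = t ≠ 1 / 2` forces `α ^ d = 1`, so there are
`4 d` automorphisms in the normalizer (`IsHyperellipticPair.nonempty_normalizer_mulEquiv`).

For the isomorphism classes, let `ℓ` be a prime divisor of `d` and `η` a primitive `ℓ`-th root of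
unity. The automorphism group of `K` is finite (`IsHyperellipticPair.finite_algEquiv`), so by
Sylow's theorem `w ↦ η w` and a conjugate of `z ↦ η z` commute with a common automorphism `c` of
order `ℓ` (`exists_commute_conj`). Then `w` and the conjugate of `z` are both eigenvectors of `c`,
hence `α ^ d = ±1`, which gives `t' = t` or `t' = 1 - t` (`IsHyperellipticPair.eq_or_eq_one_sub`).
-/

noncomputable section

namespace CyclicCover

attribute [local instance] MvPolynomial.gradedAlgebra

universe u

theorem aeval_smul_of_isHomogeneous {k : Type*} [CommRing k] {S : Type*} [CommRing S] [Algebra k S]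
    {σ : Type*} {n : ℕ} {p : MvPolynomial σ k} (hp : p.IsHomogeneous n) (a : S) (g : σ → S) :
    MvPolynomial.aeval (fun i => a * g i) p = a ^ n * MvPolynomial.aeval g p := by
  rw [MvPolynomial.aeval_def, MvPolynomial.aeval_def, MvPolynomial.eval₂_eq, MvPolynomial.eval₂_eq,
    Finset.mul_sum]
  refine Finset.sum_congr rfl fun m hm => ?_
  have h : ∑ i ∈ m.support, m i = n := by
    have := hp (MvPolynomial.mem_support_iff.mp hm)
    rw [Finsupp.weight_apply, Finsupp.sum] at this
    simpa using this
  simp_rw [mul_pow, Finset.prod_mul_distrib, Finset.prod_pow_eq_pow_sum, h]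
  ring

/-! ### Morphisms to `Proj` through a standard chart -/

section FromGlobalSections

variable {A : Type u} [CommRing A] {σ : Type*} [SetLike σ A] [AddSubgroupClass σ A]
  (𝒜 : ℕ → σ) [GradedRing 𝒜]

theorem isoOfEq_comp_morphismRestrict {X Z Y W : Scheme.{u}} (f : X ⟶ Y) (V : Y.Opens)
    (U : X.Opens) (hU : f ⁻¹ᵁ V = U) (e : V.toScheme ⟶ Z) (a : Z ⟶ W) (g : Y ⟶ W)
    (h : e ≫ a = V.ι ≫ g) :
    (X.isoOfEq hU).inv ≫ f ∣_ V ≫ e ≫ a = U.ι ≫ f ≫ g := by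
  rw [h, morphismRestrict_ι_assoc, Scheme.isoOfEq_inv, Scheme.homOfLE_ι_assoc]

/-- If a homogeneous element `t` becomes invertible on `X`, the morphism to `Proj` given by
global sections factors through the chart `D₊(t)`. -/
theorem fromOfGlobalSections_eq_awayι {X : Scheme.{u}} (F : A →+* Γ(X, ⊤))
    (hF : (HomogeneousIdeal.irrelevant 𝒜).toIdeal.map F = ⊤) {d : ℕ} {t : A} (hd : 0 < d)
    (ht : t ∈ 𝒜 d) (hu : IsUnit (F t)) (φ : HomogeneousLocalization.Away 𝒜 t →+* Γ(X, ⊤))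
    (hφ : φ = (IsLocalization.Away.lift (S := Localization.Away t) t hu).comp
        (algebraMap _ (Localization.Away t))) :
    Proj.fromOfGlobalSections 𝒜 F hF =
      X.toSpecΓ ≫ Spec.map (CommRingCat.ofHom φ) ≫ Proj.awayι 𝒜 t ht hd := by
  have htop : X.basicOpen (F t) = ⊤ := Scheme.basicOpen_of_isUnit _ hu
  have : IsIso (X.basicOpen (F t)).ι := by
    rw [htop, ← Scheme.topIso_hom]; infer_instance
  rw [← cancel_epi (X.basicOpen (F t)).ι]
  have key : CommRingCat.ofHom ((IsLocalization.map (M := .powers t) (T := .powers (F t))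
      (Localization.Away (F t)) F (by
        rw [← Submonoid.map_le_iff_le_comap, Submonoid.map_powers])).comp
      (algebraMap (HomogeneousLocalization.Away 𝒜 t) (Localization.Away t))) =
      CommRingCat.ofHom φ ≫
        CommRingCat.ofHom (algebraMap Γ(X, ⊤) (Localization.Away (F t))) := by
    rw [← CommRingCat.ofHom_comp, hφ, ← RingHom.comp_assoc]
    congr 2
    apply IsLocalization.ringHom_ext (M := .powers t)
    ext a
    simp
  have e : Proj.toBasicOpenOfGlobalSections 𝒜 F rfl hd ht =
      ((X.basicOpen (F t)).ι ≫ X.toSpecΓ ≫ Spec.map (CommRingCat.ofHom φ)) ≫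
        (Proj.basicOpenIsoSpec 𝒜 t ht hd).inv := by
    unfold Proj.toBasicOpenOfGlobalSections
    simp only [← Category.assoc]
    congr 1
    simp only [Category.assoc]
    refine isoOfEq_comp_morphismRestrict X.toSpecΓ _ _ _ _ _ _ ?_
    rw [key, Spec.map_comp, basicOpenIsoSpecAway_hom_SpecMap_assoc]
  refine ((Proj.openCoverOfMapIrrelevantEqTop 𝒜 F hF).ι_glueMorphisms _ _
    ⟨d, t, hd, ht⟩).trans ?_
  rw [e]
  simp only [Category.assoc]
  rfl

end FromGlobalSections

/-! ### The standard charts of the projective line -/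

section Charts

variable (k : Type u) [Field k]

/-- The coordinate ring of the chart `D₊(T_j)` of `ℙ¹`. -/
abbrev ChartRing (j : Fin 2) : Type u :=
  HomogeneousLocalization.Away (MvPolynomial.homogeneousSubmodule (Fin 2) k) (MvPolynomial.X j)

theorem X_mem_homogeneousSubmodule (j : Fin 2) : (MvPolynomial.X j : MvPolynomial (Fin 2) k) ∈
    MvPolynomial.homogeneousSubmodule (Fin 2) k 1 :=
  MvPolynomial.isHomogeneous_X k j

/-- The chart `D₊(T_j)` of the projective line. -/
def chart (j : Fin 2) : Spec (CommRingCat.of (ChartRing k j)) ⟶ (P1 k).left :=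
  Proj.awayι (MvPolynomial.homogeneousSubmodule (Fin 2) k) (MvPolynomial.X j)
    (X_mem_homogeneousSubmodule k j) one_pos

instance (j : Fin 2) : IsOpenImmersion (chart k j) :=
  inferInstanceAs (IsOpenImmersion (Proj.awayι (MvPolynomial.homogeneousSubmodule (Fin 2) k)
    (MvPolynomial.X j) (X_mem_homogeneousSubmodule k j) one_pos))

/-- The coordinate `T_{1-j} / T_j` on the chart `D₊(T_j)`. -/
def chartCoord (j : Fin 2) : ChartRing k j :=
  HomogeneousLocalization.Away.mk _ (X_mem_homogeneousSubmodule k j) 1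
    (MvPolynomial.X (1 - j)) (by simpa using X_mem_homogeneousSubmodule k (1 - j))

/-- The ring homomorphism `k[T] → Γ(D₊(T_j))` sending `T` to the coordinate of the chart. -/
def polyToChart (j : Fin 2) : k[X] →+* ChartRing k j :=
  eval₂RingHom ((HomogeneousLocalization.fromZeroRingHom
    (MvPolynomial.homogeneousSubmodule (Fin 2) k) _).comp
    (algebraMap k (MvPolynomial.homogeneousSubmodule (Fin 2) k 0))) (chartCoord k j)

variable {k} {R : Type u} [CommRing R] [Algebra k R]

/-- The ring homomorphism `Γ(D₊(T_j)) → R` with `T_i / T_j ↦ g i / g j`. -/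
def chartEval (g : Fin 2 → R) (j : Fin 2) (hu : IsUnit (g j)) : ChartRing k j →+* R :=
  (IsLocalization.Away.lift (S := Localization.Away (MvPolynomial.X j : MvPolynomial (Fin 2) k))
    (g := (MvPolynomial.aeval (R := k) g).toRingHom) (MvPolynomial.X j) (by simpa using hu)).comp
    (algebraMap _ _)

theorem chartEval_mk (g : Fin 2 → R) (j : Fin 2) (hu : IsUnit (g j)) (n : ℕ)
    (p : MvPolynomial (Fin 2) k) (hp) :
    chartEval g j hu (HomogeneousLocalization.Away.mk _ (X_mem_homogeneousSubmodule k j) n p hp) *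
      (g j) ^ n = MvPolynomial.aeval (R := k) g p := by
  have hu' : IsUnit ((MvPolynomial.aeval (R := k) g).toRingHom (MvPolynomial.X j)) := by
    simpa using hu
  have h : Localization.mk p (⟨_, n, rfl⟩ :
      Submonoid.powers (MvPolynomial.X j : MvPolynomial (Fin 2) k)) *
      algebraMap (MvPolynomial (Fin 2) k) (Localization.Away (MvPolynomial.X j))
        (MvPolynomial.X j ^ n) =
      algebraMap (MvPolynomial (Fin 2) k) _ p := by
    rw [Localization.mk_eq_mk']
    exact IsLocalization.mk'_spec (M := .powers (MvPolynomial.X j : MvPolynomial (Fin 2) k)) _ p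
      ⟨_, n, rfl⟩
  have h2 := congr(IsLocalization.Away.lift (MvPolynomial.X j) hu' $h)
  rw [map_mul, IsLocalization.Away.lift_eq, IsLocalization.Away.lift_eq] at h2
  have e : (MvPolynomial.aeval (R := k) g).toRingHom (MvPolynomial.X j ^ n) = g j ^ n := by simp
  rw [e] at h2
  exact h2

theorem chartEval_polyToChart (g : Fin 2 → R) (j : Fin 2) (hu : IsUnit (g j)) (s : R)
    (hs : s * g j = g (1 - j)) (p : k[X]) :
    chartEval g j hu (polyToChart k j p) = aeval s p := by
  have hc : chartEval g j hu (chartCoord k j) = s := by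
    apply hu.mul_right_cancel
    have := chartEval_mk g j hu 1 (MvPolynomial.X (1 - j))
      (by simpa using X_mem_homogeneousSubmodule k (1 - j))
    rw [pow_one, MvPolynomial.aeval_X] at this
    rw [hs]; exact this
  suffices h : (chartEval g j hu).comp (polyToChart k j) = (aeval (R := k) s).toRingHom from
    congr($h p)
  apply Polynomial.ringHom_ext
  · intro a
    simp [polyToChart]
    have := chartEval_mk g j hu 0 (MvPolynomial.C a)
      (by simp)
    rw [pow_zero, mul_one, MvPolynomial.aeval_C] at this
    exact this
  · simp [polyToChart, hc]

theorem polyToChart_injective (j : Fin 2) : Function.Injective (polyToChart k j) := by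
  have hu : IsUnit ((fun i => if i = j then 1 else (X : k[X])) j) := by simp
  have h (p : k[X]) :
      chartEval (fun i => if i = j then 1 else (X : k[X])) j hu (polyToChart k j p) = p := by
    rw [chartEval_polyToChart _ _ _ X (by fin_cases j <;> simp)]
    simp
  exact Function.LeftInverse.injective h

theorem polyToChart_surjective (j : Fin 2) : Function.Surjective (polyToChart k j) := by
  intro z
  obtain ⟨n, p, hp, rfl⟩ :=
    HomogeneousLocalization.Away.mk_surjective _ (X_mem_homogeneousSubmodule k j) z
  refine ⟨MvPolynomial.aeval (R := k) (fun i => if i = j then 1 else (X : k[X])) p, ?_⟩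
  apply HomogeneousLocalization.val_injective
  let L := Localization.Away (MvPolynomial.X j : MvPolynomial (Fin 2) k)
  have hconst (a : k) : (polyToChart k j (C a)).val = algebraMap k L a := by
    have h : polyToChart k j (C a) = HomogeneousLocalization.fromZeroRingHom
        (MvPolynomial.homogeneousSubmodule (Fin 2) k) _ (algebraMap k _ a) := by
      simp [polyToChart]
    rw [h]
    exact Localization.mk_one_eq_algebraMap (M := .powers (MvPolynomial.X j)) (MvPolynomial.C a)
  let v : k[X] →ₐ[k] L :=
    { (algebraMap (ChartRing k j) L).comp (polyToChart k j) with commutes' := hconst }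
  have hX : (MvPolynomial.aeval fun i => algebraMap (MvPolynomial (Fin 2) k) L (MvPolynomial.X j) *
      v (if i = j then 1 else X)) = Algebra.algHom k (MvPolynomial (Fin 2) k) L := by
    ext i
    rw [MvPolynomial.aeval_X]
    change _ = algebraMap (MvPolynomial (Fin 2) k) L (MvPolynomial.X i)
    split_ifs with hij
    · rw [map_one, mul_one, hij]
    · have h1 : i = 1 - j := by
        fin_cases i <;> fin_cases j <;> simp_all
      have h2 : v X = (chartCoord k j).val := by
        change (polyToChart k j X).val = _
        simp [polyToChart]
      rw [h2, chartCoord, HomogeneousLocalization.Away.val_mk, Localization.mk_eq_mk', mul_comm, h1]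
      have := IsLocalization.mk'_spec (M := .powers (MvPolynomial.X j : MvPolynomial (Fin 2) k)) L
        (MvPolynomial.X (1 - j)) ⟨MvPolynomial.X j ^ 1, 1, rfl⟩
      simpa only [pow_one] using this
  have h := aeval_smul_of_isHomogeneous (n := n) (p := p) (by simpa using hp)
    (algebraMap (MvPolynomial (Fin 2) k) L (MvPolynomial.X j)) (fun i => v (if i = j then 1 else X))
  rw [hX] at h
  have hv : v (MvPolynomial.aeval (fun i => if i = j then 1 else X) p) =
      MvPolynomial.aeval (fun i => v (if i = j then 1 else X)) p := by
    rw [← AlgHom.comp_apply, MvPolynomial.comp_aeval]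
  rw [← hv] at h
  change v _ = _
  rw [HomogeneousLocalization.Away.val_mk, Localization.mk_eq_mk', eq_comm,
    IsLocalization.mk'_eq_iff_eq_mul, mul_comm, map_pow]
  exact h

/-- The morphism `[r : 1]` factors through the chart `D₊(T_j)` if its `j`-th coordinate is
invertible. -/
theorem toP1_eq (r : R) (j : Fin 2) (hu : IsUnit (![r, 1] j)) :
    toP1 (k := k) r =
      Spec.map (CommRingCat.ofHom (chartEval (k := k) ![r, 1] j hu)) ≫ chart k j := by
  unfold toP1
  have hu' : IsUnit (evalSections (k := k) r (MvPolynomial.X j)) := by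
    have : evalSections (k := k) r (MvPolynomial.X j) =
      (Scheme.ΓSpecIso (CommRingCat.of R)).inv.hom (![r,1] j) := by simp [evalSections]
    rw [this]
    exact hu.map _
  rw [fromOfGlobalSections_eq_awayι _ _ _ one_pos (X_mem_homogeneousSubmodule k j) hu'
    ((Scheme.ΓSpecIso (CommRingCat.of R)).inv.hom.comp (chartEval ![r, 1] j hu))]
  · rw [CommRingCat.ofHom_comp, Spec.map_comp]
    simp
    rfl
  · unfold chartEval
    rw [← RingHom.comp_assoc]
    congr 1
    apply IsLocalization.ringHom_ext (M := .powers (MvPolynomial.X j : MvPolynomial (Fin 2) k))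
    ext a <;>
    simp [evalSections]

variable (k)

theorem chart_comp_hom (j : Fin 2) : chart k j ≫ (P1 k).hom =
    Spec.map (CommRingCat.ofHom ((polyToChart k j).comp C)) := by
  unfold chart P1
  dsimp only [Over.mk_hom]
  rw [Proj.awayι_toSpecZero_assoc, ← Spec.map_comp, ← CommRingCat.ofHom_comp]
  congr 2
  ext a
  simp [polyToChart]

variable {k}

theorem toP1_comp_hom (r : R) : toP1 (k := k) r ≫ (P1 k).hom =
    Spec.map (CommRingCat.ofHom (algebraMap k R)) := by
  rw [toP1_eq r 1 (by simp), Category.assoc, chart_comp_hom, ← Spec.map_comp,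
    ← CommRingCat.ofHom_comp]
  congr 2
  ext a
  simp only [RingHom.comp_apply]
  rw [chartEval_polyToChart _ _ _ r (by simp)]
  simp

theorem toP1_comp_algHom {S : Type u} [CommRing S] [Algebra k S] (r : R) (φ : R →ₐ[k] S) :
    Spec.map (CommRingCat.ofHom φ.toRingHom) ≫ toP1 (k := k) r = toP1 (k := k) (φ r) := by
  rw [toP1_eq r 1 (by simp), toP1_eq (φ r) 1 (by simp), ← Spec.map_comp_assoc,
    ← CommRingCat.ofHom_comp]
  congr 3
  ext a
  obtain ⟨p, rfl⟩ := polyToChart_surjective 1 a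
  simp only [RingHom.comp_apply]
  rw [chartEval_polyToChart _ _ _ r (by simp), chartEval_polyToChart _ _ _ (φ r) (by simp)]
  exact (aeval_algHom_apply φ r p).symm

variable (k)

theorem adjoin_range_X_eq_top : Algebra.adjoin (MvPolynomial.homogeneousSubmodule (Fin 2) k 0)
    (Set.range (MvPolynomial.X : Fin 2 → MvPolynomial (Fin 2) k)) = ⊤ := by
  rw [eq_top_iff]
  rintro p -
  induction p using MvPolynomial.induction_on with
  | C a =>
    exact Subalgebra.algebraMap_mem _
      (algebraMap k (MvPolynomial.homogeneousSubmodule (Fin 2) k 0) a)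
  | add p q hp hq => exact add_mem hp hq
  | mul_X p i hp => exact mul_mem hp (Algebra.subset_adjoin ⟨i, rfl⟩)

theorem iSup_opensRange_chart : ⨆ j, (chart k j).opensRange = ⊤ := by
  have h (j : Fin 2) : (chart k j).opensRange =
      Proj.basicOpen (MvPolynomial.homogeneousSubmodule (Fin 2) k) (MvPolynomial.X j) :=
    Proj.opensRange_awayι _ _ _ _
  simp_rw [h]
  exact Proj.iSup_basicOpen_eq_top' _ _ (fun i => ⟨1, X_mem_homogeneousSubmodule k i⟩)
    (adjoin_range_X_eq_top k)

instance : IsProper (P1 k).hom := by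
  have : Algebra.FiniteType (MvPolynomial.homogeneousSubmodule (Fin 2) k 0)
      (MvPolynomial (Fin 2) k) := by
    classical
    refine ⟨⟨Finset.univ.image MvPolynomial.X, ?_⟩⟩
    simpa using adjoin_range_X_eq_top k
  have hbij : Function.Bijective
      (algebraMap k (MvPolynomial.homogeneousSubmodule (Fin 2) k 0)) := by
    constructor
    · exact fun a b h => MvPolynomial.C_injective _ _ (congrArg Subtype.val h)
    · rintro ⟨p, hp⟩
      rw [MvPolynomial.homogeneousSubmodule_zero, Submodule.mem_one] at hp
      obtain ⟨a, ha⟩ := hp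
      exact ⟨a, Subtype.ext ha⟩
  have : IsIso (CommRingCat.ofHom
      (algebraMap k (MvPolynomial.homogeneousSubmodule (Fin 2) k 0))) :=
    (ConcreteCategory.isIso_iff_bijective _).mpr hbij
  exact inferInstanceAs (IsProper (Proj.toSpecZero (MvPolynomial.homogeneousSubmodule (Fin 2) k) ≫
    Spec.map (CommRingCat.ofHom
      (algebraMap k (MvPolynomial.homogeneousSubmodule (Fin 2) k 0)))))

end Charts

/-! ### Affine charts of a normalization -/

section NormalizationChart

/-- A chart of the normalization of `Y` in `Spec K`: over an affine chart `Spec A` of `Y` through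
which `Spec K` factors, it is the spectrum of the integral closure of `A` in `K`. -/
theorem exists_isPullback_normalization {Y : Scheme.{u}} {K A B : CommRingCat.{u}}
    (f : Spec K ⟶ Y) [QuasiCompact f] [QuasiSeparated f] (κ : Spec A ⟶ Y) [IsOpenImmersion κ]
    (φ : A ⟶ K) (hf : f = Spec.map φ ≫ κ) (α : A ⟶ B) (i : B ⟶ K) (hφ : α ≫ i = φ)
    (hi : Function.Injective i.hom) (hB : ∀ s : K, s ∈ i.hom.range ↔ φ.hom.IsIntegralElem s) :
    ∃ c : Spec B ⟶ f.normalization,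
      IsPullback c (Spec.map α) f.fromNormalization κ ∧ Spec.map i ≫ c = f.toNormalization := by
  let U : Y.Opens := κ ''ᵁ ⊤
  have hκU : κ ⁻¹ᵁ U = ⊤ := κ.preimage_image_eq ⊤
  have hU : IsAffineOpen U := (isAffineOpen_top _).image_of_isOpenImmersion κ
  have hfU : f ⁻¹ᵁ U = ⊤ := by
    rw [hf, Scheme.Hom.comp_preimage, hκU]
    rfl
  let θ : Γ(Y, U) ⟶ A := κ.appLE U ⊤ hκU.ge ≫ (Scheme.ΓSpecIso A).hom
  let ρ : Γ(Spec K, f ⁻¹ᵁ U) ⟶ K :=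
    (Spec K).presheaf.map (homOfLE hfU.ge).op ≫ (Scheme.ΓSpecIso K).hom
  have hθ : IsIso θ := by
    have : IsIso (κ.appLE U ⊤ hκU.ge) := by
      rw [← Scheme.Hom.appIso_hom' κ ⊤]
      infer_instance
    exact inferInstance
  have hρ : IsIso ρ := by
    have : IsIso (homOfLE hfU.ge) := by
      rw [show homOfLE hfU.ge = eqToHom hfU.symm from rfl]
      infer_instance
    infer_instance
  have hfθ : f.appLE U ⊤ hfU.ge ≫ (Scheme.ΓSpecIso K).hom = θ ≫ φ := by
    subst hf
    have h := Scheme.ΓSpecIso_naturality φ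
    rw [show (Spec.map φ).appTop = (Spec.map φ).appLE ⊤ ⊤ le_top from
      (Spec.map φ).appLE_eq_app.symm] at h
    rw [← Scheme.Hom.appLE_comp_appLE (Spec.map φ) κ U ⊤ ⊤ hκU.ge le_top, Category.assoc,
      Category.assoc, h]
  have hcomm : f.app U ≫ ρ = θ ≫ φ := by
    rw [← hfθ, ← Category.assoc, Scheme.Hom.appLE]
  let V := f.fromNormalization ⁻¹ᵁ U
  have hV : IsAffineOpen V := hU.preimage _
  have hηV : f.toNormalization ⁻¹ᵁ V = f ⁻¹ᵁ U := by
    rw [← Scheme.Hom.comp_preimage, Scheme.Hom.toNormalization_fromNormalization]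
  have hle : (⊤ : (Spec K).Opens) ≤ f.toNormalization ⁻¹ᵁ V := by rw [hηV, hfU]
  let ψ : Γ(f.normalization, V) ⟶ K :=
    f.toNormalization.appLE V ⊤ hle ≫ (Scheme.ΓSpecIso K).hom
  algebraize [(f.app U).hom]
  have hψ : ψ = (f.normalizationObjIso hU).hom ≫
      CommRingCat.ofHom (Subalgebra.val _).toRingHom ≫ ρ := by
    have := f.normalizationObjIso_hom_val hU
    rw [← Category.assoc]
    refine Eq.trans ?_ (congrArg (· ≫ ρ) this.symm)
    simp only [ψ, ρ, ← Category.assoc]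
    congr 1
  have hρbij : Function.Bijective ρ.hom := ConcreteCategory.bijective_of_isIso ρ
  have hθbij : Function.Bijective θ.hom := ConcreteCategory.bijective_of_isIso θ
  have hψinj : Function.Injective ψ.hom := by
    rw [hψ]
    exact hρbij.1.comp (Subtype.val_injective.comp
      (ConcreteCategory.bijective_of_isIso (f.normalizationObjIso hU).hom).1)
  have hint (s) : IsIntegral Γ(Y, U) s ↔ φ.hom.IsIntegralElem (ρ.hom s) := by
    have h1 : ρ.hom.comp (f.app U).hom = φ.hom.comp θ.hom := congr(($hcomm).hom)
    constructor
    · rintro ⟨p, hp, hs⟩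
      refine ⟨p.map θ.hom, hp.map _, ?_⟩
      rw [eval₂_map, ← h1, ← hom_eval₂]
      exact (congrArg ρ.hom hs).trans (map_zero _)
    · rintro ⟨p, hp, hs⟩
      obtain ⟨q, rfl, -, hq⟩ := lifts_and_natDegree_eq_and_monic
        (mem_lifts_of_surjective (f := θ.hom) hθbij.2 p) hp
      refine ⟨q, hq, hρbij.1 ?_⟩
      rw [eval₂_map, ← h1, ← hom_eval₂] at hs
      exact hs.trans (map_zero _).symm
  have hrange (s : K) : s ∈ ψ.hom.range ↔ s ∈ i.hom.range := by
    rw [hB]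
    obtain ⟨s, rfl⟩ := hρbij.2 s
    rw [← hint, hψ]
    constructor
    · rintro ⟨a, ha⟩
      rw [← hρbij.1 ha]
      exact ((f.normalizationObjIso hU).hom a).2
    · intro h
      obtain ⟨a, ha⟩ :=
        (ConcreteCategory.bijective_of_isIso (f.normalizationObjIso hU).hom).2 ⟨s, h⟩
      exact ⟨a, congr(ρ.hom ($ha).1)⟩
  let γ : Γ(f.normalization, V) ⟶ B := CommRingCat.ofHom
    ((RingEquiv.ofLeftInverse (Function.leftInverse_invFun hi)).symm.toRingHom.comp
      (ψ.hom.codRestrict i.hom.range fun a => (hrange _).mp ⟨a, rfl⟩))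
  have hγ : γ ≫ i = ψ := by
    ext a
    have := (RingEquiv.ofLeftInverse (Function.leftInverse_invFun hi)).apply_symm_apply
      (ψ.hom.codRestrict i.hom.range (fun a => (hrange _).mp ⟨a, rfl⟩) a)
    exact congrArg Subtype.val this
  have hγ' (a) : i.hom (γ.hom a) = ψ.hom a := congr($hγ a)
  have hγiso : IsIso γ := by
    rw [ConcreteCategory.isIso_iff_bijective]
    refine ⟨fun a b hab => hψinj ?_, fun b => ?_⟩
    · rw [← hγ', ← hγ']
      exact congrArg i.hom hab
    · obtain ⟨a, ha⟩ := (hrange _).mpr ⟨b, rfl⟩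
      exact ⟨a, hi ((hγ' a).trans ha)⟩
  have hκ : Spec.map θ ≫ hU.fromSpec = κ := by
    have := IsAffineOpen.SpecMap_appLE_fromSpec κ hU (isAffineOpen_top _) hκU.ge
    rw [Spec.map_comp, Category.assoc, this, IsAffineOpen.fromSpec_top]
    simp
  have hη : Spec.map ψ ≫ hV.fromSpec = f.toNormalization := by
    have := IsAffineOpen.SpecMap_appLE_fromSpec f.toNormalization hV (isAffineOpen_top _) hle
    rw [Spec.map_comp, Category.assoc, this, IsAffineOpen.fromSpec_top]
    simp
  refine ⟨Spec.map γ ≫ hV.fromSpec, ?_, ?_⟩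
  · refine (IsOpenImmersion.isPullback _ _ _ _ ?_ ?_).flip
    · have : Mono i := ConcreteCategory.mono_of_injective _ hi
      have h2 : f.fromNormalization.app U ≫ γ = θ ≫ α := by
        rw [← cancel_mono i, Category.assoc, Category.assoc, hγ, hφ, ← hfθ, ← Category.assoc]
        congr 1
        rw [Scheme.Hom.app_eq_appLE, Scheme.Hom.appLE_comp_appLE]
        simp only [Scheme.Hom.toNormalization_fromNormalization]
      rw [Category.assoc, ← IsAffineOpen.SpecMap_appLE_fromSpec _ hU hV le_rfl, ← hκ,
        ← Spec.map_comp_assoc, ← Spec.map_comp_assoc, ← h2, Scheme.Hom.app_eq_appLE]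
    · rw [Scheme.Hom.opensRange_comp_of_isIso, hV.opensRange_fromSpec,
        ← Scheme.Hom.image_top_eq_opensRange]
  · rw [← Spec.map_comp_assoc, hγ, hη]

end NormalizationChart

/-! ### Complete curves and their function fields -/

section FunctionFieldModels

/-- A partial map defined at `x` is given at the generic point by its restriction to the local ring
at `x`. -/
theorem fromFunctionField_eq {X Y : Scheme.{u}} [IrreducibleSpace X] (f : X.PartialMap Y) {x : X}
    (hxf : x ∈ f.domain) (hx : genericPoint X ⤳ x) :
    f.fromFunctionField = Spec.map (X.presheaf.stalkSpecializes hx) ≫ f.fromSpecStalkOfMem hxf := by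
  rw [Scheme.PartialMap.fromFunctionField, Scheme.PartialMap.fromSpecStalkOfMem,
    Scheme.PartialMap.fromSpecStalkOfMem, ← Category.assoc]
  congr 1
  rw [← cancel_mono f.domain.ι, Category.assoc, Scheme.Opens.fromSpecStalkOfMem_ι,
    Scheme.Opens.fromSpecStalkOfMem_ι, Scheme.SpecMap_stalkSpecializes_fromSpecStalk]

/-- The existence part of the valuative criterion, for a valuation ring `A` whose fraction field is
given by a homomorphism `φ : A →+* L`. -/
theorem exists_lift_of_valuationRing {A L : Type u} [CommRing A] [IsDomain A] [ValuationRing A]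
    [Field L] (φ : A →+* L) (hφ : @IsFractionRing A _ L _ φ.toAlgebra) {Y S : Scheme.{u}}
    (s : Y ⟶ S) [UniversallyClosed s] (i₁ : Spec (.of L) ⟶ Y) (i₂ : Spec (.of A) ⟶ S)
    (h : i₁ ≫ s = Spec.map (CommRingCat.ofHom φ) ≫ i₂) :
    ∃ l : Spec (.of A) ⟶ Y, Spec.map (CommRingCat.ofHom φ) ≫ l = i₁ ∧ l ≫ s = i₂ := by
  let := φ.toAlgebra
  let T : ValuativeCommSq s := { R := A, K := L, i₁ := i₁, i₂ := i₂, commSq := ⟨h⟩ }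
  have hs : (ValuativeCriterion.Existence ⊓ @QuasiCompact) s := by
    rw [← UniversallyClosed.eq_valuativeCriterion]
    infer_instance
  obtain ⟨⟨l, h1, h2⟩⟩ := (hs.1 T).exists_lift
  exact ⟨l, h1, h2⟩

variable {k : Type u} [Field k]

/-- `X` is a complete curve over `k` with function field `K`, where `η : Spec K ⟶ X` is the generic
point: `X` is integral and proper over `k`, and all its local rings are valuation rings. -/
structure IsCompleteModel {K : Type u} [Field K] [Algebra k K] (X : Over (Spec (CommRingCat.of k)))
    (η : Spec (CommRingCat.of K) ⟶ X.left) : Prop where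
  isIntegral : IsIntegral X.left
  isProper : IsProper X.hom
  valuationRing (x : X.left) : ValuationRing (X.left.presheaf.stalk x)
  exists_iso : ∃ e : X.left.functionField ≅ CommRingCat.of K,
    Spec.map e.hom ≫ X.left.fromSpecStalk _ = η
  comp_hom : η ≫ X.hom = Spec.map (CommRingCat.ofHom (algebraMap k K))

namespace IsCompleteModel

variable {K : Type u} [Field K] [Algebra k K] {X : Over (Spec (CommRingCat.of k))}
    {η : Spec (CommRingCat.of K) ⟶ X.left} (hX : IsCompleteModel X η)

include hX

theorem mono : Mono η := by
  obtain ⟨e, he⟩ := hX.exists_iso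
  rw [← he]
  infer_instance

theorem isDominant : IsDominant η := by
  have := hX.isIntegral
  obtain ⟨e, he⟩ := hX.exists_iso
  have h : IsDominant (X.left.fromSpecStalk (genericPoint X.left)) := by
    constructor
    rw [DenseRange, Scheme.range_fromSpecStalk]
    refine Dense.mono (s₁ := {genericPoint X.left}) ?_ ?_
    · rintro _ rfl
      exact specializes_rfl
    · exact dense_iff_closure_eq.mpr (genericPoint_closure _)
  rw [← he]
  infer_instance

/-- A morphism from a complete curve is determined by its value at the generic point. -/
theorem hom_ext {Y : Over (Spec (CommRingCat.of k))} [IsSeparated Y.hom] {f g : X ⟶ Y}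
    (h : η ≫ f.left = η ≫ g.left) : f = g := by
  have := hX.isIntegral
  have := hX.isDominant
  ext1
  exact ext_of_isDominant_of_isSeparated Y.hom (by simp) η h

/-- A `k`-morphism from the generic point of a complete curve to a proper `k`-scheme extends
to the curve. -/
theorem exists_extension {Y : Over (Spec (CommRingCat.of k))} [IsProper Y.hom]
    (g : Spec (CommRingCat.of K) ⟶ Y.left)
    (hg : g ≫ Y.hom = Spec.map (CommRingCat.ofHom (algebraMap k K))) :
    ∃ f : X ⟶ Y, η ≫ f.left = g := by
  have := hX.isIntegral
  have := hX.isDominant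
  obtain ⟨e, he⟩ := hX.exists_iso
  have : Y.left.IsSeparated := by
    have : IsSeparated (Y.hom ≫ Limits.terminal.from _) := inferInstance
    refine ⟨?_⟩
    rwa [Subsingleton.elim (Limits.terminal.from Y.left) (Y.hom ≫ Limits.terminal.from _)]
  let g' : Spec X.left.functionField ⟶ Y.left := Spec.map e.inv ≫ g
  have hg' : g' ≫ Y.hom = X.left.fromSpecStalk _ ≫ X.hom := by
    have h := hX.comp_hom
    simp only [← he, Category.assoc] at h
    rw [Category.assoc, hg, ← h, ← Spec.map_comp_assoc, e.hom_inv_id, Spec.map_id,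
      Category.id_comp]
  let R : X.left ⤏ Y.left := Scheme.RationalMap.ofFunctionField X.hom Y.hom g' hg'
  -- By the valuative criterion, `g` extends to the local ring at every point.
  have hR : R.domain = ⊤ := by
    rw [eq_top_iff]
    rintro x -
    rw [Scheme.RationalMap.mem_domain]
    have := hX.valuationRing x
    have hx : genericPoint X.left ⤳ x := (genericPoint_spec X.left).specializes trivial
    have hsp : Spec.map (X.left.presheaf.stalkSpecializes hx) ≫ X.left.fromSpecStalk x =
      X.left.fromSpecStalk _ := Scheme.SpecMap_stalkSpecializes_fromSpecStalk hx
    have : IsDomain (X.left.presheaf.stalk x) := inferInstance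
    obtain ⟨φ, h1, h2⟩ := exists_lift_of_valuationRing (A := X.left.presheaf.stalk x)
      (L := X.left.functionField) (X.left.presheaf.stalkSpecializes hx).hom
      (inferInstanceAs (IsFractionRing (X.left.presheaf.stalk x) X.left.functionField)) Y.hom g'
      (X.left.fromSpecStalk x ≫ X.hom) (by
        rw [hg', ← hsp, Category.assoc]
        rfl)
    change Spec.map (X.left.presheaf.stalkSpecializes hx) ≫ φ = g' at h1
    refine ⟨Scheme.PartialMap.ofFromSpecStalk X.hom Y.hom φ h2,
      Scheme.PartialMap.mem_domain_ofFromSpecStalk _ _ _ _, ?_⟩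
    apply Scheme.RationalMap.eq_of_fromFunctionField_eq
    rw [Scheme.RationalMap.fromFunctionField_ofFunctionField,
      Scheme.RationalMap.fromFunctionField_toRationalMap, ← h1]
    have h3 := Scheme.PartialMap.fromSpecStalkOfMem_ofFromSpecStalk X.hom Y.hom φ h2
    refine Eq.trans (fromFunctionField_eq _ (Scheme.PartialMap.mem_domain_ofFromSpecStalk _ _ _ _)
      hx) ?_
    rw [h3]
  let f₀ : X.left ⟶ Y.left :=
    X.left.topIso.inv ≫ (X.left.isoOfEq hR).inv ≫ R.toPartialMap.hom
  have h4 : R = f₀.toRationalMap := by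
    rw [← R.toRationalMap_toPartialMap]
    congr 1
    refine Scheme.PartialMap.ext _ _ hR ?_
    simp only [f₀, Scheme.Hom.toPartialMap_hom, Iso.hom_inv_id_assoc]
    exact (Iso.hom_inv_id_assoc _ _).symm
  have h5 : X.left.fromSpecStalk _ ≫ f₀ = g' := by
    rw [← Scheme.PartialMap.fromSpecStalkOfMem_toPartialMap,
      ← Scheme.RationalMap.fromFunctionField_ofFunctionField X.hom Y.hom g' hg']
    exact congrArg Scheme.RationalMap.fromFunctionField h4.symm
  have h6 : η ≫ f₀ = g := by
    rw [← he, Category.assoc, h5, ← Spec.map_comp_assoc, e.inv_hom_id, Spec.map_id,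
      Category.id_comp]
  refine ⟨Over.homMk f₀ ?_, h6⟩
  refine ext_of_isDominant η ?_
  rw [← Category.assoc, h6, hg, hX.comp_hom]

variable {K' : Type u} [Field K'] [Algebra k K'] {X' : Over (Spec (CommRingCat.of k))}
    {η' : Spec (CommRingCat.of K') ⟶ X'.left} (hX' : IsCompleteModel X' η')

include hX'

/-- An isomorphism of function fields is induced by an isomorphism of complete curves. -/
theorem exists_iso_of_algEquiv (σ : K' ≃ₐ[k] K) :
    ∃ φ : X ≅ X', η ≫ φ.hom.left = Spec.map (CommRingCat.ofHom (σ : K' →+* K)) ≫ η' := by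
  have := hX.isProper
  have := hX'.isProper
  obtain ⟨f, hf⟩ := hX.exists_extension (Spec.map (CommRingCat.ofHom (σ : K' →+* K)) ≫ η') (by
    rw [Category.assoc, hX'.comp_hom, ← Spec.map_comp, ← CommRingCat.ofHom_comp]
    congr 2
    exact σ.toAlgHom.comp_algebraMap)
  obtain ⟨g, hg⟩ := hX'.exists_extension (Spec.map (CommRingCat.ofHom (σ.symm : K →+* K')) ≫ η) (by
    rw [Category.assoc, hX.comp_hom, ← Spec.map_comp, ← CommRingCat.ofHom_comp]
    congr 2
    exact σ.symm.toAlgHom.comp_algebraMap)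
  refine ⟨⟨f, g, hX.hom_ext ?_, hX'.hom_ext ?_⟩, hf⟩
  · rw [Over.comp_left, reassoc_of% hf, hg, ← Spec.map_comp_assoc, ← CommRingCat.ofHom_comp,
      show (σ : K' →+* K).comp (σ.symm : K →+* K') = .id K from by ext; simp]
    simp
  · rw [Over.comp_left, reassoc_of% hg, hf, ← Spec.map_comp_assoc, ← CommRingCat.ofHom_comp,
      show (σ.symm : K →+* K').comp (σ : K' →+* K) = .id K' from by ext; simp]
    simp

theorem exists_algHom_of_iso (φ : X ≅ X') : ∃ σ : K' →ₐ[k] K,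
    η ≫ φ.hom.left = Spec.map (CommRingCat.ofHom (σ : K' →+* K)) ≫ η' := by
  have := hX.isIntegral
  have := hX'.isIntegral
  obtain ⟨e, he⟩ := hX.exists_iso
  obtain ⟨e', he'⟩ := hX'.exists_iso
  have : IsIso φ.hom.left := inferInstanceAs (IsIso ((Over.forget _).map φ.hom))
  have h0 : Spec.map e'.inv ≫ η' = X'.left.fromSpecStalk _ :=
    (congrArg (Spec.map e'.inv ≫ ·) he'.symm).trans (by
      simp only [← Spec.map_comp_assoc, e'.hom_inv_id, Spec.map_id, Category.id_comp])
  have h1 : φ.hom.left (genericPoint X.left) = genericPoint X'.left :=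
    genericPoint_eq_of_isOpenImmersion _
  let ρ : CommRingCat.of K' ⟶ CommRingCat.of K := e'.inv ≫
    X'.left.presheaf.stalkSpecializes (specializes_of_eq h1) ≫
      φ.hom.left.stalkMap (genericPoint X.left) ≫ e.hom
  have hρ : η ≫ φ.hom.left = Spec.map ρ ≫ η' := by
    simp only [ρ, Spec.map_comp, Category.assoc]
    rw [h0, Scheme.SpecMap_stalkSpecializes_fromSpecStalk, Scheme.SpecMap_stalkMap_fromSpecStalk,
      ← Category.assoc]
    exact congrArg (· ≫ φ.hom.left) he.symm
  refine ⟨⟨ρ.hom, fun a => ?_⟩, hρ⟩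
  have h2 : Spec.map (CommRingCat.ofHom (algebraMap k K') ≫ ρ) =
      Spec.map (CommRingCat.ofHom (algebraMap k K)) := by
    rw [Spec.map_comp, ← hX'.comp_hom, ← Category.assoc, ← hρ, Category.assoc, Over.w,
      hX.comp_hom]
  exact congr($(Spec.map_injective h2) a)

omit hX' in
theorem algHom_ext {σ τ : K →ₐ[k] K'} {f : Spec (CommRingCat.of K') ⟶ X.left}
    (hσ : f = Spec.map (CommRingCat.ofHom (σ : K →+* K')) ≫ η)
    (hτ : f = Spec.map (CommRingCat.ofHom (τ : K →+* K')) ≫ η) : σ = τ := by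
  have := hX.mono
  have h := Spec.map_injective ((cancel_mono η).mp (hσ.symm.trans hτ))
  ext a
  exact congr($h a)

/-- An isomorphism of complete curves induces an isomorphism of their function fields. -/
theorem exists_algEquiv_of_iso (φ : X ≅ X') : ∃ σ : K' ≃ₐ[k] K,
    η ≫ φ.hom.left = Spec.map (CommRingCat.ofHom (σ : K' →+* K)) ≫ η' := by
  obtain ⟨σ, hσ⟩ := exists_algHom_of_iso hX hX' φ
  obtain ⟨τ, hτ⟩ := exists_algHom_of_iso hX' hX φ.symm
  refine ⟨AlgEquiv.ofAlgHom σ τ ?_ ?_, hσ⟩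
  · refine hX.algHom_ext (f := η) ?_ (by simp)
    have h : η ≫ φ.hom.left ≫ φ.inv.left = η := by simp
    rw [reassoc_of% hσ] at h
    erw [hτ] at h
    rw [← Spec.map_comp_assoc] at h
    exact h.symm
  · refine hX'.algHom_ext (f := η') ?_ (by simp)
    have h : η' ≫ φ.inv.left ≫ φ.hom.left = η' := by simp
    erw [reassoc_of% hτ] at h
    rw [hσ, ← Spec.map_comp_assoc] at h
    exact h.symm

omit hX' in
/-- The automorphism group of a complete curve is the automorphism group of its function field. -/
theorem exists_mulEquiv_aut : ∃ Φ : (K ≃ₐ[k] K) ≃* Aut X, ∀ σ : K ≃ₐ[k] K,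
    η ≫ (Φ σ).hom.left = Spec.map (CommRingCat.ofHom (σ.symm : K →+* K)) ≫ η := by
  choose F hF using fun σ : K ≃ₐ[k] K => exists_iso_of_algEquiv hX hX σ.symm
  have := hX.isProper
  let Φ : (K ≃ₐ[k] K) →* Aut X := MonoidHom.mk' F fun σ τ => by
    ext1
    refine hX.hom_ext ?_
    refine (hF _).trans ?_
    change _ = η ≫ ((F τ).hom ≫ (F σ).hom).left
    rw [Over.comp_left, reassoc_of% hF τ, hF σ, ← Spec.map_comp_assoc]
    rfl
  refine ⟨MulEquiv.ofBijective Φ ⟨fun σ τ h => ?_, fun φ => ?_⟩, hF⟩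
  · have h1 := hF τ
    rw [← show F σ = F τ from h] at h1
    have h2 : σ.symm.toAlgHom = τ.symm.toAlgHom := hX.algHom_ext (hF σ) h1
    ext a
    have := congr(σ ($h2 (τ a)))
    simpa using this.symm
  · obtain ⟨σ, hσ⟩ := exists_algEquiv_of_iso hX hX φ
    refine ⟨σ.symm, ?_⟩
    ext1
    exact hX.hom_ext ((hF _).trans hσ.symm)

end IsCompleteModel

end FunctionFieldModels

/-! ### The normalization of the projective line in a function field -/

section Models

variable {k : Type u} [Field k]

/-- The chart `D₊(T_j)` of the projective line, with coordinate ring identified with `k[X]`. -/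
def lineChart (j : Fin 2) : Spec (CommRingCat.of k[X]) ⟶ (P1 k).left :=
  have : IsIso (CommRingCat.ofHom (polyToChart k j)) :=
    (ConcreteCategory.isIso_iff_bijective _).mpr
      ⟨polyToChart_injective j, polyToChart_surjective j⟩
  inv (Spec.map (CommRingCat.ofHom (polyToChart k j))) ≫ chart k j

theorem specMap_polyToChart_comp_lineChart (j : Fin 2) :
    Spec.map (CommRingCat.ofHom (polyToChart k j)) ≫ lineChart j = chart k j := by
  have : IsIso (CommRingCat.ofHom (polyToChart k j)) :=
    (ConcreteCategory.isIso_iff_bijective _).mpr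
      ⟨polyToChart_injective j, polyToChart_surjective j⟩
  exact IsIso.hom_inv_id_assoc _ _

instance (j : Fin 2) : IsOpenImmersion (lineChart (k := k) j) := by
  unfold lineChart
  infer_instance

theorem iSup_opensRange_lineChart : ⨆ j, (lineChart (k := k) j).opensRange = ⊤ := by
  rw [← iSup_opensRange_chart k]
  congr 1
  ext1 j
  have : IsIso (CommRingCat.ofHom (polyToChart k j)) :=
    (ConcreteCategory.isIso_iff_bijective _).mpr
      ⟨polyToChart_injective j, polyToChart_surjective j⟩
  rw [← Scheme.Hom.opensRange_comp_of_isIso (Spec.map (CommRingCat.ofHom (polyToChart k j)))]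
  simp only [specMap_polyToChart_comp_lineChart]

variable {K : Type u} [Field K] [Algebra k K]

/-- The morphism `[r : 1]` in terms of the chart with coordinate `r⁻¹` (for `j = 0`) or `r` (for
`j = 1`). -/
theorem toP1_eq_lineChart {r : K} (hr : r ≠ 0) (j : Fin 2) :
    toP1 (k := k) r = Spec.map (CommRingCat.ofHom
      (aeval (R := k) ((![r⁻¹, r] : Fin 2 → K) j)).toRingHom) ≫ lineChart j := by
  have hu : IsUnit ((![r, 1] : Fin 2 → K) j) := by fin_cases j <;> simp [hr]
  rw [toP1_eq r j hu, ← specMap_polyToChart_comp_lineChart, ← Spec.map_comp_assoc,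
    ← CommRingCat.ofHom_comp]
  congr 3
  refine RingHom.ext fun p => ?_
  exact chartEval_polyToChart _ j hu _ (by fin_cases j <;> simp [hr]) p

open IntermediateField in
/-- A separating transcendence basis `{r}` of a function field `K` of one variable over `k`. -/
structure IsSeparatingParameter (k : Type u) [Field k] {K : Type u} [Field K] [Algebra k K]
    (r : K) : Prop where
  transcendental : Transcendental k r
  finite : FiniteDimensional k⟮r⟯ K
  separable : Algebra.IsSeparable k⟮r⟯ K

open IntermediateField in
theorem adjoin_simple_inv (r : K) : k⟮r⁻¹⟯ = k⟮r⟯ := by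
  apply le_antisymm <;> rw [adjoin_simple_le_iff]
  · exact inv_mem (mem_adjoin_simple_self k r)
  · simpa using inv_mem (mem_adjoin_simple_self k r⁻¹)

open IntermediateField in
theorem isFractionRing_adjoin_simple {r : K} (hr : Transcendental k r) :
    @IsFractionRing k[X] _ k⟮r⟯ _ (aeval (R := k) (AdjoinSimple.gen k r)).toRingHom.toAlgebra := by
  let : Algebra k[X] k⟮r⟯ := (aeval (R := k) (AdjoinSimple.gen k r)).toRingHom.toAlgebra
  have hmap (p : k[X]) : ((algebraMap k[X] k⟮r⟯ p : k⟮r⟯) : K) = aeval r p := by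
    change algebraMap k⟮r⟯ K (aeval (AdjoinSimple.gen k r) p) = _
    rw [← aeval_algebraMap_apply]
    rfl
  have : FaithfulSMul k[X] k⟮r⟯ := by
    refine (faithfulSMul_iff_algebraMap_injective _ _).mpr fun p q hpq => ?_
    apply transcendental_iff_injective.mp hr
    rw [← hmap, ← hmap, hpq]
  refine IsFractionRing.of_field _ _ fun z => ?_
  obtain ⟨p, q, hpq⟩ := (mem_adjoin_simple_iff k (z : K)).mp z.2
  refine ⟨p, q, Subtype.ext ?_⟩
  rw [hpq, IntermediateField.coe_div, hmap, hmap]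

namespace IsSeparatingParameter

variable {r : K} (hr : IsSeparatingParameter k r)

include hr

theorem ne_zero : r ≠ 0 := by
  rintro rfl
  exact hr.transcendental isAlgebraic_zero

theorem inv : IsSeparatingParameter k r⁻¹ := by
  refine ⟨fun h => hr.transcendental (by simpa using h.inv), ?_, ?_⟩
  · rw [adjoin_simple_inv]
    exact hr.finite
  · rw [adjoin_simple_inv]
    exact hr.separable

theorem chartValue (j : Fin 2) : IsSeparatingParameter k ((![r⁻¹, r] : Fin 2 → K) j) := by
  fin_cases j
  · exact hr.inv
  · exact hr

open IntermediateField in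
/-- The integral closure `B` of `k[r]` in `K`, as a `k[X]`-algebra. -/
theorem exists_integralClosure : ∃ (B : CommRingCat.{u}) (α : CommRingCat.of k[X] ⟶ B)
    (i : B ⟶ CommRingCat.of K), α ≫ i = CommRingCat.ofHom (aeval (R := k) r).toRingHom ∧
    Function.Injective i.hom ∧
    (∀ s : K, s ∈ i.hom.range ↔ (aeval (R := k) r).toRingHom.IsIntegralElem s) ∧
    IsDedekindDomain B ∧ @IsFractionRing B _ K _ i.hom.toAlgebra ∧
    @Module.Finite k[X] B _ _ α.hom.toModule ∧ @Module.Free k[X] B _ _ α.hom.toModule ∧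
    @Module.finrank k[X] B _ _ α.hom.toModule = Module.finrank k⟮r⟯ K := by
  let : Algebra k[X] K := (aeval (R := k) r).toRingHom.toAlgebra
  let : Algebra k[X] k⟮r⟯ := (aeval (R := k) (AdjoinSimple.gen k r)).toRingHom.toAlgebra
  have hst : IsScalarTower k[X] k⟮r⟯ K := by
    refine .of_algebraMap_eq fun p => ?_
    change aeval r p = algebraMap k⟮r⟯ K (aeval (AdjoinSimple.gen k r) p)
    rw [← aeval_algebraMap_apply]
    rfl
  have hinj : Function.Injective (algebraMap k[X] K) :=
    transcendental_iff_injective.mp hr.transcendental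
  have : FaithfulSMul k[X] K := (faithfulSMul_iff_algebraMap_injective _ _).mpr hinj
  have : Module.IsTorsionFree k[X] K := inferInstance
  have : IsFractionRing k[X] k⟮r⟯ := isFractionRing_adjoin_simple hr.transcendental
  have := hr.finite
  have := hr.separable
  refine ⟨.of (integralClosure k[X] K), CommRingCat.ofHom (algebraMap _ _),
    CommRingCat.ofHom (algebraMap _ _), ?_, Subtype.val_injective, ?_, ?_, ?_, ?_, ?_, ?_⟩
  · rfl
  · intro s
    constructor
    · rintro ⟨x, rfl⟩
      exact x.2
    · intro h
      exact ⟨⟨s, h⟩, rfl⟩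
  · exact IsIntegralClosure.isDedekindDomain k[X] k⟮r⟯ K (integralClosure k[X] K)
  · exact IsIntegralClosure.isFractionRing_of_finite_extension k[X] k⟮r⟯ K (integralClosure k[X] K)
  · exact IsIntegralClosure.finite k[X] k⟮r⟯ K (integralClosure k[X] K)
  · exact IsIntegralClosure.module_free k[X] k⟮r⟯ K (integralClosure k[X] K)
  · exact IsIntegralClosure.rank k[X] k⟮r⟯ K (integralClosure k[X] K)

end IsSeparatingParameter

theorem valuationRing_of_isLocalization_atPrime {B S : Type*} [CommRing B] [IsDedekindDomain B]
    (P : Ideal B) [P.IsPrime] [CommRing S] [IsDomain S] [Algebra B S]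
    [IsLocalization.AtPrime S P] : ValuationRing S := by
  have : IsLocalRing S := IsLocalization.AtPrime.isLocalRing S P
  have : IsDedekindDomain S := IsLocalization.AtPrime.isDedekindDomain B P S
  have : IsPrincipalIdealRing S := by
    have := ((tfae_of_isNoetherianRing_of_isLocalRing_of_isDomain S).out 0 2).mpr ‹_›
    infer_instance
  infer_instance

/-- A point in the range of a chart with Dedekind coordinate ring has a valuation ring as its
local ring. -/
theorem valuationRing_stalk {X : Scheme.{u}} [IsIntegral X] {B : CommRingCat.{u}}
    [IsDedekindDomain B] (c : Spec B ⟶ X) [IsOpenImmersion c] (y : Spec B) :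
    ValuationRing (X.presheaf.stalk (c y)) := by
  have : ValuationRing ((Spec B).presheaf.stalk y) :=
    @valuationRing_of_isLocalization_atPrime B _ _ _ y.asIdeal y.isPrime _ _
      (StructureSheaf.stalkAlgebra B y)
      (StructureSheaf.IsLocalization.to_stalk B y)
  exact Function.Surjective.valuationRing (inv (c.stalkMap y)).hom
    (ConcreteCategory.bijective_of_isIso (inv (c.stalkMap y))).2

/-- The generic point of an integral scheme, described by a chart `Spec B` and the fraction field
of `B`. -/
theorem exists_functionField_iso {X : Scheme.{u}} [IsIntegral X] {B : CommRingCat.{u}} [IsDomain B]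
    (c : Spec B ⟶ X) [IsOpenImmersion c] {K : Type u} [Field K] (i : B ⟶ CommRingCat.of K)
    (hi : @IsFractionRing B _ K _ i.hom.toAlgebra) :
    ∃ e : X.functionField ≅ CommRingCat.of K,
      Spec.map e.hom ≫ X.fromSpecStalk _ = Spec.map i ≫ c := by
  let := i.hom.toAlgebra
  let e₀ : (Spec B).functionField ≃ₐ[B] K :=
    IsLocalization.algEquiv (nonZeroDivisors B) _ _
  have h1 : c (genericPoint (Spec B)) = genericPoint X := genericPoint_eq_of_isOpenImmersion c
  have h2 : IsIso (X.presheaf.stalkSpecializes (specializes_of_eq h1)) := by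
    rw [← TopCat.Presheaf.stalkCongr_inv X.presheaf (Inseparable.of_eq h1)]
    infer_instance
  let e₁ : (Spec B).functionField ≅ CommRingCat.of K := e₀.toRingEquiv.toCommRingCatIso
  refine ⟨asIso (X.presheaf.stalkSpecializes (specializes_of_eq h1)) ≪≫
    asIso (c.stalkMap (genericPoint (Spec B))) ≪≫ e₁, ?_⟩
  simp only [Iso.trans_hom, asIso_hom, Spec.map_comp, Category.assoc]
  rw [Scheme.SpecMap_stalkSpecializes_fromSpecStalk, Scheme.SpecMap_stalkMap_fromSpecStalk,
    ← Category.assoc]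
  congr 1
  have h3 : StructureSheaf.toStalk B (genericPoint (Spec B)) ≫ e₁.hom = i := by
    ext b
    exact e₀.commutes b
  exact (congrArg (Spec.map e₁.hom ≫ ·) (AlgebraicGeometry.Spec.fromSpecStalk_eq' B _)).trans
    ((Spec.map_comp _ _).symm.trans (congrArg Spec.map h3))

variable (r : K)

/-- The smooth projective curve with function field `K`: the normalization of `ℙ¹` in `K` along a
separating parameter `r`. -/
def model : Over (Spec (CommRingCat.of k)) :=
  Over.mk ((toP1 (k := k) r).fromNormalization ≫ (P1 k).hom)

/-- The generic point of `model r`. -/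
def modelGenericPoint : Spec (CommRingCat.of K) ⟶ (model (k := k) r).left :=
  (toP1 (k := k) r).toNormalization

/-- The morphism to the projective line given by `r`. -/
def modelToP1 : model (k := k) r ⟶ P1 k :=
  Over.homMk (toP1 (k := k) r).fromNormalization rfl

theorem modelGenericPoint_comp_modelToP1 :
    modelGenericPoint r ≫ (modelToP1 (k := k) r).left = toP1 r :=
  Scheme.Hom.toNormalization_fromNormalization _

variable {r}

open IntermediateField in
/-- The charts of `model r`: the chart over `D₊(T_j)` is the spectrum of the integral closure of
`k[r⁻¹]` or `k[r]` in `K`, a Dedekind domain which is free of rank `[K : k(r)]` over `k[X]`. -/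
theorem IsSeparatingParameter.exists_chart (hr : IsSeparatingParameter k r) (j : Fin 2) :
    ∃ (B : CommRingCat.{u}) (α : CommRingCat.of k[X] ⟶ B) (i : B ⟶ CommRingCat.of K)
      (c : Spec B ⟶ (model (k := k) r).left),
      IsPullback c (Spec.map α) (modelToP1 r).left (lineChart j) ∧
      Spec.map i ≫ c = modelGenericPoint r ∧
      α ≫ i = CommRingCat.ofHom (aeval (R := k) ((![r⁻¹, r] : Fin 2 → K) j)).toRingHom ∧
      IsDedekindDomain B ∧ @IsFractionRing B _ K _ i.hom.toAlgebra ∧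
      @Module.Finite k[X] B _ _ α.hom.toModule ∧ @Module.Free k[X] B _ _ α.hom.toModule ∧
      @Module.finrank k[X] B _ _ α.hom.toModule = Module.finrank k⟮r⟯ K := by
  obtain ⟨B, α, i, h1, h2, h3, h4, h5, h6, h7, h8⟩ := (hr.chartValue j).exists_integralClosure
  obtain ⟨c, hc, hc'⟩ := exists_isPullback_normalization (toP1 (k := k) r) (lineChart j) _
    (toP1_eq_lineChart hr.ne_zero j) α i h1 h2 h3
  refine ⟨B, α, i, c, hc, hc', h1, h4, h5, h6, h7, h8.trans ?_⟩
  fin_cases j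
  · exact congrArg (fun F : IntermediateField k K => Module.finrank F K) (adjoin_simple_inv r)
  · rfl

/-- A property of morphisms which is local on the target can be checked over the two standard charts
of `ℙ¹`. -/
theorem of_lineChart_isPullback (P : MorphismProperty Scheme.{u}) [IsZariskiLocalAtTarget P]
    {X : Scheme.{u}} (f : X ⟶ (P1 k).left)
    (h : ∀ j : Fin 2, ∃ (U : Scheme.{u}) (c : U ⟶ X) (g : U ⟶ Spec (CommRingCat.of k[X])),
      IsPullback c g f (lineChart j) ∧ P g) : P f := by
  apply IsZariskiLocalAtTarget.of_iSup_eq_top _ (iSup_opensRange_lineChart (k := k))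
  intro j
  obtain ⟨U, c, g, hc, hg⟩ := h j
  rw [P.arrow_mk_iso_iff (morphismRestrictOpensRange f _)]
  rw [← hc.isoPullback_hom_snd] at hg
  exact (P.cancel_left_of_respectsIso _ _).mp hg

theorem exists_lineChart_eq (y : (P1 k).left) :
    ∃ (j : Fin 2) (z : Spec (CommRingCat.of k[X])), lineChart j z = y := by
  have : y ∈ (⨆ j, (lineChart (k := k) j).opensRange) := by
    rw [iSup_opensRange_lineChart]
    trivial
  simpa using this

instance [hr : Fact (IsSeparatingParameter k r)] : IsFinite (modelToP1 (k := k) r).left := by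
  have : IsZariskiLocalAtTarget @IsFinite :=
    @HasAffineProperty.instIsZariskiLocalAtTarget @IsFinite _
      IsFinite.instHasAffinePropertyAndIsAffineFiniteCarrierObjOppositeOpensCarrierCarrierCommRingCatPresheafOpOpensTopHomAppTop
  refine of_lineChart_isPullback @IsFinite _ fun j => ?_
  obtain ⟨B, α, i, c, hc, -, -, -, -, h, -, -⟩ := hr.out.exists_chart j
  exact ⟨_, c, _, hc, (IsFinite.SpecMap_iff _).mpr h⟩

instance [hr : Fact (IsSeparatingParameter k r)] : Flat (modelToP1 (k := k) r).left := by
  have : IsZariskiLocalAtTarget @Flat :=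
    HasRingHomProperty.instIsZariskiLocalAtTarget @Flat
  refine of_lineChart_isPullback @Flat _ fun j => ?_
  obtain ⟨B, α, i, c, hc, -, -, -, -, h, h', -⟩ := hr.out.exists_chart j
  refine ⟨_, c, _, hc, Flat.SpecMap_iff.mpr ?_⟩
  let := α.hom.toAlgebra
  exact (inferInstance : Module.Flat k[X] B)

open IntermediateField in
/-- The morphism `r` to `ℙ¹` has degree `[K : k(r)]`. -/
theorem finrank_modelToP1 (hr : IsSeparatingParameter k r) (y : (P1 k).left) :
    (modelToP1 (k := k) r).left.finrank y = Module.finrank k⟮r⟯ K := by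
  have := Fact.mk hr
  obtain ⟨j, z, rfl⟩ := exists_lineChart_eq y
  obtain ⟨B, α, i, c, hc, -, -, -, -, h, h', h''⟩ := hr.exists_chart j
  rw [← Scheme.Hom.finrank_of_isPullback _ _ _ _ hc, ← h'']
  let := α.hom.toAlgebra
  have : Module.Finite k[X] B := h
  have : Module.Free k[X] B := h'
  refine (Scheme.Hom.finrank_SpecMap_algebraMap k[X] B z).trans ?_
  rw [Module.rankAtStalk_eq_finrank_of_free]
  rfl

theorem isCompleteModel_model (hr : IsSeparatingParameter k r) :
    IsCompleteModel (model (k := k) r) (modelGenericPoint r) := by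
  have := Fact.mk hr
  have hint : IsIntegral (model (k := k) r).left :=
    inferInstanceAs (IsIntegral (toP1 (k := k) r).normalization)
  refine ⟨hint, ?_, ?_, ?_, ?_⟩
  · have h : IsProper ((modelToP1 (k := k) r).left ≫ (P1 k).hom) := inferInstance
    exact h
  · intro x
    obtain ⟨j, z, hz⟩ := exists_lineChart_eq ((modelToP1 (k := k) r).left x)
    obtain ⟨B, α, i, c, hc, -, -, hB, -⟩ := hr.exists_chart j
    have : IsOpenImmersion c := MorphismProperty.of_isPullback hc.flip inferInstance
    obtain ⟨y, rfl, -⟩ := Scheme.exists_preimage_of_isPullback hc x z hz.symm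
    exact valuationRing_stalk c y
  · obtain ⟨B, α, i, c, hc, hc', -, hB, hB', -⟩ := hr.exists_chart 1
    have : IsOpenImmersion c := MorphismProperty.of_isPullback hc.flip inferInstance
    rw [← hc']
    exact exists_functionField_iso c i hB'
  · change modelGenericPoint r ≫ (modelToP1 (k := k) r).left ≫ (P1 k).hom = _
    rw [← Category.assoc, modelGenericPoint_comp_modelToP1, toP1_comp_hom]

end Models

/-! ### Polynomial relations between two functions -/

section BoundedRelations

variable {k : Type u} [Field k]

theorem coeff_coeff_swap (p : k[X][X]) (i j : ℕ) :
    ((Bivariate.swap p).coeff i).coeff j = (p.coeff j).coeff i := by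
  induction p using Polynomial.induction_on' with
  | add p q hp hq => simp [hp, hq]
  | monomial n a =>
    induction a using Polynomial.induction_on' with
    | add a b ha hb => simp only [map_add, coeff_add, ha, hb]
    | monomial m r =>
      rw [Bivariate.swap_monomial_monomial]
      simp only [coeff_monomial]
      split_ifs <;> simp [coeff_monomial, *]

theorem natDegree_coeff_le_natDegree_swap (p : k[X][X]) (j : ℕ) :
    (p.coeff j).natDegree ≤ (Bivariate.swap p).natDegree := by
  refine natDegree_le_iff_coeff_eq_zero.mpr fun i hi => ?_
  rw [← coeff_coeff_swap, coeff_eq_zero_of_natDegree_lt hi, coeff_zero]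

variable {K : Type u} [Field K] [Algebra k K]

/-- The value at `(x, y)` of a polynomial in `k[X][Y]`. -/
def evalPair (x y : K) : k[X][X] →+* K := eval₂RingHom (aeval (R := k) x).toRingHom y

@[simp] theorem evalPair_C (x y : K) (p : k[X]) : evalPair x y (C p) = aeval x p :=
  eval₂_C _ _

@[simp] theorem evalPair_X (x y : K) : evalPair (k := k) x y X = y :=
  eval₂_X _ _

theorem evalPair_swap (x y : K) (p : k[X][X]) :
    evalPair y x (Bivariate.swap p) = evalPair x y p := by
  induction p using Polynomial.induction_on' with
  | add p q hp hq => simp [hp, hq]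
  | monomial n a =>
    induction a using Polynomial.induction_on' with
    | add a b ha hb => simp only [map_add, ha, hb]
    | monomial m r =>
      rw [Bivariate.swap_monomial_monomial]
      simp only [← C_mul_X_pow_eq_monomial, map_mul, map_pow, evalPair_C, evalPair_X, aeval_C,
        aeval_X]
      ring

theorem aeval_ne_zero {x : K} (hx : Transcendental k x) {p : k[X]} (hp : p ≠ 0) :
    aeval x p ≠ 0 := fun h => hx ⟨p, hp, h⟩

/-- Some irreducible factor of a polynomial relation between `x` and `y` is itself a relation. -/
theorem exists_irreducible_relation {x y : K} {P : k[X][X]} (hP0 : P ≠ 0)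
    (hP : evalPair x y P = 0) : ∃ m, Irreducible m ∧ m ∣ P ∧ evalPair x y m = 0 := by
  classical
  obtain ⟨s, hs, hs'⟩ := UniqueFactorizationMonoid.exists_prime_factors P hP0
  obtain ⟨u, hu⟩ := hs'
  rw [← hu, map_mul, mul_eq_zero, or_iff_left (u.isUnit.map (evalPair x y)).ne_zero,
    map_multiset_prod, Multiset.prod_eq_zero_iff, Multiset.mem_map] at hP
  obtain ⟨m, hm, hm'⟩ := hP
  exact ⟨m, (hs m hm).irreducible, (Multiset.dvd_prod hm).trans ⟨u, hu.symm⟩, hm'⟩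

/-- If `y` has degree at most `a` over `k(x)` and `x` has degree at most `b` over `k(y)`, then `x`
and `y` satisfy a single polynomial relation of degree at most `a` in `y` and `b` in `x`. By
Gauss's lemma, an irreducible relation divides every relation. -/
theorem exists_bounded_relation {x y : K} (hx : Transcendental k x) {a b : ℕ} {P Q : k[X][X]}
    (hP0 : P ≠ 0) (hP : evalPair x y P = 0) (hPa : P.natDegree ≤ a)
    (hQ0 : Q ≠ 0) (hQ : evalPair y x Q = 0) (hQb : Q.natDegree ≤ b) :
    ∃ m : k[X][X], m ≠ 0 ∧ evalPair x y m = 0 ∧ m.natDegree ≤ a ∧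
      ∀ i, (m.coeff i).natDegree ≤ b := by
  obtain ⟨m, hm, hmP, hm0⟩ := exists_irreducible_relation hP0 hP
  refine ⟨m, hm.ne_zero, hm0, (natDegree_le_of_dvd hmP hP0).trans hPa, ?_⟩
  have hmdeg : m.natDegree ≠ 0 := by
    intro h
    rw [eq_C_of_natDegree_eq_zero h, evalPair_C] at hm0
    refine aeval_ne_zero hx (fun h0 => hm.ne_zero ?_) hm0
    rw [eq_C_of_natDegree_eq_zero h, h0, C_0]
  have hprim := hm.isPrimitive hmdeg
  have hinj : Function.Injective (aeval (R := k) x).toRingHom :=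
    transcendental_iff_injective.mp hx
  have hdvd : m ∣ Bivariate.swap Q := by
    by_contra hndvd
    rw [hprim.dvd_iff_fraction_map_dvd_fraction_map (FractionRing k[X])] at hndvd
    obtain ⟨u, v, huv⟩ := ((hprim.irreducible_iff_irreducible_map_fraction_map
      (K := FractionRing k[X])).mp hm).coprime_iff_not_dvd.mpr hndvd
    let φ : FractionRing k[X] →+* K := IsFractionRing.lift hinj
    have hφ : φ.comp (algebraMap k[X] (FractionRing k[X])) = (aeval (R := k) x).toRingHom :=
      RingHom.ext fun p => IsFractionRing.lift_algebraMap hinj p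
    have heval (p : k[X][X]) :
        eval₂ φ y (p.map (algebraMap k[X] (FractionRing k[X]))) = evalPair x y p := by
      rw [eval₂_map, hφ]
      rfl
    have := congrArg (eval₂ φ y) huv
    rw [eval₂_add, eval₂_mul, eval₂_mul, heval, heval, hm0, evalPair_swap, hQ] at this
    simp at this
  intro i
  refine (natDegree_coeff_le_natDegree_swap m i).trans (le_trans ?_ hQb)
  obtain ⟨q, hq⟩ := hdvd
  have : Q = Bivariate.swap m * Bivariate.swap q := by
    rw [← map_mul, ← hq, Bivariate.swap_swap_apply]
  exact natDegree_le_of_dvd ⟨_, this⟩ hQ0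

end BoundedRelations

/-! ### Hyperelliptic function fields and the uniqueness of the pencil -/

section HyperellipticPairs

variable {k : Type u} [Field k] {K : Type u} [Field K] [Algebra k K] {d : ℕ} {t : k}

/-- The polynomial `X ^ (2 d) + (2 - 4 t) X ^ d + 1`. -/
def branchPoly (d : ℕ) (t : k) : k[X] := X ^ (2 * d) + C (2 - 4 * t) * X ^ d + 1

theorem natDegree_branchPoly (hd : d ≠ 0) : (branchPoly d t).natDegree = 2 * d := by
  unfold branchPoly
  rw [natDegree_add_eq_left_of_natDegree_lt, natDegree_add_eq_left_of_natDegree_lt, natDegree_X_pow]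
  · refine (natDegree_C_mul_X_pow_le _ _).trans_lt ?_
    rw [natDegree_X_pow]
    omega
  · rw [natDegree_add_eq_left_of_natDegree_lt, natDegree_X_pow, natDegree_one]
    · omega
    · refine (natDegree_C_mul_X_pow_le _ _).trans_lt ?_
      rw [natDegree_X_pow]
      omega

theorem branchPoly_ne_zero (hd : d ≠ 0) : branchPoly d t ≠ 0 := by
  intro h
  have := natDegree_branchPoly (t := t) hd
  rw [h, natDegree_zero] at this
  omega

/-- With `f` the branch polynomial and `V = 2 W ^ d + 2 - 4 t`, one has `W f' = d W ^ d V` and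
`4 f - V ^ 2 = 16 t (1 - t)`. -/
theorem separable_branchPoly (h2 : (2 : k) ≠ 0) (hd : (d : k) ≠ 0) (ht0 : t ≠ 0) (ht1 : t ≠ 1) :
    (branchPoly d t).Separable := by
  obtain ⟨e, rfl⟩ : ∃ e, d = e + 1 := Nat.exists_eq_succ_of_ne_zero (by
    rintro rfl
    simp at hd)
  have hder : derivative (branchPoly (e + 1) t) =
      C ((e + 1 : ℕ) : k) * X ^ e * (2 * X ^ (e + 1) + C (2 - 4 * t)) := by
    rw [branchPoly, mul_comm 2 (e + 1), pow_mul]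
    simp only [derivative_add, derivative_mul, derivative_pow, derivative_C, derivative_one,
      derivative_X, Nat.add_sub_cancel, map_natCast, Nat.cast_ofNat]
    simp only [show (2 : ℕ) - 1 = 1 from rfl, pow_one]
    rw [show (C (2 : k) : k[X]) = 2 from rfl]
    ring
  rw [Separable, hder]
  refine IsCoprime.mul_right (IsCoprime.mul_right ?_ (IsCoprime.pow_right ?_)) ?_
  · exact ⟨0, C ((e + 1 : ℕ) : k)⁻¹, by rw [← C_mul, inv_mul_cancel₀ hd, zero_mul, zero_add, C_1]⟩
  · refine ⟨1, -(X ^ (2 * e + 1) + C (2 - 4 * t) * X ^ e), ?_⟩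
    rw [branchPoly]
    ring
  · have h16 : 4 * (2 * t) * (2 * (1 - t)) ≠ (0 : k) := by
      have h1 : (1 - t) ≠ 0 := sub_ne_zero.mpr ht1.symm
      have h4 : (4 : k) ≠ 0 := by
        rw [show (4 : k) = 2 * 2 by norm_num]
        exact mul_ne_zero h2 h2
      exact mul_ne_zero (mul_ne_zero h4 (mul_ne_zero h2 ht0)) (mul_ne_zero h2 h1)
    refine ⟨C (4 * (2 * t) * (2 * (1 - t)))⁻¹ * 4, -C (4 * (2 * t) * (2 * (1 - t)))⁻¹ *
      (2 * X ^ (e + 1) + C (2 - 4 * t)), ?_⟩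
    have : (4 : k[X]) * branchPoly (e + 1) t - (2 * X ^ (e + 1) + C (2 - 4 * t)) *
        (2 * X ^ (e + 1) + C (2 - 4 * t)) = C (4 * (2 * t) * (2 * (1 - t))) := by
      rw [branchPoly]
      simp only [C_sub, C_mul, C_1, C_ofNat]
      ring
    linear_combination C (4 * (2 * t) * (2 * (1 - t)))⁻¹ * this +
      (by rw [← C_mul, inv_mul_cancel₀ h16, C_1] :
        C (4 * (2 * t) * (2 * (1 - t)))⁻¹ * C (4 * (2 * t) * (2 * (1 - t))) = (1 : k[X]))

theorem dvd_of_sq_dvd_sq_mul {f s q : k[X]} (hf : Squarefree f) (h : s ^ 2 ∣ q ^ 2 * f) :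
    s ∣ q := by
  classical
  have hab := EuclideanDomain.gcd_eq_gcd_ab s q
  obtain ⟨s', hs⟩ := EuclideanDomain.gcd_dvd_left s q
  obtain ⟨q', hq⟩ := EuclideanDomain.gcd_dvd_right s q
  generalize EuclideanDomain.gcdA s q = u at *
  generalize EuclideanDomain.gcdB s q = v at *
  generalize EuclideanDomain.gcd s q = g at *
  rcases eq_or_ne g 0 with h0 | h0
  · rw [h0, zero_mul] at hq
    rw [hq]
    exact dvd_zero s
  have hcop : IsCoprime s' q' := by
    refine ⟨u, v, mul_left_cancel₀ h0 ?_⟩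
    linear_combination -hab + u * (-hs) + v * (-hq)
  have h1 : s' ^ 2 ∣ q' ^ 2 * f := by
    rw [hs, hq, mul_pow, mul_pow, mul_assoc] at h
    exact (mul_dvd_mul_iff_left (pow_ne_zero 2 h0)).mp h
  have h2 : IsCoprime (s' ^ 2) (q' ^ 2) := hcop.pow
  have h3 : IsUnit s' := hf s' (by
    rw [← sq]
    exact h2.dvd_of_dvd_mul_left h1)
  rw [hs, hq]
  exact mul_dvd_mul_left _ (h3.dvd)

/-- A squarefree polynomial of positive degree is not the square of a rational function. -/
theorem eq_zero_of_sq_eq_sq_mul {f p q : k[X]} (hf : Squarefree f) (hf0 : f.natDegree ≠ 0)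
    (h : p ^ 2 = q ^ 2 * f) : q = 0 := by
  by_contra hq
  obtain ⟨g, rfl⟩ : q ∣ p := by
    have : q ^ 2 ∣ p ^ 2 * 1 := by
      rw [h, mul_one]
      exact dvd_mul_right _ _
    exact dvd_of_sq_dvd_sq_mul squarefree_one this
  rw [mul_pow] at h
  have h1 := mul_left_cancel₀ (pow_ne_zero 2 hq) h
  have h2 : IsUnit g := hf g (by rw [← h1, sq])
  apply hf0
  rw [← h1]
  exact natDegree_eq_zero_of_isUnit (h2.pow 2)

/-- `K` is the function field `k(w, Y)` of the curve `Y ^ 2 = w ^ (2 d) + (2 - 4 t) w ^ d + 1`,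
where the polynomial on the right hand side is squarefree. -/
structure IsHyperellipticPair (d : ℕ) (t : k) (w Y : K) : Prop where
  transcendental : Transcendental k w
  sq_eq : Y ^ 2 = aeval w (branchPoly d t)
  adjoin_eq_top : IntermediateField.adjoin k {w, Y} = ⊤
  squarefree : Squarefree (branchPoly d t)
  ne_zero : d ≠ 0

namespace IsHyperellipticPair

variable {w Y : K} (h : IsHyperellipticPair d t w Y)

include h

theorem aeval_eq_zero {p : k[X]} (hp : aeval w p = 0) : p = 0 := by
  by_contra h0
  exact aeval_ne_zero h.transcendental h0 hp

theorem aeval_inj {p q : k[X]} (hp : aeval w p = aeval w q) : p = q :=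
  sub_eq_zero.mp (h.aeval_eq_zero (by rw [map_sub, hp, sub_self]))

theorem natDegree_ne_zero : (branchPoly d t).natDegree ≠ 0 := by
  rw [natDegree_branchPoly h.ne_zero]
  have := h.ne_zero
  omega

/-- The functions `1` and `Y` are linearly independent over `k[w]`. -/
theorem eq_zero_of_add_mul_eq_zero {p q : k[X]} (hpq : aeval w p + aeval w q * Y = 0) :
    p = 0 ∧ q = 0 := by
  have h1 : p ^ 2 = q ^ 2 * branchPoly d t := by
    apply h.aeval_inj
    rw [map_mul, map_pow, map_pow, ← h.sq_eq]
    linear_combination (aeval w p - aeval w q * Y) * hpq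
  have hq := eq_zero_of_sq_eq_sq_mul h.squarefree h.natDegree_ne_zero h1
  subst hq
  exact ⟨h.aeval_eq_zero (by simpa using hpq), rfl⟩

/-- Every element of `K` is of the form `(p(w) + q(w) Y) / s(w)`. -/
theorem exists_repr (z : K) : ∃ p q s : k[X], s ≠ 0 ∧
    aeval w s * z = aeval w p + aeval w q * Y := by
  have hz : z ∈ IntermediateField.adjoin k {w, Y} := by
    rw [h.adjoin_eq_top]
    trivial
  induction hz using IntermediateField.adjoin_induction with
  | mem x hx =>
    rcases hx with rfl | rfl
    · exact ⟨X, 0, 1, one_ne_zero, by simp⟩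
    · exact ⟨0, 1, 1, one_ne_zero, by simp⟩
  | algebraMap x => exact ⟨C x, 0, 1, one_ne_zero, by simp⟩
  | add x y _ _ hx hy =>
    obtain ⟨p, q, s, hs, hx⟩ := hx
    obtain ⟨p', q', s', hs', hy⟩ := hy
    refine ⟨s' * p + s * p', s' * q + s * q', s * s', mul_ne_zero hs hs', ?_⟩
    simp only [map_add, map_mul]
    linear_combination aeval w s' * hx + aeval w s * hy
  | mul x y _ _ hx hy =>
    obtain ⟨p, q, s, hs, hx⟩ := hx
    obtain ⟨p', q', s', hs', hy⟩ := hy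
    refine ⟨p * p' + q * q' * branchPoly d t, p * q' + q * p', s * s', mul_ne_zero hs hs', ?_⟩
    simp only [map_add, map_mul, ← h.sq_eq]
    linear_combination aeval w s' * y * hx + (aeval w p + aeval w q * Y) * hy
  | inv x _ hx =>
    obtain ⟨p, q, s, hs, hx⟩ := hx
    rcases eq_or_ne x 0 with rfl | hx0
    · exact ⟨0, 0, 1, one_ne_zero, by simp⟩
    refine ⟨s * p, -(s * q), p ^ 2 - q ^ 2 * branchPoly d t, ?_, ?_⟩
    · intro h0
      have hq := eq_zero_of_sq_eq_sq_mul h.squarefree h.natDegree_ne_zero (sub_eq_zero.mp h0)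
      subst hq
      have hp : p = 0 := by simpa using h0
      subst hp
      simp [aeval_ne_zero h.transcendental hs, hx0] at hx
    · simp only [map_sub, map_mul, map_pow, map_neg, ← h.sq_eq]
      field_simp
      linear_combination -(aeval w p - aeval w q * Y) * hx

theorem exists_quadratic_relation (z : K) :
    ∃ P : k[X][X], P ≠ 0 ∧ evalPair w z P = 0 ∧ P.natDegree ≤ 2 := by
  obtain ⟨p, q, s, hs, hz⟩ := h.exists_repr z
  refine ⟨C (s ^ 2) * X ^ 2 + C (-2 * s * p) * X + C (p ^ 2 - q ^ 2 * branchPoly d t), ?_, ?_, ?_⟩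
  · have key (A B E : k[X]) (hA : A ≠ 0) : C A * X ^ 2 + C B * X + C E ≠ 0 := by
      intro h0
      have := congrArg (fun P => coeff P 2) h0
      simp at this
      exact hA this
    exact key _ _ _ (pow_ne_zero 2 hs)
  · simp only [map_add, map_mul, map_pow, evalPair_C, evalPair_X, map_sub, ← h.sq_eq, map_neg,
      map_ofNat]
    linear_combination (aeval w s * z - aeval w p + aeval w q * Y) * hz
  · exact natDegree_quadratic_le

variable [NeZero (2 : k)] {t' : k} {z U : K} (h' : IsHyperellipticPair d t' z U)

include h'

/-- The functions `w` and `z` of two hyperelliptic pairs generate the same field: here `z` is a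
rational function of `w`. Otherwise the relation between them, of degree at most `2` in each
variable, would have a discriminant of degree at most `4` which is a nonzero square times the branch
polynomial, of degree `2 d`. -/
theorem exists_rational (hd : 3 ≤ d) :
    ∃ p s : k[X], s ≠ 0 ∧ aeval w s * z = aeval w p := by
  obtain ⟨P, hP0, hP, hPd⟩ := exists_quadratic_relation h z
  obtain ⟨Q, hQ0, hQ, hQd⟩ := exists_quadratic_relation h' w
  obtain ⟨m, hm0, hm, hm2, hmi⟩ := exists_bounded_relation h.transcendental hP0 hP hPd hQ0 hQ hQd
  obtain ⟨p, q, s, hs, hz⟩ := h.exists_repr z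
  rcases eq_or_ne q 0 with rfl | hq
  · exact ⟨p, s, hs, by simpa using hz⟩
  have hsum : m = C (m.coeff 2) * X ^ 2 + C (m.coeff 1) * X + C (m.coeff 0) := by
    conv_lhs => rw [as_sum_range_C_mul_X_pow' m (Nat.lt_succ_of_le hm2)]
    simp [Finset.sum_range_succ]
    ring
  have hA := hmi 2
  have hB := hmi 1
  have hC := hmi 0
  generalize m.coeff 2 = A at *
  generalize m.coeff 1 = B at *
  generalize m.coeff 0 = E at *
  subst hsum
  simp only [map_add, map_mul, map_pow, evalPair_C, evalPair_X] at hm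
  rcases eq_or_ne A 0 with rfl | hA0
  · rcases eq_or_ne B 0 with rfl | hB0
    · have : E = 0 := h.aeval_eq_zero (by simpa using hm)
      simp [this] at hm0
    · refine ⟨-E, B, hB0, ?_⟩
      rw [map_zero, zero_mul, zero_add] at hm
      rw [map_neg]
      linear_combination hm
  exfalso
  -- with `v = s (2 A z + B) = u + 2 A q Y`, the square `v ^ 2 = s ^ 2 (B ^ 2 - 4 A E)`
  -- lies in `k[w]`
  have h2 : (2 : k[X]) ≠ 0 := by
    rw [← C_ofNat, Ne, C_eq_zero]
    exact two_ne_zero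
  have hv : aeval w (s ^ 2 * (B ^ 2 - 4 * A * E)) = (aeval w (2 * A * p + s * B) +
      aeval w (2 * A * q) * Y) ^ 2 := by
    simp only [map_add, map_mul, map_pow, map_sub, map_ofNat]
    linear_combination (-4 * aeval w s ^ 2 * aeval w A) * hm + (2 * aeval w A) *
      (2 * (aeval w A) * (aeval w s * z + aeval w p + aeval w q * Y) + 2 * aeval w s * aeval w B)
        * hz
  have hv' := h.eq_zero_of_add_mul_eq_zero
    (p := (2 * A * p + s * B) ^ 2 + (2 * A * q) ^ 2 * branchPoly d t -
      s ^ 2 * (B ^ 2 - 4 * A * E)) (q := 2 * (2 * A * p + s * B) * (2 * A * q)) (by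
    rw [map_sub, hv]
    simp only [map_add, map_mul, map_pow, ← h.sq_eq, map_ofNat]
    ring)
  have hAq : 2 * A * q ≠ 0 := mul_ne_zero (mul_ne_zero h2 hA0) hq
  have hu : 2 * A * p + s * B = 0 := by
    have := hv'.2
    rw [mul_eq_zero, or_iff_left hAq, mul_eq_zero, or_iff_right h2] at this
    exact this
  have h3 : (2 * A * q) ^ 2 * branchPoly d t = s ^ 2 * (B ^ 2 - 4 * A * E) := by
    have := hv'.1
    rw [hu] at this
    linear_combination this
  obtain ⟨g, hg⟩ : s ∣ 2 * A * q := dvd_of_sq_dvd_sq_mul h.squarefree (by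
    rw [h3]
    exact dvd_mul_right _ _)
  have h4 : g ^ 2 * branchPoly d t = B ^ 2 - 4 * A * E := by
    apply mul_left_cancel₀ (pow_ne_zero 2 hs)
    rw [← h3, hg]
    ring
  have hg0 : g ≠ 0 := by
    rintro rfl
    exact hAq (by rw [hg, mul_zero])
  have h5 : (g ^ 2 * branchPoly d t).natDegree ≤ 4 := by
    rw [h4]
    compute_degree
    omega
  rw [natDegree_mul (pow_ne_zero 2 hg0) (branchPoly_ne_zero h.ne_zero),
    natDegree_branchPoly h.ne_zero] at h5
  omega

/-- The functions `w` and `z` of two hyperelliptic pairs are related by a Möbius transformation. -/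
theorem exists_mobius (hd : 3 ≤ d) : ∃ a b c e : k, (c ≠ 0 ∨ e ≠ 0) ∧
    (algebraMap k K c * w + algebraMap k K e) * z = algebraMap k K a * w + algebraMap k K b := by
  obtain ⟨p, s, hs, hz⟩ := h.exists_rational h' hd
  obtain ⟨p', s', hs', hw⟩ := h'.exists_rational h hd
  have key {x y : K} {p s : k[X]} (hs : s ≠ 0) (hy : aeval x s * y = aeval x p) :
      ∃ P : k[X][X], P ≠ 0 ∧ evalPair x y P = 0 ∧ P.natDegree ≤ 1 := by
    refine ⟨C s * X + C (-p), fun h0 => ?_, ?_, natDegree_linear_le⟩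
    · have := congrArg (fun P => coeff P 1) h0
      simp [coeff_C] at this
      exact hs this
    · simp only [map_add, map_mul, evalPair_C, evalPair_X, map_neg]
      linear_combination hy
  obtain ⟨P, hP0, hP, hPd⟩ := key hs hz
  obtain ⟨Q, hQ0, hQ, hQd⟩ := key hs' hw
  obtain ⟨m, hm0, hm, hm1, hmi⟩ := exists_bounded_relation h.transcendental hP0 hP hPd hQ0 hQ hQd
  have hsum : m = C (m.coeff 1) * X + C (m.coeff 0) := by
    conv_lhs => rw [as_sum_range_C_mul_X_pow' m (Nat.lt_succ_of_le hm1)]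
    simp [Finset.sum_range_succ]
    ring
  obtain ⟨c, e, hB⟩ := exists_eq_X_add_C_of_natDegree_le_one (hmi 1)
  obtain ⟨a, b, hC⟩ := exists_eq_X_add_C_of_natDegree_le_one (hmi 0)
  rw [hB, hC] at hsum
  subst hsum
  simp only [map_add, map_mul, evalPair_C, evalPair_X, aeval_C, aeval_X] at hm
  refine ⟨-a, -b, c, e, ?_, ?_⟩
  · by_contra! h0
    obtain ⟨rfl, rfl⟩ := h0
    have : (C a * X + C b : k[X]) = 0 := h.aeval_eq_zero (by simpa using hm)
    simp [this] at hm0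
  · simp only [map_neg]
    linear_combination hm

end IsHyperellipticPair

end HyperellipticPairs

/-! ### Möbius transformations between hyperelliptic pairs -/

section Mobius

variable {k : Type u} [Field k] {K K' : Type u} [Field K] [Algebra k K] [Field K'] [Algebra k K']
  {d : ℕ} {t t' : k}

/-- The polynomial `(c X + e) ^ (2 d) f ((a X + b) / (c X + e))`, where `f` is the branch
polynomial. -/
def mobiusPoly (d : ℕ) (t a b c e : k) : k[X] :=
  (C a * X + C b) ^ (2 * d) + C (2 - 4 * t) * ((C a * X + C b) ^ d * (C c * X + C e) ^ d) +
    (C c * X + C e) ^ (2 * d)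

theorem C_mul_X_add_C_ne_zero {c e : k} (hce : c ≠ 0 ∨ e ≠ 0) : (C c * X + C e : k[X]) ≠ 0 := by
  intro h0
  have h1 := congrArg (fun p => coeff p 1) h0
  have h2 := congrArg (fun p => coeff p 0) h0
  simp at h1 h2
  tauto

theorem natDegree_mobiusPoly_le (a b c e : k) : (mobiusPoly d t a b c e).natDegree ≤ 2 * d := by
  have h1 (a b : k) : (C a * X + C b).natDegree ≤ 1 := natDegree_linear_le
  have h2 (a b : k) (n : ℕ) : ((C a * X + C b) ^ n).natDegree ≤ n :=
    (natDegree_pow_le_of_le n (h1 a b)).trans (by omega)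
  unfold mobiusPoly
  refine natDegree_add_le_of_degree_le (natDegree_add_le_of_degree_le (h2 _ _ _) ?_) (h2 _ _ _)
  refine (natDegree_C_mul_le _ _).trans ((natDegree_mul_le_of_le (h2 _ _ _) (h2 _ _ _)).trans ?_)
  omega

namespace IsHyperellipticPair

variable {w Y z U : K}

/-- If `K = k(z, U)` is not algebraic over `k`, then `z` is transcendental. -/
theorem of_adjoin_eq_top (hsq : U ^ 2 = aeval z (branchPoly d t))
    (htop : IntermediateField.adjoin k {z, U} = ⊤) (hf : Squarefree (branchPoly d t)) (hd : d ≠ 0)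
    {x : K} (hx : Transcendental k x) : IsHyperellipticPair d t z U := by
  refine ⟨fun hz => hx ?_, hsq, htop, hf, hd⟩
  have hU : IsIntegral k U := by
    refine IsIntegral.of_pow (n := 2) two_pos ?_
    rw [hsq]
    exact (IsIntegral.of_mem_of_fg _ (isAlgebraic_iff_isIntegral.mp hz).fg_adjoin_singleton _
      (aeval_mem_adjoin_singleton k z))
  have : Algebra.IsAlgebraic k (IntermediateField.adjoin k {z, U}) := by
    apply IntermediateField.isAlgebraic_adjoin
    rintro y (rfl | rfl)
    · exact isAlgebraic_iff_isIntegral.mp hz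
    · exact hU
  rw [htop] at this
  have := this.isAlgebraic (⟨x, trivial⟩ : (⊤ : IntermediateField k K))
  exact this.algHom (⊤ : IntermediateField k K).val

theorem left_ne_zero (h : IsHyperellipticPair d t w Y) : w ≠ 0 := by
  rintro rfl
  exact h.transcendental isAlgebraic_zero

theorem right_ne_zero (h : IsHyperellipticPair d t w Y) : Y ≠ 0 := by
  rintro rfl
  refine aeval_ne_zero h.transcendental (branchPoly_ne_zero (t := t) h.ne_zero) ?_
  rw [← h.sq_eq, zero_pow two_ne_zero]

/-- Two functions `z, U` satisfying the equation of a hyperelliptic curve form a hyperelliptic pair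
if the functions of a given pair lie in `k(z, U)`. -/
theorem of_mem (h : IsHyperellipticPair d t w Y) {t' : k} (hsq : U ^ 2 = aeval z (branchPoly d t'))
    (hf : Squarefree (branchPoly d t')) (hw : w ∈ IntermediateField.adjoin k {z, U})
    (hY : Y ∈ IntermediateField.adjoin k {z, U}) : IsHyperellipticPair d t' z U := by
  refine of_adjoin_eq_top hsq ?_ hf h.ne_zero h.transcendental
  rw [eq_top_iff, ← h.adjoin_eq_top, IntermediateField.adjoin_le_iff]
  rintro y (rfl | rfl)
  · exact hw
  · exact hY

theorem map (h : IsHyperellipticPair d t w Y) (φ : K ≃ₐ[k] K') :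
    IsHyperellipticPair d t (φ w) (φ Y) := by
  refine ⟨?_, ?_, ?_, h.squarefree, h.ne_zero⟩
  · intro hw
    exact h.transcendental ((isAlgebraic_algHom_iff φ.toAlgHom φ.injective).mp hw)
  · rw [← map_pow, h.sq_eq, aeval_algEquiv]
    rfl
  · have := IntermediateField.adjoin_map k {w, Y} φ.toAlgHom
    rw [h.adjoin_eq_top] at this
    rw [eq_top_iff]
    intro y _
    have hy : y ∈ IntermediateField.map φ.toAlgHom ⊤ := ⟨φ.symm y, trivial, by simp⟩
    rw [this] at hy
    simpa [Set.image_pair] using hy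

theorem algHom_ext (h : IsHyperellipticPair d t w Y) {φ ψ : K →ₐ[k] K'} (hw : φ w = ψ w)
    (hY : φ Y = ψ Y) : φ = ψ := by
  ext z
  obtain ⟨p, q, s, hs, hz⟩ := h.exists_repr z
  have h1 := congrArg φ hz
  have h2 := congrArg ψ hz
  simp only [map_mul, map_add, ← aeval_algHom_apply, ← hw, ← hY] at h1 h2
  have hs' : aeval (φ w) s ≠ 0 := by
    rw [aeval_algHom_apply]
    exact (map_ne_zero φ).mpr (aeval_ne_zero h.transcendental hs)
  exact mul_left_cancel₀ hs' (h1.trans h2.symm)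

theorem algEquiv_ext (h : IsHyperellipticPair d t w Y) {φ ψ : K ≃ₐ[k] K'} (hw : φ w = ψ w)
    (hY : φ Y = ψ Y) : φ = ψ := by
  have := h.algHom_ext (φ := φ.toAlgHom) (ψ := ψ.toAlgHom) hw hY
  ext x
  exact congr($this x)

section CoordinateRing

theorem eval₂_hypPoly (h : IsHyperellipticPair d t w Y) :
    (hypPoly d t).eval₂ (aeval (R := k) w).toRingHom Y = 0 := by
  rw [hypPoly, eval₂_sub, eval₂_pow, eval₂_X, eval₂_C, h.sq_eq]
  exact sub_self _

/-- The inclusion of the coordinate ring `k[w, Y]` into `K`. -/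
def coordHom (h : IsHyperellipticPair d t w Y) : HypRing d t →+* K :=
  AdjoinRoot.lift (aeval (R := k) w).toRingHom Y h.eval₂_hypPoly

@[simp] theorem coordHom_of (h : IsHyperellipticPair d t w Y) (p : k[X]) :
    h.coordHom (AdjoinRoot.of _ p) = aeval w p :=
  AdjoinRoot.lift_of _

@[simp] theorem coordHom_root (h : IsHyperellipticPair d t w Y) :
    h.coordHom (AdjoinRoot.root _) = Y :=
  AdjoinRoot.lift_root _

theorem coordHom_algebraMap (h : IsHyperellipticPair d t w Y) (c : k) :
    h.coordHom (algebraMap k (HypRing d t) c) = algebraMap k K c := by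
  have : algebraMap k (HypRing d t) c = AdjoinRoot.of _ (C c) := rfl
  rw [this, coordHom_of, aeval_C]

omit [Field K] [Algebra k K] [Field K'] [Algebra k K'] in
theorem monic_hypPoly : (hypPoly d t).Monic := monic_X_pow_sub_C _ two_ne_zero

omit [Field K] [Algebra k K] [Field K'] [Algebra k K'] in
theorem natDegree_hypPoly : (hypPoly d t).natDegree = 2 := natDegree_X_pow_sub_C

omit [Field K] [Algebra k K] [Field K'] [Algebra k K'] in
/-- The coordinate ring `k[W, Y]` is spanned by `1` and `Y` over `k[W]`. -/
theorem exists_hypRing_repr (x : HypRing d t) : ∃ p q : k[X],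
    x = AdjoinRoot.of _ p + AdjoinRoot.of _ q * AdjoinRoot.root _ := by
  induction x using AdjoinRoot.induction_on with
  | ih P =>
    have h1 : P %ₘ hypPoly d t = C ((P %ₘ hypPoly d t).coeff 1) * X +
        C ((P %ₘ hypPoly d t).coeff 0) := by
      apply eq_X_add_C_of_natDegree_le_one
      have := natDegree_modByMonic_lt P monic_hypPoly (q := hypPoly d t) (by
        intro h
        have := natDegree_hypPoly (d := d) (t := t)
        rw [h, natDegree_one] at this
        omega)
      rw [natDegree_hypPoly] at this
      omega
    refine ⟨(P %ₘ hypPoly d t).coeff 0, (P %ₘ hypPoly d t).coeff 1, ?_⟩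
    have h2 : AdjoinRoot.mk (hypPoly d t) P = AdjoinRoot.mk _ (P %ₘ hypPoly d t) := by
      conv_lhs => rw [← modByMonic_add_div P (hypPoly d t)]
      rw [map_add, map_mul, AdjoinRoot.mk_self, zero_mul, add_zero]
    rw [h2, h1, map_add, map_mul, AdjoinRoot.mk_C, AdjoinRoot.mk_C, AdjoinRoot.mk_X, add_comm]
    simp

theorem coordHom_injective (h : IsHyperellipticPair d t w Y) :
    Function.Injective h.coordHom := by
  rw [injective_iff_map_eq_zero]
  intro x hx
  obtain ⟨p, q, rfl⟩ := exists_hypRing_repr x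
  rw [map_add, map_mul, coordHom_of, coordHom_of, coordHom_root] at hx
  obtain ⟨rfl, rfl⟩ := h.eq_zero_of_add_mul_eq_zero hx
  simp

theorem isFractionRing_coordHom (h : IsHyperellipticPair d t w Y) :
    @IsFractionRing (HypRing d t) _ K _ h.coordHom.toAlgebra := by
  let := h.coordHom.toAlgebra
  have : IsDomain (HypRing d t) := h.coordHom_injective.isDomain h.coordHom
  have : FaithfulSMul (HypRing d t) K :=
    (faithfulSMul_iff_algebraMap_injective _ _).mpr h.coordHom_injective
  refine IsFractionRing.of_field _ _ fun z => ?_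
  obtain ⟨p, q, s, hs, hz⟩ := h.exists_repr z
  refine ⟨AdjoinRoot.of _ p + AdjoinRoot.of _ q * AdjoinRoot.root _, AdjoinRoot.of _ s, ?_⟩
  change z = h.coordHom _ / h.coordHom _
  rw [map_add, map_mul, coordHom_of, coordHom_of, coordHom_of, coordHom_root,
    eq_div_iff (aeval_ne_zero h.transcendental hs), ← hz, mul_comm]

end CoordinateRing

/-- The pair `(w, Y)` determines the field `K`. -/
theorem exists_algEquiv {z U : K'} (h : IsHyperellipticPair d t w Y)
    (h' : IsHyperellipticPair d t z U) : ∃ φ : K ≃ₐ[k] K', φ w = z ∧ φ Y = U := by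
  let := h.coordHom.toAlgebra
  let := h'.coordHom.toAlgebra
  have := h.isFractionRing_coordHom
  have := h'.isFractionRing_coordHom
  let φ : K ≃ₐ[HypRing d t] K' := IsLocalization.algEquiv (nonZeroDivisors (HypRing d t)) K K'
  have hφ (x : HypRing d t) : φ (h.coordHom x) = h'.coordHom x := φ.commutes x
  refine ⟨AlgEquiv.ofRingEquiv (f := φ.toRingEquiv) fun c => ?_, ?_, ?_⟩
  · rw [← h.coordHom_algebraMap, ← h'.coordHom_algebraMap]
    exact hφ _
  · have := hφ (AdjoinRoot.of _ X)
    rw [coordHom_of, coordHom_of, aeval_X, aeval_X] at this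
    exact this
  · have := hφ (AdjoinRoot.root _)
    rw [coordHom_root, coordHom_root] at this
    exact this

theorem notMem_adjoin (h : IsHyperellipticPair d t w Y) :
    Y ∉ IntermediateField.adjoin k {w} := by
  intro hY
  obtain ⟨p, q, hpq⟩ := (IntermediateField.mem_adjoin_simple_iff k Y).mp hY
  rcases eq_or_ne q 0 with rfl | hq
  · have := h.eq_zero_of_add_mul_eq_zero (p := 0) (q := 1) (by simpa using hpq)
    exact one_ne_zero this.2
  · rw [eq_div_iff (aeval_ne_zero h.transcendental hq)] at hpq
    have := h.eq_zero_of_add_mul_eq_zero (p := -p) (q := q) (by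
      rw [map_neg, ← hpq]
      ring)
    exact hq this.2

/-- A Möbius transformation relating two hyperelliptic pairs carries one branch polynomial
to the other. -/
theorem exists_mobiusPoly_eq [NeZero (2 : k)] (h : IsHyperellipticPair d t w Y)
    (h' : IsHyperellipticPair d t' z U)
    {a b c e : k} (hce : c ≠ 0 ∨ e ≠ 0)
    (hz : (algebraMap k K c * w + algebraMap k K e) * z =
      algebraMap k K a * w + algebraMap k K b) :
    ∃ μ : k, mobiusPoly d t' a b c e = C (μ ^ 2) * branchPoly d t ∧
      U * (algebraMap k K c * w + algebraMap k K e) ^ d = algebraMap k K μ * Y := by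
  have hL : algebraMap k K c * w + algebraMap k K e = aeval w (C c * X + C e) := by simp
  have hL0 : (C c * X + C e : k[X]) ≠ 0 := C_mul_X_add_C_ne_zero hce
  have hLw : algebraMap k K c * w + algebraMap k K e ≠ 0 := by
    rw [hL]
    exact aeval_ne_zero h.transcendental hL0
  have hsq : (U * (algebraMap k K c * w + algebraMap k K e) ^ d) ^ 2 =
      aeval w (mobiusPoly d t' a b c e) := by
    rw [mul_pow, h'.sq_eq]
    simp only [branchPoly, mobiusPoly, map_add, map_mul, map_pow, aeval_X, aeval_C, map_one,
      ← hz, mul_pow]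
    ring
  obtain ⟨p, q, s, hs, hV⟩ := h.exists_repr (U * (algebraMap k K c * w + algebraMap k K e) ^ d)
  generalize hP : mobiusPoly d t' a b c e = P at *
  obtain ⟨h1, h2⟩ := h.eq_zero_of_add_mul_eq_zero
    (p := p ^ 2 + q ^ 2 * branchPoly d t - s ^ 2 * P) (q := 2 * p * q) (by
      simp only [map_sub, map_mul, map_pow, map_add, ← h.sq_eq, ← hsq, map_ofNat]
      linear_combination -(aeval w s * (U * (algebraMap k K c * w + algebraMap k K e) ^ d) +
        (aeval w p + aeval w q * Y)) * hV)
  have h20 : (2 : k[X]) ≠ 0 := by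
    rw [← C_ofNat, Ne, C_eq_zero]
    exact two_ne_zero
  -- `U` is not a rational function of `w`, since `z` and `U` generate `K`
  have hq : q ≠ 0 := by
    rintro rfl
    have hw := IntermediateField.mem_adjoin_simple_self k w
    have hLm : algebraMap k K c * w + algebraMap k K e ∈ IntermediateField.adjoin k {w} :=
      add_mem (mul_mem (algebraMap_mem _ _) hw) (algebraMap_mem _ _)
    have hzm : z ∈ IntermediateField.adjoin k {w} := by
      rw [eq_div_of_mul_eq hLw ((mul_comm _ _).trans hz)]
      exact div_mem (add_mem (mul_mem (algebraMap_mem _ _) hw) (algebraMap_mem _ _)) hLm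
    have hm (r : k[X]) : aeval w r ∈ IntermediateField.adjoin k {w} :=
      IntermediateField.algebra_adjoin_le_adjoin k _ (aeval_mem_adjoin_singleton k w)
    have hUm : U ∈ IntermediateField.adjoin k {w} := by
      have : U = aeval w p / aeval w s / (algebraMap k K c * w + algebraMap k K e) ^ d := by
        rw [eq_div_iff (pow_ne_zero d hLw), eq_div_iff (aeval_ne_zero h.transcendental hs),
          mul_comm, hV]
        simp
      rw [this]
      exact div_mem (div_mem (hm _) (hm _)) (pow_mem hLm d)
    have htop : IntermediateField.adjoin k {z, U} ≤ IntermediateField.adjoin k {w} := by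
      rw [IntermediateField.adjoin_le_iff]
      rintro y (rfl | rfl)
      · exact hzm
      · exact hUm
    rw [h'.adjoin_eq_top] at htop
    exact h.notMem_adjoin (htop trivial)
  have hp : p = 0 := by
    rw [mul_eq_zero, or_iff_left hq, mul_eq_zero, or_iff_right h20] at h2
    exact h2
  subst hp
  have h3 : q ^ 2 * branchPoly d t = s ^ 2 * P := by linear_combination h1
  obtain ⟨g, rfl⟩ : s ∣ q := dvd_of_sq_dvd_sq_mul h.squarefree (by
    rw [h3]
    exact dvd_mul_right _ _)
  have h4 : P = g ^ 2 * branchPoly d t := by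
    apply mul_left_cancel₀ (pow_ne_zero 2 hs)
    rw [← h3]
    ring
  have hg : g ≠ 0 := by
    rintro rfl
    exact hq (mul_zero _)
  have hdeg := natDegree_mobiusPoly_le (d := d) (t := t') a b c e
  rw [hP, h4, natDegree_mul (pow_ne_zero 2 hg) (branchPoly_ne_zero h.ne_zero),
    natDegree_branchPoly h.ne_zero, natDegree_pow] at hdeg
  obtain ⟨μ, rfl⟩ := natDegree_eq_zero.mp (show g.natDegree = 0 by omega)
  refine ⟨μ, by rw [h4, C_pow], ?_⟩
  apply mul_left_cancel₀ (aeval_ne_zero h.transcendental hs)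
  rw [hV]
  simp
  ring

theorem sq_eq_one_of_mul_eq_one_of_eq {α A A' μ : k} (h2 : α ^ (2 * d) = μ ^ 2)
    (h1 : A' * α ^ d = μ ^ 2 * A) (h0 : 1 = μ ^ 2) :
    α ^ (2 * d) = 1 ∧ μ ^ 2 = 1 ∧ A' * α ^ d = A :=
  ⟨by rw [h2, ← h0], h0.symm, by rw [h1, ← h0, one_mul]⟩

/-- If `w` and `z` are both eigenvectors of an automorphism, with `z` not fixed, then the Möbius
transformation relating them is `z = α w` or `z = α / w`. -/
theorem eq_or_mul_eq [NeZero (2 : k)] (h : IsHyperellipticPair d t w Y)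
    (h' : IsHyperellipticPair d t' z U) (hd : 3 ≤ d) (σ : K ≃ₐ[k] K) {η ξ : k} (hξ : ξ ≠ 1)
    (hw : σ w = algebraMap k K η * w) (hz : σ z = algebraMap k K ξ * z) :
    ∃ α μ : k, α ^ (2 * d) = 1 ∧ μ ^ 2 = 1 ∧ (2 - 4 * t') * α ^ d = 2 - 4 * t ∧
      ((z = algebraMap k K α * w ∧ U = algebraMap k K μ * Y) ∨
        (z * w = algebraMap k K α ∧ U * w ^ d = algebraMap k K μ * Y)) := by
  obtain ⟨a, b, c, e, hce, hm⟩ := h.exists_mobius h' hd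
  have hw0 : w ≠ 0 := h.left_ne_zero
  have hz0 : z ≠ 0 := h'.left_ne_zero
  have hη : η ≠ 0 := by
    rintro rfl
    rw [map_zero, zero_mul, map_eq_zero] at hw
    exact hw0 hw
  have h0 : (C c * X + C e : k[X]) * (C ξ * ((C a * X + C b) * (C (c * η) * X + C e))) =
      (C c * X + C e : k[X]) * ((C (a * η) * X + C b) * (C c * X + C e)) := by
    apply h.aeval_inj
    have h1 := congrArg σ hm
    simp only [map_mul, map_add, hw, hz, AlgEquiv.commutes] at h1
    simp only [map_mul, map_add, aeval_C, aeval_X]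
    linear_combination (algebraMap k K c * w + algebraMap k K e) *
      (algebraMap k K c * w + algebraMap k K e) * h1 - algebraMap k K ξ *
      (algebraMap k K c * w + algebraMap k K e) *
      (algebraMap k K (c) * (algebraMap k K η) * w + algebraMap k K e) * hm
  have hL0 : (C c * X + C e : k[X]) ≠ 0 := C_mul_X_add_C_ne_zero hce
  have hP0 : ¬ (a = 0 ∧ b = 0) := by
    rintro ⟨rfl, rfl⟩
    rw [map_zero, zero_mul, zero_add] at hm
    have := aeval_ne_zero h.transcendental hL0
    simp only [map_add, map_mul, aeval_C, aeval_X] at this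
    exact mul_ne_zero this hz0 hm
  have h1 := mul_left_cancel₀ hL0 h0
  have h2 : C (ξ * (a * (c * η))) * X ^ 2 + C (ξ * (a * e + b * (c * η))) * X + C (ξ * (b * e)) =
      C (a * η * c) * X ^ 2 + C (a * η * e + b * c) * X + C (b * e) := by
    simp only [map_mul, map_add] at h1 ⊢
    linear_combination h1
  have hξ' : ξ - 1 ≠ 0 := sub_ne_zero.mpr hξ
  have hac : a = 0 ∨ c = 0 := by
    have := congrArg (fun p => coeff p 2) h2
    simp only [coeff_add, coeff_C_mul, coeff_X_pow, coeff_X, coeff_C] at this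
    norm_num at this
    have h3 : (ξ - 1) * η * (a * c) = 0 := by linear_combination this
    simpa [hξ', hη] using h3
  have hbe : b = 0 ∨ e = 0 := by
    have := congrArg (fun p => coeff p 0) h2
    simp at this
    have h3 : (ξ - 1) * (b * e) = 0 := by linear_combination this
    simpa [hξ'] using h3
  have hd0 := h.ne_zero
  rcases hac with rfl | rfl
  · have hb : b ≠ 0 := fun hb => hP0 ⟨rfl, hb⟩
    obtain rfl := hbe.resolve_left hb
    have hc : c ≠ 0 := by simpa using hce
    have hcK : algebraMap k K c ≠ 0 := (_root_.map_ne_zero _).mpr hc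
    have hz' : z * w = algebraMap k K (b / c) := by
      rw [map_div₀, eq_div_iff hcK]
      simp only [map_zero, zero_mul, zero_add, add_zero] at hm
      linear_combination hm
    obtain ⟨μ, hμ, hU⟩ := h.exists_mobiusPoly_eq h' (a := 0) (b := b / c) (c := 1) (e := 0)
      (Or.inl one_ne_zero) (by
        rw [map_one, map_zero, zero_mul, one_mul, add_zero, zero_add, mul_comm, hz'])
    have e0 := congrArg (fun p => coeff p 0) hμ
    have e1 := congrArg (fun p => coeff p d) hμ
    have e2 := congrArg (fun p => coeff p (2 * d)) hμ
    simp only [mobiusPoly, branchPoly, map_zero, map_one, zero_mul, zero_add, one_mul, add_zero,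
      ← C_pow, ← mul_assoc, ← C_mul, coeff_add, coeff_C_mul, coeff_X_pow, coeff_C, coeff_one,
      hd0, hd0.symm, Nat.mul_eq_zero, OfNat.ofNat_ne_zero, if_true, if_false,
      or_self, show d ≠ 2 * d by omega, show 2 * d ≠ d by omega, show (0 : ℕ) ≠ 2 * d by omega,
      mul_zero, mul_one] at e0 e1 e2
    obtain ⟨g1, g2, g3⟩ := sq_eq_one_of_mul_eq_one_of_eq e0 e1 e2
    refine ⟨b / c, μ, g1, g2, g3, Or.inr ⟨hz', ?_⟩⟩
    simpa using hU
  · have he : e ≠ 0 := by simpa using hce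
    obtain rfl := hbe.resolve_right he
    have heK : algebraMap k K e ≠ 0 := (_root_.map_ne_zero _).mpr he
    have hz' : z = algebraMap k K (a / e) * w := by
      rw [map_div₀, div_mul_eq_mul_div, eq_div_iff heK]
      simp only [map_zero, zero_mul, zero_add, add_zero] at hm
      linear_combination hm
    obtain ⟨μ, hμ, hU⟩ := h.exists_mobiusPoly_eq h' (a := a / e) (b := 0) (c := 0) (e := 1)
      (Or.inr one_ne_zero) (by simp [hz'])
    have e0 := congrArg (fun p => coeff p 0) hμ
    have e1 := congrArg (fun p => coeff p d) hμ
    have e2 := congrArg (fun p => coeff p (2 * d)) hμ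
    simp only [mobiusPoly, branchPoly, map_zero, map_one, zero_mul, zero_add, add_zero,
      mul_pow, one_pow, ← C_pow, ← mul_assoc, ← C_mul, coeff_add, coeff_C_mul, coeff_X_pow,
      coeff_one, hd0, hd0.symm, Nat.mul_eq_zero, OfNat.ofNat_ne_zero, if_true, if_false,
      or_self, show d ≠ 2 * d by omega, show 2 * d ≠ d by omega, show (0 : ℕ) ≠ 2 * d by omega,
      mul_zero, mul_one] at e0 e1 e2
    obtain ⟨g1, g2, g3⟩ := sq_eq_one_of_mul_eq_one_of_eq e2 e1 e0
    refine ⟨a / e, μ, g1, g2, g3, Or.inl ⟨hz', ?_⟩⟩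
    simpa using hU

/-- The automorphism group of `K` is finite: an automorphism is determined, up to the sign of the
image of `Y`, by the permutation it induces on the branch points, because there are at least three
of them. -/
theorem finite_algEquiv [NeZero (2 : k)] (h : IsHyperellipticPair d t w Y) (hd : 3 ≤ d)
    (S : Finset k) (hS : S.card = 2 * d) (hroot : ∀ x, x ∈ S ↔ (branchPoly d t).eval x = 0) :
    Finite (K ≃ₐ[k] K) := by
  have key (ρ : K ≃ₐ[k] K) : ∃ π : S → S, ∃ a b c e : k,
      (C c * X + C e : k[X]) ≠ 0 ∧
      ((algebraMap k K c * w + algebraMap k K e) * ρ w =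
        algebraMap k K a * w + algebraMap k K b) ∧
      ∀ x : S, (c * x + e) * π x = a * x + b := by
    obtain ⟨a, b, c, e, hce, hm⟩ := h.exists_mobius (h.map ρ) hd
    obtain ⟨μ, hμ, -⟩ := h.exists_mobiusPoly_eq (h.map ρ) hce hm
    have hL0 : (C c * X + C e : k[X]) ≠ 0 := C_mul_X_add_C_ne_zero hce
    have hx (x : S) : ∃ y : S, (c * x + e) * y = a * x + b := by
      have h0 : (mobiusPoly d t a b c e).eval (x : k) = 0 := by
        rw [hμ, eval_mul, (hroot x).mp x.2, mul_zero]
      simp only [mobiusPoly, eval_add, eval_mul, eval_pow, eval_C, eval_X] at h0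
      by_cases hv : c * x + e = 0
      · -- otherwise `ρ w` would be a constant
        exfalso
        rw [hv] at h0
        have hv' : a * x + b = 0 := by
          simpa [h.ne_zero] using h0
        have hb : b = -(a * x) := by linear_combination hv'
        have he : e = -(c * x) := by linear_combination hv
        have hc : c ≠ 0 := by
          rintro rfl
          simp [he] at hce
        have hwx : w - algebraMap k K x ≠ 0 := by
          have := aeval_ne_zero h.transcendental (X_sub_C_ne_zero (x : k))
          simpa using this
        refine (h.map ρ).transcendental ?_
        have : ρ w = algebraMap k K (a / c) := by
          rw [map_div₀, eq_div_iff ((_root_.map_ne_zero _).mpr hc)]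
          apply mul_left_cancel₀ hwx
          rw [hb, he] at hm
          simp only [map_neg, map_mul] at hm
          linear_combination hm
        rw [this]
        exact isAlgebraic_algebraMap _
      · refine ⟨⟨(a * x + b) / (c * x + e), (hroot _).mpr ?_⟩, ?_⟩
        · simp only [branchPoly, eval_add, eval_mul, eval_pow, eval_C, eval_X, eval_one]
          generalize c * (x : k) + e = v at *
          generalize a * (x : k) + b = u at *
          rw [div_pow, div_pow, two_mul, pow_add, pow_add]
          rw [two_mul, pow_add, pow_add] at h0
          field_simp
          linear_combination h0
        · exact mul_div_cancel₀ _ hv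
    choose π hπ using hx
    exact ⟨π, a, b, c, e, hL0, hm, hπ⟩
  choose π a b c e hL hm hπ using key
  have hfib (ρ ρ' : K ≃ₐ[k] K) (hρ : π ρ = π ρ') : ρ w = ρ' w := by
    have hpoly : (C (a ρ) * X + C (b ρ)) * (C (c ρ') * X + C (e ρ')) =
        (C (a ρ') * X + C (b ρ')) * (C (c ρ) * X + C (e ρ)) := by
      refine eq_of_natDegree_lt_card_of_eval_eq' _ _ S (fun x hx => ?_) ?_
      · have h1 := hπ ρ ⟨x, hx⟩
        have h2 := hπ ρ' ⟨x, hx⟩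
        rw [hρ] at h1
        simp only [eval_add, eval_mul, eval_C, eval_X]
        simp only at h1 h2
        rw [← h1, ← h2]
        ring
      · have hl (a b c e : k) : ((C a * X + C b) * (C c * X + C e)).natDegree ≤ 2 :=
          natDegree_mul_le_of_le natDegree_linear_le natDegree_linear_le
        rw [hS]
        refine lt_of_le_of_lt (max_le (hl _ _ _ _) (hl _ _ _ _)) (by omega)
    have h1 := congrArg (aeval w) hpoly
    have hn := mul_ne_zero (aeval_ne_zero h.transcendental (hL ρ))
      (aeval_ne_zero h.transcendental (hL ρ'))
    simp only [map_mul, map_add, aeval_C, aeval_X] at h1 hn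
    apply mul_left_cancel₀ hn
    linear_combination (algebraMap k K (c ρ') * w + algebraMap k K (e ρ')) * hm ρ -
      (algebraMap k K (c ρ) * w + algebraMap k K (e ρ)) * hm ρ' + h1
  rw [← Set.finite_univ_iff]
  have := Set.Finite.preimage' (f := π) (Set.finite_univ) fun q _ => ?_
  · simpa using this
  rcases (π ⁻¹' {q}).eq_empty_or_nonempty with h0 | ⟨ρ₀, hρ₀⟩
  · rw [h0]
    exact Set.finite_empty
  · refine Set.Finite.of_finite_image (f := fun ρ => ρ Y)
      (Set.Finite.subset (Set.toFinite {ρ₀ Y, -ρ₀ Y}) ?_) ?_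
    · rintro _ ⟨ρ, hρ, rfl⟩
      have h1 := hfib ρ ρ₀ (hρ.trans hρ₀.symm)
      have h2 : (ρ Y) ^ 2 = (ρ₀ Y) ^ 2 := by
        rw [(h.map ρ).sq_eq, (h.map ρ₀).sq_eq, h1]
      exact sq_eq_sq_iff_eq_or_eq_neg.mp h2
    · intro ρ hρ ρ' hρ' hY
      exact h.algEquiv_ext (hfib ρ ρ' (Eq.trans hρ (Eq.symm hρ'))) hY

end IsHyperellipticPair

end Mobius

/-! ### Commuting elements of prime order in finite groups -/

section PrimeOrder

/-- In a finite group, two elements of order `ℓ` have conjugates in a common Sylow subgroup, and an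
element of order `ℓ` in the centre of that subgroup commutes with both. -/
theorem exists_commute_conj {G : Type*} [Group G] [Finite G] {ℓ : ℕ} (hℓ : ℓ.Prime) {a b : G}
    (ha : orderOf a = ℓ) (hb : orderOf b = ℓ) :
    ∃ g c : G, orderOf c = ℓ ∧ Commute c (g * a * g⁻¹) ∧ Commute c b := by
  have := Fact.mk hℓ
  have hz (x : G) (hx : orderOf x = ℓ) : IsPGroup ℓ (Subgroup.zpowers x) := by
    apply IsPGroup.of_card (n := 1)
    rw [Nat.card_zpowers, hx, pow_one]
  obtain ⟨P, hP⟩ := (hz a ha).exists_le_sylow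
  obtain ⟨Q, hQ⟩ := (hz b hb).exists_le_sylow
  obtain ⟨g, rfl⟩ := MulAction.exists_smul_eq G P Q
  have haP : a ∈ P := hP (Subgroup.mem_zpowers a)
  have hbQ : b ∈ (g • P : Sylow ℓ G) := hQ (Subgroup.mem_zpowers b)
  have haQ : g * a * g⁻¹ ∈ (g • P : Sylow ℓ G) := by
    have := Subgroup.smul_mem_pointwise_smul a (MulAut.conj g) (P : Subgroup G) haP
    exact this
  generalize (g • P : Sylow ℓ G) = Q at *
  have hb1 : b ≠ 1 := by
    rintro rfl
    rw [orderOf_one] at hb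
    exact hℓ.one_lt.ne hb
  have : Nontrivial Q := ⟨⟨⟨b, hbQ⟩, 1, fun h => hb1 congr(($h : G))⟩⟩
  have hZ : Nontrivial (Subgroup.center Q) := Q.isPGroup'.center_nontrivial
  have hdvd : ℓ ∣ Nat.card (Subgroup.center Q) := by
    obtain ⟨n, hn⟩ := (IsPGroup.iff_card.mp (Q.isPGroup'.to_subgroup (Subgroup.center Q)))
    rw [hn]
    refine dvd_pow_self _ ?_
    rintro rfl
    rw [pow_zero] at hn
    exact (Finite.one_lt_card (α := Subgroup.center Q)).ne' hn
  obtain ⟨c, hc⟩ := exists_prime_orderOf_dvd_card' ℓ hdvd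
  refine ⟨g, ((c : Q) : G), ?_, ?_, ?_⟩
  · rw [Subgroup.orderOf_coe, Subgroup.orderOf_coe, hc]
  · exact congr((($(Subgroup.mem_center_iff.mp c.2 ⟨_, haQ⟩) : Q) : G)).symm
  · exact congr((($(Subgroup.mem_center_iff.mp c.2 ⟨_, hbQ⟩) : Q) : G)).symm

end PrimeOrder

/-! ### Automorphisms of hyperelliptic function fields -/

section Automorphisms

variable {k : Type u} [Field k] {K K' : Type u} [Field K] [Algebra k K] [Field K'] [Algebra k K']
  {d : ℕ} {t t' : k}

namespace IsHyperellipticPair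

variable {w Y z U : K}

theorem aeval_branchPoly (x : K) : aeval x (branchPoly d t) =
    x ^ (2 * d) + algebraMap k K (2 - 4 * t) * x ^ d + 1 := by
  simp [branchPoly]

theorem smul_left (h : IsHyperellipticPair d t w Y) {α : k} (hα : α ^ d = 1) :
    IsHyperellipticPair d t (algebraMap k K α * w) Y := by
  have hα0 : algebraMap k K α ≠ 0 := by
    refine (_root_.map_ne_zero _).mpr ?_
    rintro rfl
    rw [zero_pow h.ne_zero] at hα
    exact zero_ne_one hα
  have hαK : algebraMap k K α ^ d = 1 := by rw [← map_pow, hα, map_one]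
  refine h.of_mem ?_ h.squarefree ?_ (IntermediateField.subset_adjoin _ _ (by simp))
  · rw [h.sq_eq, aeval_branchPoly, aeval_branchPoly, mul_comm 2 d, pow_mul, pow_mul, mul_pow, hαK,
      one_mul]
  · have : w = (algebraMap k K α)⁻¹ * (algebraMap k K α * w) := (inv_mul_cancel_left₀ hα0 w).symm
    generalize algebraMap k K α * w = v at this
    rw [this, ← map_inv₀]
    exact mul_mem (algebraMap_mem _ _) (IntermediateField.subset_adjoin _ _ (by simp))

theorem neg_right (h : IsHyperellipticPair d t w Y) : IsHyperellipticPair d t w (-Y) := by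
  refine h.of_mem ?_ h.squarefree (IntermediateField.subset_adjoin _ _ (by simp)) ?_
  · rw [neg_sq, h.sq_eq]
  · rw [← neg_mem_iff]
    exact IntermediateField.subset_adjoin _ _ (by simp)

theorem inv (h : IsHyperellipticPair d t w Y) : IsHyperellipticPair d t w⁻¹ (Y / w ^ d) := by
  have hw := h.left_ne_zero
  have hm : w ∈ IntermediateField.adjoin k {w⁻¹, Y / w ^ d} := by
    rw [← inv_mem_iff]
    exact IntermediateField.subset_adjoin _ _ (by simp)
  refine h.of_mem ?_ h.squarefree hm ?_
  · rw [div_pow, h.sq_eq, aeval_branchPoly, aeval_branchPoly, mul_comm 2 d, pow_mul, pow_mul]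
    rw [inv_pow]
    field_simp
    ring
  · have : Y = Y / w ^ d * w ^ d := (div_mul_cancel₀ Y (pow_ne_zero d hw)).symm
    generalize Y / w ^ d = v at this hm ⊢
    rw [this]
    exact mul_mem (IntermediateField.subset_adjoin _ _ (by simp)) (pow_mem hm d)

theorem neg_left (h : IsHyperellipticPair d t w Y) (hd : Odd d)
    (hf : Squarefree (branchPoly d (1 - t))) : IsHyperellipticPair d (1 - t) (-w) Y := by
  refine h.of_mem ?_ hf ?_ (IntermediateField.subset_adjoin _ _ (by simp))
  · rw [h.sq_eq, aeval_branchPoly, aeval_branchPoly, mul_comm 2 d, pow_mul, pow_mul, hd.neg_pow,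
      neg_sq]
    simp only [map_sub, map_mul, map_one, map_ofNat]
    ring
  · rw [← neg_mem_iff]
    exact IntermediateField.subset_adjoin _ _ (by simp)

theorem exists_algEquiv_smul (h : IsHyperellipticPair d t w Y) {α : k} (hα : α ^ d = 1) :
    ∃ σ : K ≃ₐ[k] K, σ w = algebraMap k K α * w ∧ σ Y = Y :=
  h.exists_algEquiv (h.smul_left hα)

/-- An automorphism of prime order commuting with `w ↦ η w` is again of this form. -/
theorem exists_eq_mul_of_commute [NeZero (2 : k)] (h : IsHyperellipticPair d t w Y) (hd : 3 ≤ d)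
    {ℓ : ℕ} (hℓ : ℓ.Prime) (hodd : Odd ℓ) {σ c : K ≃ₐ[k] K} {η : k} (hη : IsPrimitiveRoot η ℓ)
    (hσ : σ w = algebraMap k K η * w) (hc : orderOf c = ℓ) (hcσ : Commute c σ) :
    ∃ ξ : k, ξ ≠ 1 ∧ c w = algebraMap k K ξ * w := by
  have hσc : σ (c w) = algebraMap k K η * c w := by
    have := congr($(hcσ.eq) w)
    rw [AlgEquiv.mul_apply, AlgEquiv.mul_apply, hσ, map_mul, AlgEquiv.commutes] at this
    exact this.symm
  obtain ⟨α, μ, -, hμ, -, ⟨h1, h2⟩ | ⟨h1, -⟩⟩ :=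
    h.eq_or_mul_eq (h.map c) hd σ (hη.ne_one hℓ.one_lt) hσ hσc
  · refine ⟨α, ?_, h1⟩
    rintro rfl
    have hpow (n : ℕ) : (c ^ n) Y = algebraMap k K (μ ^ n) * Y := by
      induction n with
      | zero => simp
      | succ n ih =>
        rw [pow_succ', AlgEquiv.mul_apply, ih, map_mul, AlgEquiv.commutes, h2, pow_succ, map_mul,
          mul_assoc]
    have hcℓ := hpow ℓ
    obtain ⟨m, hm⟩ := hodd
    rw [← hc, pow_orderOf_eq_one, hc, hm, pow_succ, pow_mul, hμ, one_pow, one_mul, ← h2,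
      AlgEquiv.one_apply] at hcℓ
    have : c = 1 := h.algEquiv_ext (by simpa using h1) hcℓ.symm
    rw [this, orderOf_one] at hc
    exact hℓ.one_lt.ne hc
  · -- `c w = α / w` would force `η ^ 2 = 1`
    exfalso
    have h3 := congrArg σ h1
    rw [map_mul, hσc, hσ, AlgEquiv.commutes, ← h1] at h3
    have h4 : c w * w ≠ 0 := mul_ne_zero (h.map c).left_ne_zero h.left_ne_zero
    have h5 : η ^ 2 = 1 := by
      apply (algebraMap k K).injective
      rw [map_pow, map_one]
      apply mul_right_cancel₀ h4
      linear_combination h3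
    have h6 := (Nat.prime_dvd_prime_iff_eq hℓ Nat.prime_two).mp (hη.dvd_of_pow_eq_one 2 h5)
    rw [h6] at hodd
    exact absurd hodd (by decide)

/-- The parameter `t` of a hyperelliptic pair is determined by the field up to `t ↦ 1 - t`. -/
theorem eq_or_eq_one_sub [IsAlgClosed k] [NeZero (2 : k)] [NeZero (d : k)]
    (h : IsHyperellipticPair d t w Y) (h' : IsHyperellipticPair d t' z U) (hd : 3 ≤ d)
    (hodd : Odd d) (hsep : (branchPoly d t).Separable) : t' = t ∨ t' = 1 - t := by
  classical
  obtain ⟨ℓ, hℓ, e, he⟩ := Nat.exists_prime_and_dvd (show d ≠ 1 by omega)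
  have hℓodd : Odd ℓ := (Nat.odd_mul.mp (he ▸ hodd)).1
  have hℓk : NeZero (ℓ : k) := ⟨by
    intro h0
    have := NeZero.ne (d : k)
    rw [he, Nat.cast_mul, h0, zero_mul] at this
    exact this rfl⟩
  obtain ⟨η, hη⟩ := HasEnoughRootsOfUnity.exists_primitiveRoot k ℓ
  have hηd : η ^ d = 1 := by rw [he, pow_mul, hη.pow_eq_one, one_pow]
  obtain ⟨a, haz, haU⟩ := h'.exists_algEquiv_smul hηd
  obtain ⟨b, hbw, hbY⟩ := h.exists_algEquiv_smul hηd
  have horder {t : k} {w Y : K} (h : IsHyperellipticPair d t w Y) {σ : K ≃ₐ[k] K}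
      (hw : σ w = algebraMap k K η * w) (hY : σ Y = Y) : orderOf σ = ℓ := by
    have := Fact.mk hℓ
    apply orderOf_eq_prime
    · have hpow (n : ℕ) : (σ ^ n) w = algebraMap k K (η ^ n) * w ∧ (σ ^ n) Y = Y := by
        induction n with
        | zero => simp
        | succ n ih =>
          rw [pow_succ', AlgEquiv.mul_apply, AlgEquiv.mul_apply, ih.1, ih.2, map_mul,
            AlgEquiv.commutes, hw, hY, pow_succ, map_mul, mul_assoc]
          exact ⟨rfl, rfl⟩
      refine h.algEquiv_ext ?_ (hpow ℓ).2
      rw [(hpow ℓ).1, hη.pow_eq_one, map_one, one_mul, AlgEquiv.one_apply]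
    · rintro rfl
      refine hη.ne_one hℓ.one_lt ((algebraMap k K).injective ?_)
      apply mul_right_cancel₀ h.left_ne_zero
      rw [← hw, map_one, one_mul, AlgEquiv.one_apply]
  have hcard : (branchPoly d t).roots.toFinset.card = 2 * d := by
    rw [Multiset.toFinset_card_of_nodup (nodup_roots hsep),
      ← natDegree_branchPoly (t := t) h.ne_zero]
    exact (IsAlgClosed.splits (branchPoly d t)).natDegree_eq_card_roots.symm
  have := h.finite_algEquiv hd _ hcard fun x => by
    rw [Multiset.mem_toFinset, mem_roots (branchPoly_ne_zero h.ne_zero)]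
    rfl
  obtain ⟨g, c, hc, hca, hcb⟩ := exists_commute_conj hℓ (horder h' haz haU) (horder h hbw hbY)
  obtain ⟨ξ₁, -, hcw⟩ := h.exists_eq_mul_of_commute hd hℓ hℓodd hη hbw hc hcb
  have hgz : (g * a * g⁻¹) (g z) = algebraMap k K η * g z := by
    rw [AlgEquiv.mul_apply, AlgEquiv.mul_apply, AlgEquiv.aut_inv, AlgEquiv.symm_apply_apply, haz,
      map_mul, AlgEquiv.commutes]
  obtain ⟨ξ₂, hξ₂, hcz⟩ := (h'.map g).exists_eq_mul_of_commute hd hℓ hℓodd hη hgz hc hca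
  obtain ⟨α, -, hα, -, ht, -⟩ := h.eq_or_mul_eq (h'.map g) hd c hξ₂ hcw hcz
  have h4 : (4 : k) ≠ 0 := by
    rw [show (4 : k) = 2 * 2 by norm_num]
    exact mul_ne_zero two_ne_zero two_ne_zero
  rw [mul_comm 2 d, pow_mul, sq_eq_one_iff] at hα
  rcases hα with hα | hα
  · left
    apply mul_left_cancel₀ h4
    rw [hα] at ht
    linear_combination -ht
  · right
    apply mul_left_cancel₀ h4
    rw [hα] at ht
    linear_combination ht

/-- For `x = (s, .r i)` the automorphism `w ↦ χ(i) w`, `Y ↦ ψ(s) Y`, and for `x = (s, .sr i)` the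
automorphism `w ↦ χ(i) / w`, `Y ↦ ψ(s) Y / w ^ d`. Here `χ(i) = ζ ^ i` and `ψ(s) = (-1) ^ s` for the
characters `χ` and `ψ` of interest. -/
theorem exists_algEquiv_dihedral (h : IsHyperellipticPair d t w Y) (χ : AddChar (ZMod d) k)
    (hχ : ∀ i, χ i ^ d = 1) (ψ : AddChar (ZMod 2) k) (hψ : ∀ i, ψ i ^ 2 = 1)
    (x : Multiplicative (ZMod 2) × DihedralGroup d) : ∃ σ : K ≃ₐ[k] K,
      (∀ i, x.2 = .r i → σ w = algebraMap k K (χ i) * w ∧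
        σ Y = algebraMap k K (ψ x.1.toAdd) * Y) ∧
      (∀ i, x.2 = .sr i → σ w = algebraMap k K (χ i) * w⁻¹ ∧
        σ Y = algebraMap k K (ψ x.1.toAdd) * (Y / w ^ d)) := by
  have hs {z U : K} (h' : IsHyperellipticPair d t z U) :
      IsHyperellipticPair d t z (algebraMap k K (ψ x.1.toAdd) * U) := by
    rcases sq_eq_one_iff.mp (hψ x.1.toAdd) with h1 | h1
    · simpa [h1] using h'
    · simpa [h1] using h'.neg_right
  obtain ⟨s, i | i⟩ := x
  · obtain ⟨σ, hσ⟩ := h.exists_algEquiv (hs (h.smul_left (hχ i)))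
    refine ⟨σ, fun j hj => ?_, fun j hj => by cases hj⟩
    cases hj
    exact hσ
  · obtain ⟨σ, hσ⟩ := h.exists_algEquiv (hs (h.inv.smul_left (hχ i)))
    refine ⟨σ, ?_, fun j hj => ?_⟩
    · rintro j ⟨⟩
    cases hj
    exact hσ

/-- The normalizer of the group generated by `w ↦ ζ w` is the group of the automorphisms
`w ↦ ζ ^ i w`, `Y ↦ ± Y` and `w ↦ ζ ^ i / w`, `Y ↦ ± Y / w ^ d`. -/
theorem nonempty_normalizer_mulEquiv [NeZero (2 : k)] (h : IsHyperellipticPair d t w Y)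
    (hd : 3 ≤ d) (ht : t ≠ 1 / 2) {ζ : k} (hζ : IsPrimitiveRoot ζ d) {σ : K ≃ₐ[k] K}
    (hw : σ w = algebraMap k K ζ * w) (hY : σ Y = Y) :
    Nonempty (Subgroup.normalizer (Subgroup.zpowers σ : Set (K ≃ₐ[k] K)) ≃*
      Multiplicative (ZMod 2) × DihedralGroup d) := by
  have : NeZero d := ⟨h.ne_zero⟩
  have hw0 := h.left_ne_zero
  have hY0 := h.right_ne_zero
  let χ : AddChar (ZMod d) k := AddChar.zmodChar d hζ.pow_eq_one
  have hχinj {i j : ZMod d} (hij : χ i = χ j) : i = j :=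
    ZMod.val_injective d (hζ.pow_inj i.val_lt j.val_lt hij)
  have hχ (i : ZMod d) : χ i ^ d = 1 := by
    rw [AddChar.zmodChar_apply, ← pow_mul, mul_comm, pow_mul, hζ.pow_eq_one, one_pow]
  have hχd (i : ZMod d) : algebraMap k K (χ i) ^ d = 1 := by rw [← map_pow, hχ, map_one]
  have hχ1 : χ 1 = ζ := by
    have := AddChar.zmodChar_apply' (n := d) hζ.pow_eq_one 1
    simpa using this
  have hχ0 (i : ZMod d) : algebraMap k K (χ i) ≠ 0 := by
    refine (_root_.map_ne_zero _).mpr fun h0 => ?_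
    have := hχ i
    rw [h0, zero_pow h.ne_zero] at this
    exact zero_ne_one this
  let ψ : AddChar (ZMod 2) k := AddChar.zmodChar 2 (ζ := -1) (by ring)
  have hψ (i : ZMod 2) : ψ i ^ 2 = 1 := by
    rw [AddChar.zmodChar_apply, ← pow_mul, mul_comm, pow_mul, neg_one_sq, one_pow]
  have hneg : (1 : k) ≠ -1 := by
    intro h0
    apply two_ne_zero (α := k)
    linear_combination h0
  have hψ1 : ψ 1 = -1 := by
    have := AddChar.zmodChar_apply' (n := 2) (ζ := (-1 : k)) (by ring) 1
    simpa using this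
  have hψinj {i j : ZMod 2} (hij : ψ i = ψ j) : i = j := by
    fin_cases i <;> fin_cases j
    · rfl
    · exact absurd ((AddChar.map_zero_eq_one ψ).symm.trans (hij.trans hψ1)) hneg
    · exact absurd ((AddChar.map_zero_eq_one ψ).symm.trans (hij.symm.trans hψ1)) hneg
    · rfl
  choose F hFr hFsr using h.exists_algEquiv_dihedral χ hχ ψ hψ
  have hr (s : Multiplicative (ZMod 2)) (i : ZMod d) := hFr (s, .r i) i rfl
  have hsr (s : Multiplicative (ZMod 2)) (i : ZMod d) := hFsr (s, .sr i) i rfl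
  simp only at hr hsr
  have hmul (x y : Multiplicative (ZMod 2) × DihedralGroup d) : F (x * y) = F x * F y := by
    obtain ⟨s, i | i⟩ := x <;> obtain ⟨s', j | j⟩ := y <;>
    refine h.algEquiv_ext ?_ ?_ <;>
    simp only [Prod.mk_mul_mk, DihedralGroup.r_mul_r, DihedralGroup.r_mul_sr,
      DihedralGroup.sr_mul_r, DihedralGroup.sr_mul_sr, AlgEquiv.mul_apply, hr, hsr, map_mul,
      map_inv₀, map_div₀, map_pow, AlgEquiv.commutes, AddChar.map_add_eq_mul,
      AddChar.map_sub_eq_div, toAdd_mul, mul_pow, inv_pow, hχd]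
    all_goals
      have hχi := hχ0 i
      field_simp
  have hF1 : F (1, .r 1) = σ := by
    refine h.algEquiv_ext ?_ ?_
    · rw [(hr _ _).1, hw, hχ1]
    · rw [(hr _ _).2, hY, toAdd_one, AddChar.map_zero_eq_one, map_one, one_mul]
  let Φ : Multiplicative (ZMod 2) × DihedralGroup d →* (K ≃ₐ[k] K) := MonoidHom.mk' F hmul
  have hinj : Function.Injective Φ := by
    -- `w ^ 2` is not a constant
    have hw2 (α β : k) (hα : algebraMap k K α ≠ 0)
        (h0 : algebraMap k K α * w = algebraMap k K β * w⁻¹) : False := by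
      refine aeval_ne_zero h.transcendental (p := C α * X ^ 2 - C β) ?_ ?_
      · intro h1
        have := congrArg (fun p => coeff p 2) h1
        simp only [coeff_sub, coeff_C_mul, coeff_X_pow, coeff_C, coeff_zero] at this
        norm_num at this
        rw [this, map_zero] at hα
        exact hα rfl
      · simp only [map_sub, map_mul, map_pow, aeval_C, aeval_X]
        field_simp at h0
        linear_combination h0
    rintro ⟨s, i | i⟩ ⟨s', j | j⟩ hxy
    · have h1 := congr($hxy w)
      have h2 := congr($hxy Y)
      change F _ _ = F _ _ at h1 h2
      rw [(hr _ _).1, (hr _ _).1, mul_left_inj' hw0] at h1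
      rw [(hr _ _).2, (hr _ _).2, mul_left_inj' hY0] at h2
      rw [hχinj ((algebraMap k K).injective h1),
        Multiplicative.toAdd.injective (hψinj ((algebraMap k K).injective h2))]
    · have h1 := congr($hxy w)
      change F _ _ = F _ _ at h1
      rw [(hr _ _).1, (hsr _ _).1] at h1
      exact (hw2 _ _ (hχ0 _) h1).elim
    · have h1 := congr($hxy w)
      change F _ _ = F _ _ at h1
      rw [(hr _ _).1, (hsr _ _).1] at h1
      exact (hw2 _ _ (hχ0 _) h1.symm).elim
    · have h1 := congr($hxy w)
      have h2 := congr($hxy Y)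
      change F _ _ = F _ _ at h1 h2
      rw [(hsr _ _).1, (hsr _ _).1, mul_left_inj' (inv_ne_zero hw0)] at h1
      rw [(hsr _ _).2, (hsr _ _).2, mul_left_inj' (div_ne_zero hY0 (pow_ne_zero d hw0))] at h2
      rw [hχinj ((algebraMap k K).injective h1),
        Multiplicative.toAdd.injective (hψinj ((algebraMap k K).injective h2))]
  have hconj (x : Multiplicative (ZMod 2) × DihedralGroup d) :
      Φ x * σ * (Φ x)⁻¹ ∈ Subgroup.zpowers σ := by
    have h1 : x * (1, .r 1) * x⁻¹ = (1, .r 1) ∨ x * (1, .r 1) * x⁻¹ = (1, .r 1)⁻¹ := by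
      obtain ⟨s, i | i⟩ := x
      · left
        simp
      · right
        simp
    have h2 : Φ x * σ * (Φ x)⁻¹ = Φ (x * (1, .r 1) * x⁻¹) := by
      rw [map_mul, map_mul, map_inv, ← hF1]
      rfl
    have h3 : Φ (1, .r 1) = σ := hF1
    rw [h2]
    rcases h1 with h1 | h1
    · rw [h1, h3]
      exact Subgroup.mem_zpowers σ
    · rw [h1, map_inv, h3]
      exact inv_mem (Subgroup.mem_zpowers σ)
  have hconj' (x : Multiplicative (ZMod 2) × DihedralGroup d) {g : K ≃ₐ[k] K}
      (hg : g ∈ Subgroup.zpowers σ) : Φ x * g * (Φ x)⁻¹ ∈ Subgroup.zpowers σ := by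
    obtain ⟨n, rfl⟩ := hg
    simp only
    rw [← conj_zpow]
    exact zpow_mem (hconj x) n
  have hrange : Φ.range = Subgroup.normalizer (Subgroup.zpowers σ : Set (K ≃ₐ[k] K)) := by
    apply le_antisymm
    · rintro _ ⟨x, rfl⟩
      refine Subgroup.mem_normalizer_iff.mpr fun g => ⟨hconj' x, fun hg => ?_⟩
      have := hconj' x⁻¹ hg
      simpa [mul_assoc] using this
    · intro ρ hρ
      obtain ⟨n, hn⟩ := (Subgroup.mem_normalizer_iff.mp hρ σ).mp (Subgroup.mem_zpowers σ)
      have hσ' : (ρ * σ * ρ⁻¹) (ρ w) = algebraMap k K ζ * ρ w := by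
        rw [AlgEquiv.mul_apply, AlgEquiv.mul_apply, AlgEquiv.aut_inv, AlgEquiv.symm_apply_apply,
          hw, map_mul, AlgEquiv.commutes]
      have hpow (n : ℤ) : ∃ η : k, (σ ^ n) w = algebraMap k K η * w := by
        have hz : σ ^ n = Φ ((1, .r 1) ^ n) := by
          rw [map_zpow, ← hF1]
          rfl
        refine ⟨χ (n : ℤ), ?_⟩
        rw [hz]
        have := (hr 1 n).1
        convert this using 2
        simp [Φ]
      obtain ⟨η, hη⟩ := hpow n
      simp only at hn
      rw [hn] at hη
      obtain ⟨α, μ, -, hμ, hα, hcase⟩ :=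
        h.eq_or_mul_eq (h.map ρ) hd _ (hζ.ne_one (by omega)) hη hσ'
      have hA : (2 - 4 * t : k) ≠ 0 := by
        intro h0
        apply ht
        have h2 : (2 : k) ≠ 0 := two_ne_zero
        field_simp
        apply mul_left_cancel₀ h2
        linear_combination -h0
      rw [mul_eq_left₀ hA] at hα
      obtain ⟨i, hi⟩ : ∃ i, χ i = α := by
        obtain ⟨i, -, hi⟩ := hζ.eq_pow_of_pow_eq_one hα
        exact ⟨i, by rw [AddChar.zmodChar_apply', hi]⟩
      obtain ⟨s, hs⟩ : ∃ s, ψ s = μ := by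
        rcases sq_eq_one_iff.mp hμ with rfl | rfl
        · exact ⟨0, AddChar.map_zero_eq_one ψ⟩
        · exact ⟨1, hψ1⟩
      rcases hcase with ⟨h1, h2⟩ | ⟨h1, h2⟩
      · refine ⟨(.ofAdd s, .r i), h.algEquiv_ext ?_ ?_⟩
        · exact (hr _ _).1.trans (by rw [h1, hi])
        · exact (hr _ _).2.trans (by rw [h2, ← hs]; rfl)
      · refine ⟨(.ofAdd s, .sr i), h.algEquiv_ext ?_ ?_⟩
        · exact (hsr _ _).1.trans (by rw [hi, ← h1, mul_inv_cancel_right₀ hw0])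
        · refine (hsr _ _).2.trans ?_
          rw [toAdd_ofAdd, hs, ← mul_div_assoc, ← h2, mul_div_cancel_right₀ _ (pow_ne_zero d hw0)]
  exact ⟨((MonoidHom.ofInjective hinj).trans (MulEquiv.subgroupCongr hrange)).symm⟩

end IsHyperellipticPair

end Automorphisms

/-! ### Fields generated by a radical -/

section RadicalExtension

variable {k : Type u} [Field k] {K : Type u} [Field K] [Algebra k K]

open IntermediateField in
theorem adjoin_simple_adjoin_eq_top {r y : K} (htop : adjoin k {r, y} = ⊤) :
    adjoin k⟮r⟯ {y} = ⊤ := by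
  apply restrictScalars_injective k
  rw [adjoin_adjoin_left, restrictScalars_top, ← htop]
  rfl

open IntermediateField in
/-- If `K = k(r, y)` and some `n`-th power of `y`, with `n` prime to the characteristic, lies in
`k(r)`, then `r` is a separating parameter. -/
theorem IsSeparatingParameter.of_pow_mem {r y : K} (hr : Transcendental k r)
    (htop : adjoin k {r, y} = ⊤) {n : ℕ} (hn : (n : k) ≠ 0) (hy0 : y ≠ 0) (hy : y ^ n ∈ k⟮r⟯) :
    IsSeparatingParameter k r := by
  have hn0 : n ≠ 0 := by
    rintro rfl
    simp at hn
  have hnF : (n : k⟮r⟯) ≠ 0 := by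
    rw [← map_natCast (algebraMap k k⟮r⟯)]
    exact (_root_.map_ne_zero _).mpr hn
  have hc0 : (⟨y ^ n, hy⟩ : k⟮r⟯) ≠ 0 := fun h => pow_ne_zero n hy0 congr(($h : K))
  have hroot : aeval y (X ^ n - C (⟨y ^ n, hy⟩ : k⟮r⟯)) = 0 := by
    rw [map_sub, map_pow, aeval_X, aeval_C]
    exact sub_self _
  have hint : IsIntegral k⟮r⟯ y := ⟨_, monic_X_pow_sub_C _ hn0, hroot⟩
  have hsep : IsSeparable k⟮r⟯ y :=
    (separable_X_pow_sub_C _ hnF hc0).of_dvd (minpoly.dvd _ _ hroot)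
  have htop' := adjoin_simple_adjoin_eq_top htop
  have h1 := (isSeparable_adjoin_simple_iff_isSeparable _ _).mpr hsep
  have h2 := adjoin.finiteDimensional hint
  rw [htop'] at h1 h2
  exact ⟨hr, topEquiv.toLinearEquiv.finiteDimensional, Algebra.IsSeparable.of_algHom _ _
    (topEquiv (F := k⟮r⟯) (E := K)).symm.toAlgHom⟩

open IntermediateField in
theorem finrank_adjoin_simple_eq_two {r y : K} (htop : adjoin k {r, y} = ⊤) (hy : y ^ 2 ∈ k⟮r⟯)
    (hy' : y ∉ k⟮r⟯) : Module.finrank k⟮r⟯ K = 2 := by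
  have hroot : aeval y (X ^ 2 - C (⟨y ^ 2, hy⟩ : k⟮r⟯)) = 0 := by
    rw [map_sub, map_pow, aeval_X, aeval_C]
    exact sub_self _
  have hint : IsIntegral k⟮r⟯ y := ⟨_, monic_X_pow_sub_C _ two_ne_zero, hroot⟩
  have h1 := adjoin.finrank hint
  rw [adjoin_simple_adjoin_eq_top htop, finrank_top'] at h1
  rw [h1]
  have h2 := natDegree_le_of_dvd (minpoly.dvd _ _ hroot) (monic_X_pow_sub_C _ two_ne_zero).ne_zero
  rw [natDegree_X_pow_sub_C] at h2
  have h3 := minpoly.natDegree_pos hint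
  have h4 : (minpoly k⟮r⟯ y).natDegree ≠ 1 := by
    rw [Ne, minpoly.natDegree_eq_one_iff]
    rintro ⟨c, rfl⟩
    exact hy' c.2
  omega

end RadicalExtension

/-! ### The function field of `X_t` -/

section CyclicField

variable {k : Type u} [Field k] {d : ℕ} {t : k}

theorem monic_cyclicPoly (hd : d ≠ 0) : (cyclicPoly d t).Monic := monic_X_pow_sub_C _ hd

theorem natDegree_cyclicPoly : (cyclicPoly d t).natDegree = d := natDegree_X_pow_sub_C

/-- The polynomial is Eisenstein at the prime `x` of `k[x]`. -/
theorem irreducible_cyclicPoly (hd : d ≠ 0) (ht : t ≠ 0) : Irreducible (cyclicPoly d t) := by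
  have hcoeff (n : ℕ) : (cyclicPoly d t).coeff n = (if n = d then 1 else 0) -
      (if n = 0 then X * (X - 1) * (X - C t) ^ (d - 1) else 0) := by
    rw [cyclicPoly, coeff_sub, coeff_X_pow, coeff_C]
  have hE : (cyclicPoly d t).IsEisensteinAt (Ideal.span {(X : k[X])}) := by
    refine ⟨?_, fun {n} hn => ?_, ?_⟩
    · rw [(monic_cyclicPoly hd).leadingCoeff, Ideal.mem_span_singleton]
      exact fun h => not_isUnit_X (isUnit_of_dvd_one h)
    · rw [natDegree_cyclicPoly] at hn
      rw [hcoeff, if_neg hn.ne, Ideal.mem_span_singleton]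
      split_ifs
      · rw [zero_sub, dvd_neg, mul_assoc]
        exact dvd_mul_right _ _
      · simp
    · rw [hcoeff, if_neg hd.symm, if_pos rfl, zero_sub, neg_mem_iff, Ideal.span_singleton_pow,
        Ideal.mem_span_singleton, sq, mul_assoc, mul_dvd_mul_iff_left X_ne_zero, X_dvd_iff,
        coeff_zero_eq_eval_zero]
      simp [ht]
  refine hE.irreducible ?_ (monic_cyclicPoly hd).isPrimitive ?_
  · exact (Ideal.span_singleton_prime X_ne_zero).mpr prime_X
  · rw [natDegree_cyclicPoly]
    exact Nat.pos_of_ne_zero hd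

theorem isDomain_cyclicRing (hd : d ≠ 0) (ht : t ≠ 0) : IsDomain (CyclicRing d t) :=
  AdjoinRoot.isDomain_of_prime (irreducible_cyclicPoly hd ht).prime

theorem transcendental_xCoord (hd : d ≠ 0) : Transcendental k (xCoord d t) := by
  have h (p : k[X]) : aeval (xCoord d t) p =
      algebraMap (CyclicRing d t) _ (AdjoinRoot.of (cyclicPoly d t) p) := by
    induction p using Polynomial.induction_on with
    | C a =>
      rw [aeval_C]
      rfl
    | add p q hp hq => simp only [map_add, hp, hq]
    | monomial n a h => simp only [map_mul, map_pow, aeval_C, aeval_X] at h ⊢; rfl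
  rw [transcendental_iff]
  intro p hp
  rw [h] at hp
  have h1 := IsFractionRing.injective (CyclicRing d t) (CyclicField d t)
    (hp.trans (map_zero _).symm)
  refine AdjoinRoot.of.injective_of_degree_ne_zero ?_ (h1.trans (map_zero _).symm)
  rw [degree_eq_natDegree (monic_cyclicPoly hd).ne_zero, natDegree_cyclicPoly]
  exact_mod_cast hd

theorem yCoord_pow : yCoord d t ^ d =
    xCoord d t * (xCoord d t - 1) * (xCoord d t - algebraMap k _ t) ^ (d - 1) := by
  have h := AdjoinRoot.eval₂_root (cyclicPoly d t)
  have hp (y : CyclicRing d t) : eval₂ (AdjoinRoot.of (cyclicPoly d t)) y (cyclicPoly d t) =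
      y ^ d - AdjoinRoot.of (cyclicPoly d t) (X * (X - 1) * (X - C t) ^ (d - 1)) := by
    conv_lhs => arg 3; rw [cyclicPoly]
    rw [eval₂_sub, eval₂_pow, eval₂_X, eval₂_C]
  rw [hp, sub_eq_zero] at h
  rw [yCoord, ← map_pow, h]
  simp only [map_mul, map_sub, map_pow, map_one]
  rfl

theorem xCoord_sub_ne_zero (hd : d ≠ 0) (c : k) :
    xCoord d t - algebraMap k (CyclicField d t) c ≠ 0 := by
  intro h
  rw [sub_eq_zero] at h
  apply transcendental_xCoord (t := t) hd
  rw [h]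
  exact isAlgebraic_algebraMap _

variable [IsDomain (CyclicRing d t)]

theorem adjoin_coords_eq_top :
    IntermediateField.adjoin k {xCoord d t, yCoord d t} = ⊤ := by
  have hx : xCoord d t ∈ IntermediateField.adjoin k {xCoord d t, yCoord d t} :=
    IntermediateField.subset_adjoin _ _ (by simp)
  have hy : yCoord d t ∈ IntermediateField.adjoin k {xCoord d t, yCoord d t} :=
    IntermediateField.subset_adjoin _ _ (by simp)
  have hof (p : k[X]) : algebraMap (CyclicRing d t) (CyclicField d t)
      (AdjoinRoot.of (cyclicPoly d t) p) ∈
        IntermediateField.adjoin k {xCoord d t, yCoord d t} := by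
    induction p using Polynomial.induction_on with
    | C a => exact algebraMap_mem _ a
    | add p q hp hq =>
      rw [map_add, map_add]
      exact add_mem hp hq
    | monomial n a h =>
      rw [pow_succ, ← mul_assoc, map_mul, map_mul]
      exact mul_mem h hx
  have hmk (a : CyclicRing d t) : algebraMap (CyclicRing d t) (CyclicField d t) a ∈
        IntermediateField.adjoin k {xCoord d t, yCoord d t} := by
    induction a using AdjoinRoot.induction_on with
    | ih P =>
      induction P using Polynomial.induction_on with
      | C a => exact hof a
      | add p q hp hq =>
        rw [map_add, map_add]
        exact add_mem hp hq
      | monomial n a h =>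
        rw [pow_succ, ← mul_assoc, map_mul, map_mul]
        exact mul_mem h hy
  rw [eq_top_iff]
  intro z _
  obtain ⟨a, b, -, rfl⟩ := IsFractionRing.div_surjective (A := CyclicRing d t) z
  exact div_mem (hmk a) (hmk b)

/-- The function `w = y / (x - t)`, which satisfies `w ^ d = x (x - 1) / (x - t)`. -/
def wCoord (d : ℕ) (t : k) [IsDomain (CyclicRing d t)] : CyclicField d t :=
  yCoord d t / (xCoord d t - algebraMap k _ t)

/-- The function `Y = 2 x - 1 - w ^ d`. The equation `x ^ 2 - (1 + w ^ d) x + t w ^ d = 0`, which is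
`w ^ d = x (x - 1) / (x - t)`, becomes `Y ^ 2 = (1 + w ^ d) ^ 2 - 4 t w ^ d`. -/
def hypYCoord (d : ℕ) (t : k) [IsDomain (CyclicRing d t)] : CyclicField d t :=
  2 * xCoord d t - 1 - wCoord d t ^ d

theorem wCoord_mul (hd : d ≠ 0) :
    wCoord d t * (xCoord d t - algebraMap k _ t) = yCoord d t :=
  div_mul_cancel₀ _ (xCoord_sub_ne_zero hd t)

theorem wCoord_pow_mul (hd : d ≠ 0) :
    wCoord d t ^ d * (xCoord d t - algebraMap k _ t) = xCoord d t * (xCoord d t - 1) := by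
  have h0 := xCoord_sub_ne_zero (t := t) hd t
  rw [wCoord, div_pow, yCoord_pow, div_mul_eq_mul_div, div_eq_iff (pow_ne_zero d h0), mul_assoc,
    ← pow_succ, Nat.sub_add_cancel (Nat.pos_of_ne_zero hd)]

/-- The function field of `X_t` is the function field of the curve
`Y ^ 2 = w ^ (2 d) + (2 - 4 t) w ^ d + 1`. -/
theorem isHyperellipticPair_cyclicField (h2 : (2 : k) ≠ 0) (hd : (d : k) ≠ 0) (ht0 : t ≠ 0)
    (ht1 : t ≠ 1) : IsHyperellipticPair d t (wCoord d t) (hypYCoord d t) := by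
  have hd0 : d ≠ 0 := by
    rintro rfl
    simp at hd
  refine IsHyperellipticPair.of_adjoin_eq_top ?_ ?_ (separable_branchPoly h2 hd ht0 ht1).squarefree
    hd0 (transcendental_xCoord hd0)
  · rw [IsHyperellipticPair.aeval_branchPoly, hypYCoord, mul_comm 2 d, pow_mul]
    simp only [map_sub, map_mul, map_ofNat]
    linear_combination -4 * wCoord_pow_mul (t := t) hd0
  · have hw : wCoord d t ∈ IntermediateField.adjoin k {wCoord d t, hypYCoord d t} :=
      IntermediateField.subset_adjoin _ _ (by simp)
    have hY : hypYCoord d t ∈ IntermediateField.adjoin k {wCoord d t, hypYCoord d t} :=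
      IntermediateField.subset_adjoin _ _ (by simp)
    have hx : xCoord d t ∈ IntermediateField.adjoin k {wCoord d t, hypYCoord d t} := by
      have h2K : (2 : CyclicField d t) ≠ 0 := by
        rw [← map_ofNat (algebraMap k (CyclicField d t))]
        exact (_root_.map_ne_zero _).mpr h2
      have : xCoord d t = (hypYCoord d t + 1 + wCoord d t ^ d) / 2 := by
        rw [eq_div_iff h2K, hypYCoord]
        ring
      rw [this]
      exact div_mem (add_mem (add_mem hY (one_mem _)) (pow_mem hw d)) (ofNat_mem _ 2)
    rw [eq_top_iff, ← adjoin_coords_eq_top, IntermediateField.adjoin_le_iff]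
    rintro y (rfl | rfl)
    · exact hx
    · rw [← wCoord_mul hd0]
      exact mul_mem hw (sub_mem hx (algebraMap_mem _ _))

theorem isSeparatingParameter_xCoord (hd : (d : k) ≠ 0) :
    IsSeparatingParameter k (xCoord d t) := by
  have hd0 : d ≠ 0 := by
    rintro rfl
    simp at hd
  have hx := IntermediateField.mem_adjoin_simple_self k (xCoord d t)
  refine .of_pow_mem (transcendental_xCoord hd0) adjoin_coords_eq_top hd (fun h0 => ?_) ?_
  · have h1 := yCoord_pow (d := d) (t := t)
    rw [h0, zero_pow hd0] at h1
    refine mul_ne_zero (mul_ne_zero ?_ ?_) (pow_ne_zero _ (xCoord_sub_ne_zero hd0 t)) h1.symm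
    · simpa using xCoord_sub_ne_zero (t := t) hd0 0
    · simpa using xCoord_sub_ne_zero (t := t) hd0 1
  · rw [yCoord_pow]
    exact mul_mem (mul_mem hx (sub_mem hx (one_mem _)))
      (pow_mem (sub_mem hx (algebraMap_mem _ _)) _)

end CyclicField

/-! ### The degree of a hyperelliptic function field over `k(w)` -/

section HyperellipticParameter

variable {k : Type u} [Field k] {K : Type u} [Field K] [Algebra k K] {d : ℕ} {t : k} {w Y : K}

namespace IsHyperellipticPair

open IntermediateField in
theorem sq_mem_adjoin (h : IsHyperellipticPair d t w Y) : Y ^ 2 ∈ k⟮w⟯ := by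
  rw [h.sq_eq]
  exact algebra_adjoin_le_adjoin k _ (aeval_mem_adjoin_singleton k w)

theorem isSeparatingParameter (h : IsHyperellipticPair d t w Y) (h2 : (2 : k) ≠ 0) :
    IsSeparatingParameter k w :=
  .of_pow_mem (n := 2) h.transcendental h.adjoin_eq_top (by simpa using h2) h.right_ne_zero
    h.sq_mem_adjoin

open IntermediateField in
theorem finrank_eq_two (h : IsHyperellipticPair d t w Y) : Module.finrank k⟮w⟯ K = 2 :=
  finrank_adjoin_simple_eq_two h.adjoin_eq_top h.sq_mem_adjoin h.notMem_adjoin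

end IsHyperellipticPair

end HyperellipticParameter

/-! ### Isomorphisms and automorphisms of the curves `X_t` -/

section Isomorphisms

variable {k : Type u} [Field k] {d : ℕ} {t t' : k}

theorem isCompleteModel_curve [IsDomain (CyclicRing d t)] (hd : (d : k) ≠ 0) :
    IsCompleteModel (curve d t) (curveGenericPoint d t) :=
  isCompleteModel_model (isSeparatingParameter_xCoord hd)

theorem nonempty_curve_iso_iff [IsAlgClosed k] (h2 : (2 : k) ≠ 0) (hdk : (d : k) ≠ 0) (hd : 3 ≤ d)
    (hodd : Odd d) (ht0 : t ≠ 0) (ht1 : t ≠ 1) (ht0' : t' ≠ 0) (ht1' : t' ≠ 1) :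
    Nonempty (curve d t ≅ curve d t') ↔ t' = t ∨ t' = 1 - t := by
  have := isDomain_cyclicRing (d := d) (by omega) ht0
  have := isDomain_cyclicRing (d := d) (by omega) ht0'
  have := NeZero.mk h2
  have := NeZero.mk hdk
  have hX := isCompleteModel_curve (d := d) (t := t) hdk
  have hX' := isCompleteModel_curve (d := d) (t := t') hdk
  have h := isHyperellipticPair_cyclicField h2 hdk ht0 ht1
  have h' := isHyperellipticPair_cyclicField h2 hdk ht0' ht1'
  constructor
  · rintro ⟨φ⟩
    obtain ⟨σ, -⟩ := hX.exists_algEquiv_of_iso hX' φ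
    exact h.eq_or_eq_one_sub (h'.map σ) hd hodd (separable_branchPoly h2 hdk ht0 ht1)
  · rintro (rfl | rfl)
    · exact ⟨Iso.refl _⟩
    · have hneg := h.neg_left hodd (separable_branchPoly h2 hdk ht0' ht1').squarefree
      obtain ⟨σ, -⟩ := h'.exists_algEquiv hneg
      obtain ⟨φ, -⟩ := hX.exists_iso_of_algEquiv hX' σ
      exact ⟨φ⟩

/-- The automorphism `(x, y) ↦ (x, ζ y)` is `w ↦ ζ w`, `Y ↦ Y` in the coordinates `w` and `Y`. -/
theorem exists_isCyclicAut [IsDomain (CyclicRing d t)] (h2 : (2 : k) ≠ 0) (hdk : (d : k) ≠ 0)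
    (ht0 : t ≠ 0) (ht1 : t ≠ 1) {ζ : k} (hζ : ζ ^ d = 1) :
    ∃ τ : Aut (curve d t), IsCyclicAut d t ζ τ := by
  have hX := isCompleteModel_curve (d := d) (t := t) hdk
  have h := isHyperellipticPair_cyclicField h2 hdk ht0 ht1
  obtain ⟨σ, hw, hY⟩ := h.exists_algEquiv_smul hζ
  obtain ⟨τ, hτ⟩ := hX.exists_iso_of_algEquiv hX σ
  have hwd : σ (wCoord d t ^ d) = wCoord d t ^ d := by
    rw [map_pow, hw, mul_pow, ← map_pow, hζ, map_one, one_mul]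
  have hx : σ (xCoord d t) = xCoord d t := by
    have h2K : (2 : CyclicField d t) ≠ 0 := by
      rw [← map_ofNat (algebraMap k (CyclicField d t))]
      exact (_root_.map_ne_zero _).mpr h2
    have h3 := hY
    simp only [hypYCoord, map_sub, map_mul, map_one, map_ofNat, hwd] at h3
    apply mul_left_cancel₀ h2K
    linear_combination h3
  refine ⟨τ, σ.toAlgHom, hx, ?_, hτ.symm⟩
  change σ (yCoord d t) = _
  rw [← wCoord_mul h.ne_zero, map_mul, hw, map_sub, hx, AlgEquiv.commutes, Algebra.smul_def,
    mul_assoc]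

theorem nonempty_autNormalizer_mulEquiv [IsDomain (CyclicRing d t)] (h2 : (2 : k) ≠ 0)
    (hdk : (d : k) ≠ 0) (hd : 3 ≤ d) (ht0 : t ≠ 0) (ht1 : t ≠ 1) (ht2 : t ≠ 1 / 2) {ζ : k}
    (hζ : IsPrimitiveRoot ζ d) {τ : Aut (curve d t)} (hτ : IsCyclicAut d t ζ τ) :
    Nonempty (AutNormalizer d t τ ≃* Multiplicative (ZMod 2) × DihedralGroup d) := by
  have := NeZero.mk h2
  have hX := isCompleteModel_curve (d := d) (t := t) hdk
  have h := isHyperellipticPair_cyclicField h2 hdk ht0 ht1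
  obtain ⟨σ₀, hx, hy, hσ₀⟩ := hτ
  obtain ⟨σ, hσ⟩ := hX.exists_algEquiv_of_iso hX τ
  obtain rfl := hX.algHom_ext (σ := σ₀) (τ := σ.toAlgHom) hσ₀.symm hσ
  change σ _ = _ at hx hy
  have hw : σ (wCoord d t) = algebraMap k _ ζ * wCoord d t := by
    rw [wCoord, map_div₀, hy, map_sub, hx, AlgEquiv.commutes, Algebra.smul_def, mul_div_assoc]
  have hY : σ (hypYCoord d t) = hypYCoord d t := by
    simp only [hypYCoord, map_sub, map_mul, map_one, map_ofNat, map_pow, hx, hw, mul_pow]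
    rw [← map_pow, hζ.pow_eq_one, map_one, one_mul]
  obtain ⟨Φ, hΦ⟩ := hX.exists_mulEquiv_aut
  have hτΦ : Φ σ⁻¹ = τ := by
    ext1
    have := hX.isProper
    refine hX.hom_ext ((hΦ _).trans ?_)
    exact hσ.symm
  have hmap : (Subgroup.zpowers σ).map Φ.toMonoidHom = Subgroup.zpowers τ := by
    rw [← Subgroup.zpowers_inv, MonoidHom.map_zpowers]
    exact congrArg _ hτΦ
  obtain ⟨e⟩ := h.nonempty_normalizer_mulEquiv hd ht2 hζ hw hY
  have h3 := Subgroup.map_equiv_normalizer_eq (Subgroup.zpowers σ) Φ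
  rw [hmap] at h3
  exact ⟨((MulEquiv.subgroupCongr h3.symm).trans (Φ.subgroupMap _).symm).trans e⟩

end Isomorphisms

/-! ### Charts and the double cover -/

section NormalAffineCurve

variable {k : Type u} [Field k] {K : Type u} [Field K] [Algebra k K] {d : ℕ} {t : k} {w Y : K}

open IntermediateField in
/-- An element of `k(w)` which is integral over `k[w]` lies in `k[w]`. -/
theorem exists_aeval_eq_of_isIntegralElem (hw : Transcendental k w) {s : k[X]} (hs : s ≠ 0)
    {p : k[X]} {u : K} (hu : (aeval (R := k) w).toRingHom.IsIntegralElem u)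
    (h : aeval w s * u = aeval w p) : ∃ q : k[X], aeval w q = u := by
  let : Algebra k[X] K := (aeval (R := k) w).toRingHom.toAlgebra
  have hinj : Function.Injective (algebraMap k[X] K) := transcendental_iff_injective.mp hw
  have : FaithfulSMul k[X] K := (faithfulSMul_iff_algebraMap_injective _ _).mpr hinj
  let φ : FractionRing k[X] →ₐ[k[X]] K := IsFractionRing.liftAlgHom (g := Algebra.ofId k[X] K) hinj
  have hs' : algebraMap k[X] (FractionRing k[X]) s ≠ 0 := by simpa using hs
  have hφ : φ (algebraMap k[X] _ p / algebraMap k[X] _ s) = u := by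
    rw [map_div₀, AlgHom.commutes, AlgHom.commutes, div_eq_iff]
    · exact h.symm.trans (mul_comm _ _)
    · exact aeval_ne_zero hw hs
  have hint : IsIntegral k[X] (φ (algebraMap k[X] _ p / algebraMap k[X] _ s)) := by
    rw [hφ]
    exact hu
  rw [isIntegral_algHom_iff φ φ.injective, IsIntegrallyClosed.isIntegral_iff] at hint
  obtain ⟨q, hq⟩ := hint
  refine ⟨q, ?_⟩
  rw [← hφ, ← hq, AlgHom.commutes]
  rfl

namespace IsHyperellipticPair

/-- The ring `k[w, Y]` is the integral closure of `k[w]` in `K`: as the branch polynomial is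
squarefree, the affine plane curve is normal. -/
theorem mem_range_coordHom_iff (h : IsHyperellipticPair d t w Y) (h2 : (2 : k) ≠ 0) (s : K) :
    s ∈ h.coordHom.range ↔ (aeval (R := k) w).toRingHom.IsIntegralElem s := by
  let : Algebra k[X] K := (aeval (R := k) w).toRingHom.toAlgebra
  have hInt (u : K) : (aeval (R := k) w).toRingHom.IsIntegralElem u ↔ IsIntegral k[X] u := Iff.rfl
  have hw (p : k[X]) : IsIntegral k[X] (aeval w p) := isIntegral_algebraMap (R := k[X]) (x := p)
  have hY : IsIntegral k[X] Y := by
    refine IsIntegral.of_pow two_pos ?_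
    rw [h.sq_eq]
    exact hw _
  constructor
  · rintro ⟨x, rfl⟩
    obtain ⟨p, q, rfl⟩ := exists_hypRing_repr x
    rw [map_add, map_mul, coordHom_of, coordHom_of, coordHom_root, hInt]
    exact (hw p).add ((hw q).mul hY)
  · intro hs
    obtain ⟨p, q, r, hr, hpq⟩ := h.exists_repr s
    obtain ⟨σ, hσw, hσY⟩ := h.exists_algEquiv h.neg_right
    have hσ (p : k[X]) : σ (aeval w p) = aeval w p := by
      rw [← Polynomial.aeval_algHom_apply σ w p, hσw]
    have hσs : IsIntegral k[X] (σ s) := by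
      obtain ⟨P, hP, hPs⟩ := hs
      refine ⟨P, hP, ?_⟩
      have h1 := congrArg σ hPs
      rw [map_zero] at h1
      rw [← h1, eval₂_eq_sum_range, eval₂_eq_sum_range, map_sum]
      refine Finset.sum_congr rfl fun n _ => ?_
      rw [map_mul, map_pow]
      exact congrArg (· * _) (hσ _).symm
    have hpq' : aeval w r * σ s = aeval w p - aeval w q * Y := by
      have := congrArg σ hpq
      rw [map_mul, map_add, map_mul, hσ, hσ, hσ, hσY] at this
      rw [this]
      ring
    have h2' : (2 : k[X]) = C 2 := rfl
    have hunit : IsUnit (2 : k[X]) := by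
      rw [h2', isUnit_C]
      exact isUnit_iff_ne_zero.mpr h2
    -- the trace of `s` is a polynomial
    obtain ⟨a, ha⟩ := exists_aeval_eq_of_isIntegralElem h.transcendental hr (p := 2 * p)
      ((hInt _).mpr ((show IsIntegral k[X] s from hs).add hσs)) (by
        rw [map_mul, map_ofNat]
        linear_combination hpq + hpq')
    -- and so is the square of `s - σ s`
    obtain ⟨b, hb⟩ := exists_aeval_eq_of_isIntegralElem h.transcendental (pow_ne_zero 2 hr)
      (p := (2 * q) ^ 2 * branchPoly d t)
      ((hInt _).mpr (((show IsIntegral k[X] s from hs).sub hσs).pow 2)) (by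
        have h3 : aeval w r * (s - σ s) = 2 * aeval w q * Y := by
          linear_combination hpq - hpq'
        rw [map_pow, ← mul_pow, h3, map_mul, map_pow, map_mul, map_ofNat, ← h.sq_eq, mul_pow])
    have h4 : r ^ 2 * b = (2 * q) ^ 2 * branchPoly d t := by
      apply h.aeval_inj
      have h3 : aeval w r * (s - σ s) = 2 * aeval w q * Y := by
        linear_combination hpq - hpq'
      rw [map_mul, map_pow, hb, ← mul_pow, h3, map_mul, map_pow, map_mul, map_ofNat, ← h.sq_eq,
        mul_pow]
    have hrq : r ∣ q := (hunit.dvd_mul_left).mp (dvd_of_sq_dvd_sq_mul h.squarefree ⟨b, h4.symm⟩)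
    have hrp : r ∣ p := by
      rw [← hunit.dvd_mul_left]
      refine ⟨a, ?_⟩
      apply h.aeval_inj
      rw [map_mul, map_mul, ha, map_ofNat]
      linear_combination -hpq - hpq'
    obtain ⟨q', rfl⟩ := hrq
    obtain ⟨p', rfl⟩ := hrp
    refine ⟨AdjoinRoot.of _ p' + AdjoinRoot.of _ q' * AdjoinRoot.root _, ?_⟩
    rw [map_add, map_mul, coordHom_of, coordHom_of, coordHom_root]
    apply mul_left_cancel₀ (aeval_ne_zero h.transcendental hr)
    rw [hpq, map_mul, map_mul]
    ring

/-- If `w` is the coordinate `r` or `1 / r`, then the corresponding chart of the normalization of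
`ℙ¹` along `r` is the affine plane curve with coordinates `w, Y`. -/
theorem exists_isPullback_lineChart (h : IsHyperellipticPair d t w Y) (h2 : (2 : k) ≠ 0)
    {r : K} (hr : r ≠ 0) (j : Fin 2) (hj : (![r⁻¹, r] : Fin 2 → K) j = w) :
    ∃ c : Spec (CommRingCat.of (HypRing d t)) ⟶ (model (k := k) r).left,
      IsPullback c (Spec.map (CommRingCat.ofHom (AdjoinRoot.of (hypPoly d t))))
        (modelToP1 r).left (lineChart j) ∧
      Spec.map (CommRingCat.ofHom h.coordHom) ≫ c = modelGenericPoint r := by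
  refine exists_isPullback_normalization (toP1 (k := k) r) (lineChart j) _
    (toP1_eq_lineChart hr j) _ (CommRingCat.ofHom h.coordHom) ?_ h.coordHom_injective ?_
  · rw [hj, ← CommRingCat.ofHom_comp]
    congr 1
    ext p
    · exact (h.coordHom_of _).trans rfl
    · exact h.coordHom_of _
  · rw [hj]
    exact h.mem_range_coordHom_iff h2

/-- The complete curve with function field `k(w, Y)` is covered by two copies of the affine plane
curve: the one with coordinates `w, Y` and the one with coordinates `1 / w, Y / w ^ d`. -/
theorem exists_charts (h : IsHyperellipticPair d t w Y) (h2 : (2 : k) ≠ 0)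
    {X : Over (Spec (CommRingCat.of k))} {η : Spec (CommRingCat.of K) ⟶ X.left}
    (hX : IsCompleteModel X η) :
    ∃ c c' : Spec (CommRingCat.of (HypRing d t)) ⟶ X.left, IsOpenImmersion c ∧
      IsOpenImmersion c' ∧ Spec.map (CommRingCat.ofHom h.coordHom) ≫ c = η ∧
      Spec.map (CommRingCat.ofHom h.inv.coordHom) ≫ c' = η ∧
      ∀ x, x ∈ Set.range c ∨ x ∈ Set.range c' := by
  have hsep := h.isSeparatingParameter h2
  obtain ⟨φ, hφ⟩ := hX.exists_iso_of_algEquiv (isCompleteModel_model hsep) AlgEquiv.refl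
  have hφ' : η ≫ φ.hom.left = modelGenericPoint w := by
    rw [hφ]
    exact (congrArg (· ≫ _) (Spec.map_id _)).trans (Category.id_comp _)
  have hφ2 : modelGenericPoint w ≫ φ.inv.left = η := by
    rw [← hφ', Category.assoc, ← Over.comp_left, φ.hom_inv_id, Over.id_left, Category.comp_id]
  have : IsIso φ.inv.left := inferInstanceAs (IsIso ((Over.forget _).map φ.inv))
  obtain ⟨c, hc, hcη⟩ := h.exists_isPullback_lineChart h2 h.left_ne_zero 1 rfl
  obtain ⟨c', hc', hcη'⟩ := h.inv.exists_isPullback_lineChart h2 h.left_ne_zero 0 rfl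
  have : IsOpenImmersion c :=
    MorphismProperty.of_isPullback hc.flip (inferInstanceAs (IsOpenImmersion (lineChart 1)))
  have : IsOpenImmersion c' :=
    MorphismProperty.of_isPullback hc'.flip (inferInstanceAs (IsOpenImmersion (lineChart 0)))
  refine ⟨c ≫ φ.inv.left, c' ≫ φ.inv.left, inferInstance, inferInstance, ?_, ?_, fun x => ?_⟩
  · rw [← Category.assoc, hcη, hφ2]
  · rw [← Category.assoc, hcη', hφ2]
  · have hx : φ.inv.left (φ.hom.left x) = x := by
      rw [← Scheme.Hom.comp_apply, ← Over.comp_left, φ.hom_inv_id, Over.id_left]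
      rfl
    have hr {j : Fin 2} {z : Spec (CommRingCat.of k[X])}
        {c : Spec (CommRingCat.of (HypRing d t)) ⟶ (model (k := k) w).left}
        (hc : IsPullback c (Spec.map (CommRingCat.ofHom (AdjoinRoot.of (hypPoly d t))))
          (modelToP1 w).left (lineChart j))
        (hz : lineChart j z = (modelToP1 w).left (φ.hom.left x)) :
        x ∈ Set.range (c ≫ φ.inv.left) := by
      obtain ⟨u, hu, -⟩ := Scheme.exists_preimage_of_isPullback hc (φ.hom.left x) z hz.symm
      exact ⟨u, by rw [Scheme.Hom.comp_apply, hu, hx]⟩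
    obtain ⟨j, z, hz⟩ := exists_lineChart_eq ((modelToP1 w).left (φ.hom.left x))
    fin_cases j
    · exact Or.inr (hr hc' hz)
    · exact Or.inl (hr hc hz)

/-- The morphism `w` from the complete curve with function field `k(w, Y)` to `ℙ¹` has degree two.
-/
theorem exists_isDoubleCover (h : IsHyperellipticPair d t w Y) (h2 : (2 : k) ≠ 0)
    {X : Over (Spec (CommRingCat.of k))} {η : Spec (CommRingCat.of K) ⟶ X.left}
    (hX : IsCompleteModel X η) : ∃ π : X ⟶ P1 k, IsDoubleCover π ∧ η ≫ π.left = toP1 w := by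
  have hsep := h.isSeparatingParameter h2
  have := Fact.mk hsep
  obtain ⟨φ, hφ⟩ := hX.exists_iso_of_algEquiv (isCompleteModel_model hsep) AlgEquiv.refl
  have hφ' : η ≫ φ.hom.left = modelGenericPoint w := by
    rw [hφ]
    exact (congrArg (· ≫ _) (Spec.map_id _)).trans (Category.id_comp _)
  have : IsIso φ.hom.left := inferInstanceAs (IsIso ((Over.forget _).map φ.hom))
  refine ⟨φ.hom ≫ modelToP1 w, ⟨?_, ?_, fun s => ?_⟩, ?_⟩
  · rw [Over.comp_left]
    infer_instance
  · rw [Over.comp_left]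
    infer_instance
  · rw [Over.comp_left, Scheme.Hom.finrank_comp_left_of_isIso, finrank_modelToP1 hsep,
      h.finrank_eq_two]
  · rw [Over.comp_left, ← Category.assoc, hφ', modelGenericPoint_comp_modelToP1]

end IsHyperellipticPair

end NormalAffineCurve

/-! ### Partial isomorphisms given by open immersions -/

section PartialIsomorphisms

variable {U X S : Scheme.{u}}

/-- The partial isomorphism from `X` to `U` inverse to a dominant open immersion `U ⟶ X`. -/
def partialIsoOfOpenImmersion (j : U ⟶ X) [IsOpenImmersion j] [IsDominant j] :
    X.PartialIso U where
  source := j.opensRange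
  dense_source := j.denseRange
  target := ⊤
  dense_target := dense_univ
  iso := j.isoOpensRange.symm ≪≫ U.topIso.symm

theorem partialIsoOfOpenImmersion_hom_comp (j : U ⟶ X) [IsOpenImmersion j] [IsDominant j] :
    (partialIsoOfOpenImmersion j).iso.hom ≫ (partialIsoOfOpenImmersion j).target.ι ≫ j =
      (partialIsoOfOpenImmersion j).source.ι := by
  change (j.isoOpensRange.inv ≫ U.topIso.inv) ≫ (⊤ : U.Opens).ι ≫ j = j.opensRange.ι
  have : U.topIso.inv ≫ (⊤ : U.Opens).ι = 𝟙 U := U.topIso.inv_hom_id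
  rw [Category.assoc, reassoc_of% this, Scheme.Hom.isoOpensRange_inv_comp]

/-- A commutative square of an automorphism of `U`, an automorphism of `X`, and a dominant open
immersion, in terms of the corresponding partial isomorphism. -/
theorem toRationalMap_trans_partialIsoOfOpenImmersion (j : U ⟶ X) [IsOpenImmersion j]
    [IsDominant j] (φ : X ≅ X) (ψ : U ⟶ U) (h : ψ ≫ j = j ≫ φ.hom) :
    ((Scheme.PartialIso.ofIso φ).trans (partialIsoOfOpenImmersion j)).toRationalMap =
      (partialIsoOfOpenImmersion j).toRationalMap.compHom ψ := by
  have h1 : (Scheme.PartialIso.ofIso φ).IsOver φ.hom (𝟙 X) := by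
    change (X.topIso.hom ≫ φ.hom ≫ X.topIso.inv) ≫ (⊤ : X.Opens).ι ≫ 𝟙 X = (⊤ : X.Opens).ι ≫ φ.hom
    have : X.topIso.inv ≫ (⊤ : X.Opens).ι = 𝟙 X := X.topIso.inv_hom_id
    rw [Category.comp_id, Category.assoc, Category.assoc, this, Category.comp_id]
    rfl
  have h2 : (partialIsoOfOpenImmersion j).IsOver (𝟙 X) j := by
    rw [Scheme.PartialIso.IsOver, Category.comp_id]
    exact partialIsoOfOpenImmersion_hom_comp j
  have h3 := h1.trans h2
  rw [Scheme.PartialIso.toRationalMap, Scheme.PartialIso.toRationalMap,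
    ← Scheme.RationalMap.compHom_toRationalMap, Scheme.PartialMap.toRationalMap_eq_iff]
  have h4 : ((Scheme.PartialIso.ofIso φ).trans (partialIsoOfOpenImmersion j)).toPartialMap.hom ≫ j =
      Scheme.Opens.ι _ ≫ φ.hom := (Category.assoc _ _ _).trans h3
  have h5 : ((partialIsoOfOpenImmersion j).toPartialMap.compHom ψ).hom ≫ j =
      Scheme.Opens.ι _ ≫ φ.hom := by
    change (((partialIsoOfOpenImmersion j).iso.hom ≫ (partialIsoOfOpenImmersion j).target.ι) ≫ ψ) ≫
      j = (partialIsoOfOpenImmersion j).source.ι ≫ φ.hom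
    rw [Category.assoc, h, Category.assoc, ← partialIsoOfOpenImmersion_hom_comp j, Category.assoc,
      Category.assoc]
  generalize (Scheme.PartialIso.ofIso φ).trans (partialIsoOfOpenImmersion j) = f at h4 ⊢
  generalize f.toPartialMap = f at h4 ⊢
  generalize (partialIsoOfOpenImmersion j).toPartialMap.compHom ψ = g at h5 ⊢
  refine ⟨f.domain ⊓ g.domain, f.dense_domain.inter_of_isOpen_left g.dense_domain f.domain.2,
    inf_le_left, inf_le_right, ?_⟩
  change X.homOfLE inf_le_left ≫ f.hom = X.homOfLE inf_le_right ≫ g.hom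
  rw [← cancel_mono j, Category.assoc, Category.assoc, h4, h5, Scheme.homOfLE_ι_assoc,
    Scheme.homOfLE_ι_assoc]

/-- An open immersion `c` of `H` into a complete curve, through which the generic point factors, is
inverse to a partial isomorphism over `k`. It carries an automorphism `ι` of the curve to an
endomorphism `ψ` of `H` if `ι` and `ψ` agree at the generic point. -/
theorem IsCompleteModel.exists_partialIso_of_openImmersion {k : Type u} [Field k] {K : Type u}
    [Field K] [Algebra k K] {X H : Over (Spec (CommRingCat.of k))}
    {η : Spec (CommRingCat.of K) ⟶ X.left} (hX : IsCompleteModel X η) [IsIntegral H.left]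
    {s : Spec (CommRingCat.of K) ⟶ H.left} {c : H.left ⟶ X.left} (hs : IsDominant s)
    (hc : IsOpenImmersion c) (hsc : s ≫ c = η)
    (hsH : s ≫ H.hom = Spec.map (CommRingCat.ofHom (algebraMap k K))) (ι : Aut X)
    {σ : K →+* K} (hι : η ≫ ι.hom.left = Spec.map (CommRingCat.ofHom σ) ≫ η)
    {ψ : H.left ⟶ H.left} (hψ : ψ ≫ H.hom = H.hom)
    (hsψ : s ≫ ψ = Spec.map (CommRingCat.ofHom σ) ≫ s) :
    ∃ e : Scheme.PartialIso X.left H.left, e.IsOver X.hom H.hom ∧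
      ((Scheme.PartialIso.ofIso ((Over.forget _).mapIso ι)).trans e).toRationalMap =
        e.toRationalMap.compHom ψ := by
  have := hX.isIntegral
  have := hX.isProper
  have : IsDominant c := by
    have := hX.isDominant
    rw [← hsc] at this
    exact IsDominant.of_comp s c
  have hcH : c ≫ X.hom = H.hom := by
    refine ext_of_isDominant s ?_
    rw [← Category.assoc, hsc, hX.comp_hom, hsH]
  refine ⟨partialIsoOfOpenImmersion c, ?_, toRationalMap_trans_partialIsoOfOpenImmersion c _ _ ?_⟩
  · rw [Scheme.PartialIso.IsOver, ← hcH, ← partialIsoOfOpenImmersion_hom_comp c]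
    simp only [Category.assoc]
  · change ψ ≫ c = c ≫ ι.hom.left
    refine ext_of_isDominant_of_isSeparated X.hom ?_ s ?_
    · rw [Category.assoc, Category.assoc, Over.w, hcH, hψ]
    · rw [reassoc_of% hsψ, hsc, ← hι, ← hsc, Category.assoc]

end PartialIsomorphisms

/-! ### The birational model and the hyperelliptic involution -/

section BirationalModel

variable {k : Type u} [Field k] {K : Type u} [Field K] [Algebra k K] {d : ℕ} {t : k} {w Y : K}

theorem negY_of (p : k[X]) : negY d t (AdjoinRoot.of _ p) = AdjoinRoot.of _ p :=
  AdjoinRoot.lift_of _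

theorem negY_root : negY d t (AdjoinRoot.root _) = -AdjoinRoot.root _ :=
  AdjoinRoot.lift_root _

namespace IsHyperellipticPair

theorem coordHom_negY (h : IsHyperellipticPair d t w Y) {σ : K ≃ₐ[k] K} (hw : σ w = w)
    (hY : σ Y = -Y) (x : HypRing d t) : h.coordHom (negY d t x) = σ (h.coordHom x) := by
  obtain ⟨p, q, rfl⟩ := exists_hypRing_repr x
  simp only [map_add, map_mul, negY_of, negY_root, map_neg, coordHom_of, coordHom_root, hY,
    ← aeval_algHom_apply, hw]

/-- The complete curve with function field `k(w, Y)` is birational to the affine plane curve, and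
`Y ↦ -Y` is the deck transformation of its morphism `w` to `ℙ¹`. -/
theorem exists_partialIso (h : IsHyperellipticPair d t w Y) (h2 : (2 : k) ≠ 0)
    {X : Over (Spec (CommRingCat.of k))} {η : Spec (CommRingCat.of K) ⟶ X.left}
    (hX : IsCompleteModel X η) :
    ∃ e : Scheme.PartialIso X.left (hypCurve d t).left, e.IsOver X.hom (hypCurve d t).hom ∧
      ∃ ι : Aut X, IsHyperellipticInvolution ι ∧
        ((Scheme.PartialIso.ofIso ((Over.forget _).mapIso ι)).trans e).toRationalMap =
          e.toRationalMap.compHom (hypCurveInvolution d t) := by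
  obtain ⟨c, -, hc, -, hcη, -, -⟩ := h.exists_charts h2 hX
  obtain ⟨σ, hσw, hσY⟩ := h.exists_algEquiv h.neg_right
  obtain ⟨π, hπ, hπη⟩ := h.exists_isDoubleCover h2 hX
  obtain ⟨Φ, hΦ⟩ := hX.exists_mulEquiv_aut
  have := hX.isProper
  have hσσ : σ * σ = 1 := by
    refine h.algEquiv_ext ?_ ?_
    · rw [AlgEquiv.mul_apply, hσw, hσw, AlgEquiv.one_apply]
    · rw [AlgEquiv.mul_apply, hσY, map_neg, hσY, neg_neg, AlgEquiv.one_apply]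
  have hσ1 : σ ≠ 1 := by
    rintro rfl
    rw [AlgEquiv.one_apply, eq_neg_iff_add_eq_zero, ← two_mul, mul_eq_zero,
      or_iff_left h.right_ne_zero, ← map_ofNat (algebraMap k K), map_eq_zero] at hσY
    exact h2 hσY
  have hσinv : σ.symm = σ := inv_eq_of_mul_eq_one_left hσσ
  have hι : η ≫ (Φ σ).hom.left = Spec.map (CommRingCat.ofHom (σ : K →+* K)) ≫ η := by
    have := hΦ σ
    rwa [hσinv] at this
  have hinv : IsHyperellipticInvolution (Φ σ) := by
    refine ⟨?_, ?_, π, hπ, hX.hom_ext ?_⟩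
    · rwa [Ne, map_eq_one_iff _ Φ.injective]
    · rw [← map_mul, hσσ, map_one]
    · have h1 := toP1_comp_algHom w σ.toAlgHom
      rw [Over.comp_left, ← Category.assoc, hι, Category.assoc, hπη]
      exact h1.trans (congrArg (toP1 (k := k)) hσw)
  have : IsDomain (HypRing d t) := h.coordHom_injective.isDomain h.coordHom
  have : IsIntegral (hypCurve d t).left :=
    inferInstanceAs (IsIntegral (Spec (CommRingCat.of (HypRing d t))))
  have hdom : IsDominant (Spec.map (CommRingCat.ofHom h.coordHom)) := by
    constructor
    exact (PrimeSpectrum.denseRange_comap_iff_ker_le_nilRadical _).mpr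
      (((RingHom.injective_iff_ker_eq_bot _).mp h.coordHom_injective).le.trans bot_le)
  obtain ⟨e, he, he'⟩ := hX.exists_partialIso_of_openImmersion (H := hypCurve d t)
    (s := Spec.map (CommRingCat.ofHom h.coordHom)) (c := c) (hs := hdom) (hc := hc) hcη
    (by
      refine (Spec.map_comp _ _).symm.trans ?_
      rw [← CommRingCat.ofHom_comp]
      exact congrArg (fun f => Spec.map (CommRingCat.ofHom f))
        (RingHom.ext h.coordHom_algebraMap)) (Φ σ) hι (ψ := hypCurveInvolution d t)
    (by
      refine (Spec.map_comp _ _).symm.trans ?_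
      rw [← CommRingCat.ofHom_comp]
      exact congrArg (fun f => Spec.map (CommRingCat.ofHom f))
        (RingHom.ext fun x => negY_of (C x)))
    (by
      refine (Spec.map_comp _ _).symm.trans (Eq.trans ?_ (Spec.map_comp _ _))
      rw [← CommRingCat.ofHom_comp, ← CommRingCat.ofHom_comp]
      exact congrArg (fun f => Spec.map (CommRingCat.ofHom f))
        (RingHom.ext (h.coordHom_negY hσw hσY)))
  exact ⟨e, he, Φ σ, hinv, he'⟩

end IsHyperellipticPair

end BirationalModel

/-! ### Differentials on a hyperelliptic curve -/

section Differentials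

variable {k : Type u} [Field k] {K : Type u} [Field K] [Algebra k K] {d : ℕ} {t : k} {w Y : K}

open IntermediateField TensorProduct in
/-- The differential of a separating parameter `r` does not vanish: `K` is formally étale over
`k[r]`, so that `dr` is a basis of the differentials of `K`. -/
theorem IsSeparatingParameter.D_ne_zero {r : K} (hr : IsSeparatingParameter k r) :
    KaehlerDifferential.D k K r ≠ 0 := by
  let : Algebra k[X] K := (aeval (R := k) r).toRingHom.toAlgebra
  let : Algebra k[X] k⟮r⟯ := (aeval (R := k) (AdjoinSimple.gen k r)).toRingHom.toAlgebra
  have : IsScalarTower k[X] k⟮r⟯ K := by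
    refine .of_algebraMap_eq fun p => ?_
    change aeval r p = algebraMap k⟮r⟯ K (aeval (AdjoinSimple.gen k r) p)
    rw [← aeval_algebraMap_apply]
    rfl
  have : IsScalarTower k k[X] K := by
    refine .of_algebraMap_eq fun c => ?_
    change _ = aeval r (algebraMap k k[X] c)
    rw [AlgHom.commutes]
  have := isFractionRing_adjoin_simple hr.transcendental
  have := hr.separable
  have : Algebra.FormallyEtale k[X] k⟮r⟯ := .of_isLocalization (nonZeroDivisors k[X])
  have : Algebra.FormallyEtale k⟮r⟯ K := .of_isSeparable _ _
  have : Algebra.FormallyEtale k[X] K := .comp k[X] k⟮r⟯ K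
  intro h0
  have h1 := KaehlerDifferential.tensorKaehlerEquivOfFormallyEtale_symm_D_algebraMap k k[X] K X
  have h2 : algebraMap k[X] K X = r := aeval_X r
  rw [h2, h0, map_zero] at h1
  have h3 := congrArg (TensorProduct.rid k[X] K ∘
    LinearMap.lTensor K (KaehlerDifferential.polynomialEquiv k).toLinearMap) h1
  simp at h3

namespace IsHyperellipticPair

/-- The differential `dw / Y` is regular on the affine plane curve: if `a f + b f' = 1`, where
`f` is the branch polynomial, it is equal to `a Y dw + 2 b dY`. -/
theorem exists_smul_D_eq (h : IsHyperellipticPair d t w Y) (hsep : (branchPoly d t).Separable) :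
    ∃ a b : k[X], Y⁻¹ • KaehlerDifferential.D k K w =
      (aeval w a * Y) • KaehlerDifferential.D k K w +
        (2 * aeval w b) • KaehlerDifferential.D k K Y := by
  obtain ⟨a, b, hab⟩ := hsep
  refine ⟨a, b, ?_⟩
  have h1 := congrArg (KaehlerDifferential.D k K) h.sq_eq
  rw [Derivation.leibniz_pow, Derivation.map_aeval] at h1
  have h2 := congrArg (aeval w) hab
  rw [map_add, map_mul, map_mul, ← h.sq_eq, map_one] at h2
  have hY := h.right_ne_zero
  have h3 : (2 * Y) • KaehlerDifferential.D k K Y =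
      aeval w (derivative (branchPoly d t)) • KaehlerDifferential.D k K w := by
    rw [← h1, mul_smul, pow_one, ← Nat.cast_smul_eq_nsmul K, Nat.cast_ofNat]
  have h4 : (2 * aeval w b) • KaehlerDifferential.D k K Y =
      (aeval w b * aeval w (derivative (branchPoly d t)) * Y⁻¹) •
        KaehlerDifferential.D k K w := by
    rw [mul_right_comm, mul_smul _ _ (KaehlerDifferential.D k K w), ← h3, smul_smul]
    congr 1
    field_simp
  rw [h4, ← add_smul]
  congr 1
  field_simp
  linear_combination -h2

/-- The differentials `wⁿ dw / Y` are regular on the affine plane curve. -/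
theorem smul_D_mem_span (h : IsHyperellipticPair d t w Y) (hsep : (branchPoly d t).Separable)
    (S : Set K) (hS : (h.coordHom.range : Set K) ⊆ S) (c : k) (n : ℕ) :
    (algebraMap k K c * w ^ n * Y⁻¹) • KaehlerDifferential.D k K w ∈
      Submodule.span k {ω | ∃ a ∈ S, ∃ b ∈ S, ω = a • KaehlerDifferential.D k K b} := by
  obtain ⟨a, b, hab⟩ := h.exists_smul_D_eq hsep
  have hw (p : k[X]) : aeval w p ∈ h.coordHom.range := ⟨AdjoinRoot.of _ p, h.coordHom_of p⟩
  have hw' : w ∈ h.coordHom.range := by simpa using hw X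
  have hY : Y ∈ h.coordHom.range := ⟨AdjoinRoot.root _, h.coordHom_root⟩
  have hc : algebraMap k K c ∈ h.coordHom.range := ⟨_, h.coordHom_algebraMap c⟩
  rw [mul_smul, hab, smul_add, smul_smul, smul_smul]
  refine add_mem (Submodule.subset_span ⟨_, hS ?_, _, hS hw', rfl⟩)
    (Submodule.subset_span ⟨_, hS ?_, _, hS hY, rfl⟩)
  · exact mul_mem (mul_mem hc (pow_mem hw' n)) (mul_mem (hw a) hY)
  · exact mul_mem (mul_mem hc (pow_mem hw' n)) (mul_mem (ofNat_mem _ 2) (hw b))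

/-- The differential `wⁿ dw / Y` in terms of the coordinates `1 / w` and `Y / w ^ d`, where it is
regular because `m = d - 2 - n` is nonnegative. -/
theorem smul_D_eq_smul_D_inv (h : IsHyperellipticPair d t w Y) {n m : ℕ} (hnm : n + m + 2 = d) :
    (algebraMap k K 1 * w ^ n * Y⁻¹) • KaehlerDifferential.D k K w =
      (algebraMap k K (-1) * w⁻¹ ^ m * (Y / w ^ d)⁻¹) • KaehlerDifferential.D k K w⁻¹ := by
  have hw := h.left_ne_zero
  have h1 : KaehlerDifferential.D k K w⁻¹ = -((w ^ 2)⁻¹ • KaehlerDifferential.D k K w) := by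
    have := congrArg (KaehlerDifferential.D k K) (mul_inv_cancel₀ hw)
    rw [Derivation.leibniz, Derivation.map_one_eq_zero] at this
    have h2 := congrArg (w⁻¹ • ·) this
    simp only [smul_add, smul_smul, inv_mul_cancel₀ hw, one_smul, smul_zero] at h2
    rw [eq_neg_of_add_eq_zero_left h2, sq, mul_inv]
  rw [h1, smul_neg, ← neg_smul, smul_smul]
  congr 1
  have hY := h.right_ne_zero
  subst hnm
  rw [map_neg, map_one, inv_pow]
  field_simp
  ring

/-- The differentials `dw / Y` and `w dw / Y` are linearly independent. -/
theorem linearIndependent_smul_D (h : IsHyperellipticPair d t w Y) (h2 : (2 : k) ≠ 0) :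
    LinearIndependent k (fun n : Fin 2 =>
      (algebraMap k K 1 * w ^ (n : ℕ) * Y⁻¹) • KaehlerDifferential.D k K w) := by
  have hD := (h.isSeparatingParameter h2).D_ne_zero
  rw [Fintype.linearIndependent_iff]
  intro g hg
  rw [Fin.sum_univ_two, ← algebraMap_smul K (g 0), ← algebraMap_smul K (g 1), smul_smul, smul_smul,
    ← add_smul, smul_eq_zero, or_iff_left hD] at hg
  have h3 : aeval w (C (g 1) * X + C (g 0)) = 0 := by
    simp only [map_add, map_mul, aeval_C, aeval_X]
    apply mul_right_cancel₀ (inv_ne_zero h.right_ne_zero)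
    simp at hg
    linear_combination hg
  have h4 : C (g 1) * X + C (g 0) = 0 := by
    by_contra h5
    exact aeval_ne_zero h.transcendental h5 h3
  have e1 := congrArg (fun p => coeff p 1) h4
  have e0 := congrArg (fun p => coeff p 0) h4
  simp at e0 e1
  intro i
  fin_cases i
  · exact e0
  · exact e1

end IsHyperellipticPair

end Differentials

/-! ### The genus -/

section Genus

/-- The coordinate ring of an affine chart maps to the local rings of the points of the chart. -/
theorem exists_stalk_eq {X : Scheme.{u}} [IsIntegral X] {B : CommRingCat.{u}}
    (c : Spec B ⟶ X) [IsOpenImmersion c] (i : B ⟶ X.functionField)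
    (hi : Spec.map i ≫ c = X.fromSpecStalk (genericPoint X)) (z : Spec B) (b : B) :
    ∃ s : X.presheaf.stalk (c z), algebraMap _ X.functionField s = i.hom b := by
  let g : (Spec B).presheaf.stalk z ⟶ X.presheaf.stalk (c z) := inv (c.stalkMap z)
  have hg : c.stalkMap z ≫ g = 𝟙 _ := IsIso.hom_inv_id (c.stalkMap z)
  let θ : B ⟶ X.presheaf.stalk (c z) := StructureSheaf.toStalk B z ≫ g
  have hθ : Spec.map θ ≫ c = X.fromSpecStalk (c z) := by
    have h1 : Spec.map (c.stalkMap z) ≫ X.fromSpecStalk (c z) = (Spec B).fromSpecStalk z ≫ c :=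
      Scheme.SpecMap_stalkMap_fromSpecStalk c
    have h2 : (Spec B).fromSpecStalk z = Spec.map (StructureSheaf.toStalk B z) :=
      AlgebraicGeometry.Spec.fromSpecStalk_eq' B _
    rw [h2] at h1
    refine (congrArg (· ≫ c) (Spec.map_comp _ _)).trans ((Category.assoc _ _ _).trans ?_)
    refine (congrArg (Spec.map g ≫ ·) h1.symm).trans ?_
    rw [← Spec.map_comp_assoc, hg, Spec.map_id, Category.id_comp]
  have hx : genericPoint X ⤳ c z := (genericPoint_spec X).specializes trivial
  have h3 : θ ≫ X.presheaf.stalkSpecializes hx = i := by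
    apply Spec.map_injective
    rw [← cancel_mono c, hi, Spec.map_comp, Category.assoc, hθ,
      Scheme.SpecMap_stalkSpecializes_fromSpecStalk]
  exact ⟨θ.hom b, congr(($h3).hom b)⟩

variable {k : Type u} [Field k] {K : Type u} [Field K] [Algebra k K]
  {X : Over (Spec (CommRingCat.of k))} {η : Spec (CommRingCat.of K) ⟶ X.left}

/-- The identification of `K` with the function field of `X` is an isomorphism of `k`-algebras,
compatible with the generic points. -/
theorem IsCompleteModel.exists_functionField_algEquiv [IsIntegral X.left]
    (hX : IsCompleteModel X η) :
    ∃ (e : K ≃ₐ[k] X.left.functionField) (g : CommRingCat.of K ⟶ X.left.functionField),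
      (∀ z, g.hom z = e z) ∧ Spec.map g ≫ η = X.left.fromSpecStalk (genericPoint X.left) := by
  obtain ⟨e, he⟩ : ∃ e : X.left.functionField ≅ CommRingCat.of K,
    Spec.map e.hom ≫ X.left.fromSpecStalk (genericPoint X.left) = η := hX.exists_iso
  have h1 : X.left.fromSpecStalk (genericPoint X.left) ≫ X.hom =
      Spec.map (CommRingCat.ofHom (algebraMap k X.left.functionField)) := by
    have h2 : X.hom = X.left.toSpecΓ ≫ Spec.map ((Scheme.ΓSpecIso (CommRingCat.of k)).inv ≫
        X.hom.appTop) := by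
      rw [Spec.map_comp, ← Scheme.toSpecΓ_naturality_assoc, toSpecΓ_SpecMap_ΓSpecIso_inv]
      exact (Category.comp_id _).symm
    rw [h2, Scheme.fromSpecStalk_toSpecΓ_assoc, ← Spec.map_comp]
    congr 1
  have h3 : CommRingCat.ofHom (algebraMap k K) ≫ e.inv =
      CommRingCat.ofHom (algebraMap k X.left.functionField) := by
    apply Spec.map_injective
    rw [← h1, Spec.map_comp, ← hX.comp_hom, ← he, Category.assoc, ← Spec.map_comp_assoc,
      e.hom_inv_id, Spec.map_id, Category.id_comp]
  refine ⟨AlgEquiv.ofRingEquiv (f := e.symm.commRingCatIsoToRingEquiv) fun c =>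
    RingHom.congr_fun (congrArg CommRingCat.Hom.hom h3) c, e.inv, fun _ => rfl, ?_⟩
  rw [← he, ← Spec.map_comp_assoc, e.hom_inv_id, Spec.map_id, Category.id_comp]

namespace IsHyperellipticPair

variable {d : ℕ} {t : k} {w Y : K}

theorem coordHom_comp {K' : Type u} [Field K'] [Algebra k K'] {z U : K'}
    (h : IsHyperellipticPair d t w Y) (h' : IsHyperellipticPair d t z U) (e : K ≃ₐ[k] K')
    (hw : e w = z) (hY : e Y = U) : h'.coordHom = (e : K →+* K').comp h.coordHom := by
  refine RingHom.ext fun x => ?_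
  obtain ⟨p, q, rfl⟩ := exists_hypRing_repr x
  change _ = e _
  simp only [map_add, map_mul, coordHom_of, coordHom_root, hY, ← aeval_algHom_apply, hw]

/-- The functions in `k[w, Y]` are regular at every point of the chart with coordinates `w, Y`. Here
`(z, U)` is the image of `(w, Y)` in the function field of the scheme `X`. -/
theorem exists_stalk_eq_coordHom [IsIntegral X.left] {z U : X.left.functionField}
    (h : IsHyperellipticPair d t w Y) (h' : IsHyperellipticPair d t z U)
    {e : K ≃ₐ[k] X.left.functionField} {g : CommRingCat.of K ⟶ X.left.functionField}
    (hge : ∀ z, g.hom z = e z)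
    (hg : Spec.map g ≫ η = X.left.fromSpecStalk (genericPoint X.left)) (hw : e w = z) (hY : e Y = U)
    (c : Spec (CommRingCat.of (HypRing d t)) ⟶ X.left) [IsOpenImmersion c]
    (hcη : Spec.map (CommRingCat.ofHom h.coordHom) ≫ c = η)
    (q : Spec (CommRingCat.of (HypRing d t))) (b : HypRing d t) :
    ∃ s : X.left.presheaf.stalk (c q),
      algebraMap _ X.left.functionField s = h'.coordHom b := by
  have h1 : h'.coordHom b = e (h.coordHom b) := congr($(h.coordHom_comp h' e hw hY) b)
  rw [h1, ← hge]
  refine exists_stalk_eq c (CommRingCat.ofHom h.coordHom ≫ g) ?_ q b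
  rw [Spec.map_comp, Category.assoc, hcη, hg]

/-- The differentials `a zⁿ dz / U` are regular at every point at which the functions in `k[z, U]`
are. -/
theorem smul_D_mem_span_stalk [IsIntegral X.left] {z U : X.left.functionField}
    (h' : IsHyperellipticPair d t z U) (hsep : (branchPoly d t).Separable) (x : X.left)
    (hx : ∀ b, ∃ s : X.left.presheaf.stalk x,
      algebraMap _ X.left.functionField s = h'.coordHom b) (a : k) (n : ℕ) :
    (algebraMap k X.left.functionField a * z ^ n * U⁻¹) •
      KaehlerDifferential.D k X.left.functionField z ∈ Submodule.span k
        {ω | ∃ a b : X.left.presheaf.stalk x, ω =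
          algebraMap _ X.left.functionField a •
            KaehlerDifferential.D k X.left.functionField
              (algebraMap _ X.left.functionField b)} := by
  refine Submodule.span_mono ?_ (h'.smul_D_mem_span hsep
    (Set.range (algebraMap (X.left.presheaf.stalk x) X.left.functionField)) ?_ a n)
  · rintro _ ⟨_, ⟨a, rfl⟩, _, ⟨b, rfl⟩, rfl⟩
    exact ⟨a, b, rfl⟩
  · rintro _ ⟨b, rfl⟩
    exact hx b

/-- The differentials `dw / Y` and `w dw / Y` are regular on both charts. -/
theorem two_le_genus (h : IsHyperellipticPair d t w Y) (h2 : (2 : k) ≠ 0) (hd : 3 ≤ d)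
    (hsep : (branchPoly d t).Separable) (hX : IsCompleteModel X η) [IsIntegral X.left] :
    2 ≤ genus X := by
  obtain ⟨e, g, hge, hg⟩ := hX.exists_functionField_algEquiv
  obtain ⟨c, c', hc, hc', hcη, hcη', hcover⟩ := h.exists_charts h2 hX
  have h' := h.map e
  let ω (n : Fin 2) : Ω[X.left.functionField⁄k] :=
    (algebraMap k X.left.functionField 1 * e w ^ (n : ℕ) * (e Y)⁻¹) •
      KaehlerDifferential.D k X.left.functionField (e w)
  have hω (n : Fin 2) : ω n ∈ regularDifferentials X := by
    rw [regularDifferentials, Submodule.mem_iInf]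
    intro x
    rcases hcover x with ⟨q, rfl⟩ | ⟨q, rfl⟩
    · exact h'.smul_D_mem_span_stalk hsep _
        (h.exists_stalk_eq_coordHom h' hge hg rfl rfl c hcη q) 1 n
    · have h3 := h'.smul_D_eq_smul_D_inv (n := n) (m := d - 2 - n) (by omega)
      change ω n = _ at h3
      rw [h3]
      exact h'.inv.smul_D_mem_span_stalk hsep _ (h.inv.exists_stalk_eq_coordHom h'.inv hge hg
        (map_inv₀ e w) (by rw [map_div₀, map_pow]) c' hcη' q) _ _
  have hli : LinearIndependent k fun n => (⟨ω n, hω n⟩ : regularDifferentials X) := by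
    refine LinearIndependent.of_comp (regularDifferentials X).subtype ?_
    exact h'.linearIndependent_smul_D h2
  have := hli.cardinal_lift_le_rank
  simpa [genus] using this

theorem isHyperelliptic (h : IsHyperellipticPair d t w Y) (h2 : (2 : k) ≠ 0) (hd : 3 ≤ d)
    (hsep : (branchPoly d t).Separable) (hX : IsCompleteModel X η) : IsHyperelliptic X := by
  obtain ⟨π, hπ, -⟩ := h.exists_isDoubleCover h2 hX
  exact ⟨hX.isIntegral, @two_le_genus _ _ _ _ _ _ _ _ _ _ _ h h2 hd hsep hX hX.isIntegral, π, hπ⟩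

end IsHyperellipticPair

end Genus

end CyclicCover

end

theorem lemma6p2 (p : ℕ) (hp : p.Prime) (hp2 : p ≠ 2)
    (k : Type*) [Field k] [IsAlgClosed k] [CharP k p]
    (d : ℕ) (hd3 : 3 ≤ d) (hd : Odd d) (hpd : ¬ p ∣ d) :
    -- (1) `X_t` is hyperelliptic and birational over `k` to `Y² = W²ᵈ + (2 - 4t) Wᵈ + 1`,
    -- with hyperelliptic involution `(Y, W) ↦ (-Y, W)`
    (∀ t : k, t ≠ 0 → t ≠ 1 →
      CyclicCover.IsHyperelliptic (CyclicCover.curve d t) ∧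
      ∃ e : Scheme.PartialIso (CyclicCover.curve d t).left (CyclicCover.hypCurve d t).left,
        e.IsOver (CyclicCover.curve d t).hom (CyclicCover.hypCurve d t).hom ∧
        ∃ ι : Aut (CyclicCover.curve d t), CyclicCover.IsHyperellipticInvolution ι ∧
          ((Scheme.PartialIso.ofIso ((Over.forget _).mapIso ι)).trans e).toRationalMap =
            e.toRationalMap.compHom (CyclicCover.hypCurveInvolution d t)) ∧
    -- (2) the isomorphism classes
    (∀ t₁ t₂ : k, t₁ ≠ 0 → t₁ ≠ 1 → t₂ ≠ 0 → t₂ ≠ 1 →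
      (Nonempty (CyclicCover.curve d t₁ ≅ CyclicCover.curve d t₂) ↔ t₂ = t₁ ∨ t₂ = 1 - t₁)) ∧
    -- (3) the group `Aut(X_t, τ)`, where `τ` is `(x, y) ↦ (x, ζ y)`
    (∀ t : k, t ≠ 0 → t ≠ 1 → t ≠ 1 / 2 → ∀ ζ : k, IsPrimitiveRoot ζ d →
      (∃ τ : Aut (CyclicCover.curve d t), CyclicCover.IsCyclicAut d t ζ τ) ∧
      ∀ τ : Aut (CyclicCover.curve d t), CyclicCover.IsCyclicAut d t ζ τ →
        Nonempty (CyclicCover.AutNormalizer d t τ ≃*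
          Multiplicative (ZMod 2) × DihedralGroup d)) := by
  have h2 : (2 : k) ≠ 0 := by
    intro h0
    have h1 : ((2 : ℕ) : k) = 0 := by exact_mod_cast h0
    rw [CharP.cast_eq_zero_iff k p] at h1
    exact hp2 ((Nat.prime_dvd_prime_iff_eq hp Nat.prime_two).mp h1)
  have hdk : (d : k) ≠ 0 := by rwa [Ne, CharP.cast_eq_zero_iff k p]
  refine ⟨fun t ht0 ht1 => ?_, fun t₁ t₂ h10 h11 h20 h21 =>
    CyclicCover.nonempty_curve_iso_iff h2 hdk hd3 hd h10 h11 h20 h21,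
    fun t ht0 ht1 ht2 ζ hζ => ?_⟩
  · have := CyclicCover.isDomain_cyclicRing (d := d) (by omega) ht0
    have h := CyclicCover.isHyperellipticPair_cyclicField h2 hdk ht0 ht1
    have hX := CyclicCover.isCompleteModel_curve (d := d) (t := t) hdk
    exact ⟨h.isHyperelliptic h2 hd3 (CyclicCover.separable_branchPoly h2 hdk ht0 ht1) hX,
      h.exists_partialIso h2 hX⟩
  · have := CyclicCover.isDomain_cyclicRing (d := d) (by omega) ht0
    exact ⟨CyclicCover.exists_isCyclicAut h2 hdk ht0 ht1 hζ.pow_eq_one, fun τ hτ =>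
      CyclicCover.nonempty_autNormalizer_mulEquiv h2 hdk hd3 ht0 ht1 ht2 hζ hτ⟩
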